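/- Let $\breve\Omega\subset\mathbb R^3$ be a bounded domain that is invariant under rotation around the $z$-axis, with polygonal half section $\Omega=\{(r,z): r>0,\ (r,0,z)\in\breve\Omega\}$. Let $\Gamma_0$ be the interior (within the axis $r=0$) of the part of $\partial\Omega$ contained in the axis and $\Gamma=\partial\Omega\setminus\Gamma_0$. All functions are complex valued and derivatives are taken in the sense of distributions. $H^1_0(\breve\Omega)$ is the space of $v\in H^1(\breve\Omega)$ with $v=0$ on $\partial\breve\Omega$ (the closure of $C_c^\infty(\breve\Omega)$ in $H^1(\breve\Omega)$), and $(H^1_0(\breve\Omega))^3$ carries the semi-norm $|\vec v|_{(H^1(\breve\Omega))^3}=\bigl(\sum_{i,j}\|\partial_j v_i\|^2_{L^2(\breve\Omega)}\bigr)^{1/2}$. For $\alpha=\pm1$ let $\|v\|_{L^2_\alpha(\Omega)}^2=\int_\Omega|v|^2r^\alpha\,dr\,dz$; let $H^1_1(\Omega)$ be the space of $v\in L^2_1(\Omega)$ with $\partial_rv,\partial_zv\in L^2_1(\Omega)$, with $|v|^2_{H^1_1(\Omega)}=\|\partial_rv\|^2_{L^2_1(\Omega)}+\|\partial_zv\|^2_{L^2_1(\Omega)}$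 and $\|v\|^2_{H^1_1(\Omega)}=\|v\|^2_{L^2_1(\Omega)}+|v|^2_{H^1_1(\Omega)}$; and let $V^1_1(\Omega)=H^1_1(\Omega)\cap L^2_{-1}(\Omega)$ with $\|v\|^2_{V^1_1(\Omega)}=\|v\|^2_{L^2_{-1}(\Omega)}+|v|^2_{H^1_1(\Omega)}$. The subspaces $H^1_{1\diamond}(\Omega)$ and $V^1_{1\diamond}(\Omega)$ consist of the functions with $v=0$ on $\Gamma$ (i.e. in the closure in $H^1_1(\Omega)$ of the smooth functions vanishing near $\Gamma$). For $k\in\mathbb Z$ and $\vec v=(v_r,v_\theta,v_z)$ put $$|\vec v|^2_{\boldsymbol H^1_{(k)}(\Omega)}=\int_\Omega\Bigl(\sum_{i\in\{r,\theta,z\}}\bigl(|\partial_rv_i|^2+|\partial_zv_i|^2\bigr)+\tfrac{1+k^2}{r^2}\bigl(|v_r|^2+|v_\theta|^2\bigr)+\tfrac{k^2}{r^2}|v_z|^2+\tfrac{2ik}{r^2}\bigl(v_\theta\bar v_r-v_r\bar v_\theta\bigr)\Bigr)r\,dr\,dz ,$$ let $\boldsymbol H^1_{(k)}(\Omega)$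 be the space of triples for which $\|\vec v\|^2_{(L^2_1(\Omega))^3}+|\vec v|^2_{\boldsymbol H^1_{(k)}(\Omega)}$ is finite (that is, $\vec v\in(H^1_1(\Omega))^3$ and the terms of order zero in the integral have a finite integral), and let $\boldsymbol H^1_{(k)\diamond}(\Omega)=\boldsymbol H^1_{(k)}(\Omega)\cap(H^1_{1\diamond}(\Omega))^3$. For a vector field $\vec{\breve v}$ on $\breve\Omega$ with cylindrical components $\vec v=(v_r,v_\theta,v_z)$ let $$\vec v^k(r,z)=\frac1{\sqrt{2\pi}}\int_{-\pi}^{\pi}\vec v(r,\theta,z)e^{-ik\theta}\,d\theta .$$ Then $|\cdot|_{(H^1(\breve\Omega))^3}$ and $|\cdot|_{\boldsymbol H^1_{(k)}(\Omega)}$ are definite on $(H^1_0(\breve\Omega))^3$ and $\boldsymbol H^1_{(k)\diamond}(\Omega)$, and the map $\vec{\breve v}\mapsto(\vec v^k)_{k\in\mathbb Z}$ is a well-defined isometric isomorphism (linear and bijective, functions being identified when they agree almost everywhere) from $(H^1_0(\breve\Omega))^3$ onto the $\ell_2$-sum $\bigoplus_2\{\boldsymbol H^1_{(k)\diamond}(\Omega):k\in\mathbb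 Z\}$: $$|\vec{\breve v}|_{(H^1(\breve\Omega))^3}=\Bigl(\sum_{k\in\mathbb Z}|\vec v^k|^2_{\boldsymbol H^1_{(k)}(\Omega)}\Bigr)^{1/2}.$$ Moreover: * for $k=0$, $\boldsymbol H^1_{(0)\diamond}(\Omega)=V^1_{1\diamond}(\Omega)\times V^1_{1\diamond}(\Omega)\times H^1_{1\diamond}(\Omega)$ and $|\vec v|^2_{\boldsymbol H^1_{(0)}(\Omega)}=\|v_r\|^2_{V^1_1(\Omega)}+\|v_\theta\|^2_{V^1_1(\Omega)}+|v_z|^2_{H^1_1(\Omega)}$ there; * for $|k|=1$, $\boldsymbol H^1_{(k)\diamond}(\Omega)=\{\vec v\in H^1_{1\diamond}(\Omega)\times H^1_{1\diamond}(\Omega)\times V^1_{1\diamond}(\Omega): v_r+ikv_\theta\in L^2_{-1}(\Omega)\}$ and $|\vec v|^2_{\boldsymbol H^1_{(k)}(\Omega)}=|v_r|^2_{H^1_1(\Omega)}+|v_\theta|^2_{H^1_1(\Omega)}+\|v_z\|^2_{V^1_1(\Omega)}+2\|v_r+ikv_\theta\|^2_{L^2_{-1}(\Omega)}$ there; * for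 $|k|\ge2$, $\boldsymbol H^1_{(k)\diamond}(\Omega)=(V^1_{1\diamond}(\Omega))^3$ and $|\vec v|^2_{\boldsymbol H^1_{(k)}(\Omega)}=|\vec v|^2_{(H^1_1(\Omega))^3}+(1+k^2)\bigl(\|v_r\|^2_{L^2_{-1}(\Omega)}+\|v_\theta\|^2_{L^2_{-1}(\Omega)}\bigr)+k^2\|v_z\|^2_{L^2_{-1}(\Omega)}+2ik\int_\Omega(v_\theta\bar v_r-v_r\bar v_\theta)\frac1r\,dr\,dz$ there; and $\frac12|\vec v|_{\boldsymbol H^1_{(k)*}(\Omega)}\le|\vec v|_{\boldsymbol H^1_{(k)}(\Omega)}\le\frac32|\vec v|_{\boldsymbol H^1_{(k)*}(\Omega)}$ with the equivalent norm $|\vec v|^2_{\boldsymbol H^1_{(k)*}(\Omega)}=|\vec v|^2_{(H^1_1(\Omega))^3}+k^2\|\vec v\|^2_{(L^2_{-1}(\Omega))^3}$. -/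

import Mathlib

open MeasureTheory Set
open scoped ContDiff ComplexConjugate

noncomputable section

namespace Axisym

/-- Cartesian space, a point being written `((x, y), z)`. -/
abbrev Space : Type := (ℝ × ℝ) × ℝ

/-- The meridian plane, a point being written `(r, z)`. -/
abbrev Plane : Type := ℝ × ℝ

/-- A triple of scalar functions on space, with components `x, y, z`. -/
abbrev Field3 : Type := Fin 3 → Space → ℂ

/-- A triple of scalar functions on the meridian plane, with components `r, θ, z`. -/
abbrev Field2 : Type := Fin 3 → Plane → ℂ

/-! ### Axisymmetric domains -/

/-- Rotation by the angle `θ` around the `z`-axis. -/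
def rot (θ : ℝ) (p : Space) : Space :=
  ((Real.cos θ * p.1.1 - Real.sin θ * p.1.2, Real.sin θ * p.1.1 + Real.cos θ * p.1.2), p.2)

/-- The half section (meridian domain) of a set `D`. -/
def halfSection (D : Set Space) : Set Plane :=
  {p | 0 < p.1 ∧ ((p.1, 0), p.2) ∈ D}

/-- A planar set is polygonal when its boundary is a finite union of closed line segments. -/
def IsPolygonal (Ω : Set Plane) : Prop :=
  ∃ S : Finset (Plane × Plane), frontier Ω = ⋃ s ∈ S, segment ℝ s.1 s.2

/-- Bounded axisymmetric domains with polygonal half section. -/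
structure IsAxisymmetricDomain (D : Set Space) : Prop where
  isOpen : IsOpen D
  isConnected : IsConnected D
  isBounded : Bornology.IsBounded D
  rot_mem : ∀ θ : ℝ, ∀ p ∈ D, rot θ p ∈ D
  isPolygonal : IsPolygonal (halfSection D)

/-- `Γ₀`: the interior (within the axis `r = 0`) of the part of the boundary of `Ω` that is
contained in the axis. -/
def axisBoundary (Ω : Set Plane) : Set Plane :=
  {p | p.1 = 0 ∧ p.2 ∈ interior {z : ℝ | ((0 : ℝ), z) ∈ frontier Ω}}

/-- `Γ`: the rest of the boundary of `Ω`. -/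
def outerBoundary (Ω : Set Plane) : Set Plane :=
  frontier Ω \ axisBoundary Ω

/-! ### Weak derivatives -/

/-- On the open set `U`, the function `g` is the derivative of `u` in the direction `e` in the
sense of distributions. -/
def HasWeakDeriv {E : Type*} [NormedAddCommGroup E] [NormedSpace ℝ E] [MeasureSpace E]
    (U : Set E) (e : E) (u g : E → ℂ) : Prop :=
  LocallyIntegrableOn u U ∧ LocallyIntegrableOn g U ∧
    ∀ φ : E → ℝ, ContDiff ℝ ∞ φ → HasCompactSupport φ → tsupport φ ⊆ U →
      ∫ x in U, (fderiv ℝ φ x e) • u x = - ∫ x in U, φ x • g x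

open Classical in
/-- The weak derivative of `u` in the direction `e`; it is determined almost everywhere on `U`,
and it is `0` by convention when there is none. -/
def weakDeriv {E : Type*} [NormedAddCommGroup E] [NormedSpace ℝ E] [MeasureSpace E]
    (U : Set E) (e : E) (u : E → ℂ) : E → ℂ :=
  if h : ∃ g : E → ℂ, HasWeakDeriv U e u g then h.choose else 0

/-! ### Sobolev spaces on the three-dimensional domain -/

/-- The unit vectors in the directions `x, y, z`. -/
def cart : Fin 3 → Space := ![((1, 0), 0), ((0, 1), 0), ((0, 0), 1)]

/-- `u ∈ H¹(D)`. -/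
def MemH1 (D : Set Space) (u : Space → ℂ) : Prop :=
  MemLp u 2 (volume.restrict D) ∧
    ∀ j : Fin 3, ∃ g : Space → ℂ,
      HasWeakDeriv D (cart j) u g ∧ MemLp g 2 (volume.restrict D)

/-- The square of the semi-norm of `H¹(D)`. -/
def h1SemiSq (D : Set Space) (u : Space → ℂ) : ℝ :=
  ∑ j : Fin 3, ∫ p in D, ‖weakDeriv D (cart j) u p‖ ^ 2

/-- The square of the norm of `H¹(D)`. -/
def h1NormSq (D : Set Space) (u : Space → ℂ) : ℝ :=
  (∫ p in D, ‖u p‖ ^ 2) + h1SemiSq D u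

/-- `u ∈ H¹₀(D)`: the function `u` vanishes on the boundary of `D`, in the sense that it lies in
the closure in `H¹(D)` of the smooth functions with compact support in `D`. -/
def MemH10 (D : Set Space) (u : Space → ℂ) : Prop :=
  MemH1 D u ∧ ∀ ε > 0, ∃ φ : Space → ℂ,
    ContDiff ℝ ∞ φ ∧ HasCompactSupport φ ∧ tsupport φ ⊆ D ∧ h1NormSq D (u - φ) < ε

/-- `v ∈ (H¹₀(D))³`. -/
def MemH10Vec (D : Set Space) (v : Field3) : Prop :=
  ∀ i, MemH10 D (v i)

/-- The semi-norm of `(H¹(D))³`. -/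
def h1Semi (D : Set Space) (v : Field3) : ℝ :=
  √(∑ i, h1SemiSq D (v i))

/-! ### Weighted Sobolev spaces on the half section -/

/-- `u ∈ L²_α(Ω)`: square integrability with the weight `r ^ α`. -/
def MemL2w (α : ℤ) (Ω : Set Plane) (u : Plane → ℂ) : Prop :=
  AEStronglyMeasurable u (volume.restrict Ω) ∧
    IntegrableOn (fun p : Plane => ‖u p‖ ^ 2 * p.1 ^ α) Ω

/-- The square of the norm of `L²_α(Ω)`. -/
def l2wNormSq (α : ℤ) (Ω : Set Plane) (u : Plane → ℂ) : ℝ :=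
  ∫ p in Ω, ‖u p‖ ^ 2 * p.1 ^ α

/-- The weak derivative with respect to `r`. -/
def dr (Ω : Set Plane) (u : Plane → ℂ) : Plane → ℂ := weakDeriv Ω (1, 0) u

/-- The weak derivative with respect to `z`. -/
def dz (Ω : Set Plane) (u : Plane → ℂ) : Plane → ℂ := weakDeriv Ω (0, 1) u

/-- `u ∈ H¹₁(Ω)`. -/
def MemH11 (Ω : Set Plane) (u : Plane → ℂ) : Prop :=
  MemL2w 1 Ω u ∧
    (∃ g : Plane → ℂ, HasWeakDeriv Ω (1, 0) u g ∧ MemL2w 1 Ω g) ∧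
    (∃ g : Plane → ℂ, HasWeakDeriv Ω (0, 1) u g ∧ MemL2w 1 Ω g)

/-- The square of the semi-norm of `H¹₁(Ω)`. -/
def h11SemiSq (Ω : Set Plane) (u : Plane → ℂ) : ℝ :=
  l2wNormSq 1 Ω (dr Ω u) + l2wNormSq 1 Ω (dz Ω u)

/-- The square of the norm of `H¹₁(Ω)`. -/
def h11NormSq (Ω : Set Plane) (u : Plane → ℂ) : ℝ :=
  l2wNormSq 1 Ω u + h11SemiSq Ω u

/-- `u ∈ V¹₁(Ω) = H¹₁(Ω) ∩ L²₋₁(Ω)`. -/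
def MemV11 (Ω : Set Plane) (u : Plane → ℂ) : Prop :=
  MemH11 Ω u ∧ MemL2w (-1) Ω u

/-- The square of the norm of `V¹₁(Ω)`. -/
def v11NormSq (Ω : Set Plane) (u : Plane → ℂ) : ℝ :=
  l2wNormSq (-1) Ω u + h11SemiSq Ω u

/-- `u = 0` on `Γ`, for `u ∈ H¹₁(Ω)`: the function `u` lies in the closure in `H¹₁(Ω)` of the
smooth functions that vanish in a neighbourhood of `Γ`. -/
def VanishesOnOuter (Ω : Set Plane) (u : Plane → ℂ) : Prop :=
  ∀ ε > 0, ∃ φ : Plane → ℂ,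
    ContDiff ℝ ∞ φ ∧ HasCompactSupport φ ∧ Disjoint (tsupport φ) (outerBoundary Ω) ∧
      h11NormSq Ω (u - φ) < ε

/-- `u ∈ H¹₁(Ω)` with `u = 0` on `Γ`. -/
def MemH11Diamond (Ω : Set Plane) (u : Plane → ℂ) : Prop :=
  MemH11 Ω u ∧ VanishesOnOuter Ω u

/-- `u ∈ V¹₁(Ω)` with `u = 0` on `Γ`. -/
def MemV11Diamond (Ω : Set Plane) (u : Plane → ℂ) : Prop :=
  MemV11 Ω u ∧ VanishesOnOuter Ω u

/-! ### The spaces of Fourier coefficients -/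

/-- The terms of order zero of the semi-norm for the wavenumber `k`:
`(1 + k²)/r² (|v_r|² + |v_θ|²) + k²/r² |v_z|² + 2ik/r² (v_θ conj v_r - v_r conj v_θ)`,
the last term being real. -/
def modeDensity (k : ℤ) (v : Field2) (p : Plane) : ℝ :=
  (1 + (k : ℝ) ^ 2) / p.1 ^ 2 * (‖v 0 p‖ ^ 2 + ‖v 1 p‖ ^ 2)
    + (k : ℝ) ^ 2 / p.1 ^ 2 * ‖v 2 p‖ ^ 2
    + (2 * Complex.I * (k : ℂ) / ((p.1 : ℝ) : ℂ) ^ 2 *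
        (v 1 p * conj (v 0 p) - v 0 p * conj (v 1 p))).re

/-- `v ∈ H¹_(k)(Ω)`: all terms of the norm
`‖v‖² = ∫ (∑ |vᵢ|² + ∑ (|∂_r vᵢ|² + |∂_z vᵢ|²) + modeDensity k v) r dr dz` are finite. -/
def MemHk (Ω : Set Plane) (k : ℤ) (v : Field2) : Prop :=
  (∀ i, MemH11 Ω (v i)) ∧ IntegrableOn (fun p : Plane => modeDensity k v p * p.1) Ω

/-- The semi-norm of `H¹_(k)(Ω)`. -/
def hkSemi (Ω : Set Plane) (k : ℤ) (v : Field2) : ℝ :=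
  √(∫ p in Ω,
    ((∑ i, (‖dr Ω (v i) p‖ ^ 2 + ‖dz Ω (v i) p‖ ^ 2)) + modeDensity k v p) * p.1)

/-- `v ∈ H¹_(k)◇(Ω)`, the functions in `H¹_(k)(Ω)` that vanish on `Γ`. -/
def MemHkDiamond (Ω : Set Plane) (k : ℤ) (v : Field2) : Prop :=
  MemHk Ω k v ∧ ∀ i, MemH11Diamond Ω (v i)

/-- The norm that is used alternatively for `|k| ≥ 2`. -/
def hkStarSemi (Ω : Set Plane) (k : ℤ) (v : Field2) : ℝ :=
  √((∑ i, h11SemiSq Ω (v i)) + (k : ℝ) ^ 2 * ∑ i, l2wNormSq (-1) Ω (v i))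

/-- The sequence `w` belongs to the `ℓ²`-sum of the spaces `H¹_(k)◇(Ω)`, `k ∈ ℤ`. -/
def MemL2Sum (Ω : Set Plane) (w : ℤ → Field2) : Prop :=
  (∀ k, MemHkDiamond Ω k (w k)) ∧ Summable fun k => hkSemi Ω k (w k) ^ 2

/-- The norm of the `ℓ²`-sum. -/
def l2SumNorm (Ω : Set Plane) (w : ℤ → Field2) : ℝ :=
  √(∑' k, hkSemi Ω k (w k) ^ 2)

/-! ### Fourier coefficients -/

/-- The cylindrical components `(v_r, v_θ, v_z)`, at the point with cylindrical coordinates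
`(r, θ, z)`, of the vector field with Cartesian components `v`. -/
def cylComp (v : Field3) (r θ z : ℝ) : Fin 3 → ℂ :=
  let p : Space := ((r * Real.cos θ, r * Real.sin θ), z)
  ![Real.cos θ * v 0 p + Real.sin θ * v 1 p,
    -Real.sin θ * v 0 p + Real.cos θ * v 1 p,
    v 2 p]

/-- The Fourier coefficients `v^k = (v_r^k, v_θ^k, v_z^k)` of a vector field, normalized by
`(v_r, v_θ, v_z) = (2π)^(-1/2) ∑ v^k e^(ikθ)`. -/
def fourierCoef (v : Field3) (k : ℤ) : Field2 := fun i p =>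
  ((√(2 * Real.pi) : ℝ) : ℂ)⁻¹ *
    ∫ θ in (-Real.pi)..Real.pi,
      cylComp v p.1 θ p.2 i * Complex.exp (-(Complex.I * (k : ℂ) * (θ : ℂ)))

end Axisym

end

open Axisym

noncomputable section

set_option linter.unusedSectionVars false

namespace Axisym

open Filter Topology
open scoped ENNReal NNReal

/-! ### Calculus of weak derivatives and their limits -/

section WeakDerivative

variable {E : Type*} [NormedAddCommGroup E] [NormedSpace ℝ E] [MeasureSpace E]
  {U : Set E} {e : E} {u v g h : E → ℂ}

/-! The vector problem decouples into scalar ones. Since `v_r ± i v_θ = e^{∓iθ} (v_x ± i v_y)`, the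
function `v_r^k + i v_θ^k` is the Fourier coefficient of index `k + 1` of the scalar function `v_x +
i v_y`, and `v_r^k - i v_θ^k` is that of index `k - 1` of `v_x - i v_y`. The same combinations
diagonalise the terms of order zero: they equal `((1+k)²/2 |v_r + i v_θ|² + (1-k)²/2 |v_r - i v_θ|²
+ k² |v_z|²) / r²` (`modeDensity_mul`). So `hkSemi` is a sum of three scalar norms `modeSq` of
indices `k + 1`, `k - 1`, `k` (`hkSemi_sq`). The explicit descriptions for `k = 0`, `|k| = 1`, `|k|
≥ 2` record which of these three indices are zero.

There remains the scalar statement: `u ↦ (mode m u)` is an isometry of `H¹₀(D)` onto the square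
summable sequences with `m`-th term in `MemMode`, with squared norm `|w|²_{H¹₁} + m² ‖w‖²_{L²₋₁}`.
For the isometry (`hasSum_modeSq`), the gradient is split into radial, angular and axial parts and
Parseval's identity is applied to each on almost every circle. Integration by parts on the circle
makes the `m`-th mode of the angular part equal to `(im/r)` times that of `u`, which produces the
weight `r⁻¹`. These identities are proved for test functions and pass to limits because taking a
mode is a contraction of `L²`.

For surjectivity, test functions supported inside the half section, hence away from the axis, are
dense in every mode space (`exists_isTest`). If `m = 0`, the axis can be cut out at small cost
because it has zero capacity (`exists_isCutoff`, a logarithmic cutoff); if `m ≠ 0`, membership in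
`L²₋₁` controls the cutoff. A test function `ψ(r, z)` lifts to the test function `(2π)^{-1/2} ψ
e^{imθ}` on `D`, and the isometry already proved computes its norm. By the Poincaré inequality,
`H¹₀(D)` is complete for the semi-norm, so limits of lifts give all single modes, and limits of
their finite sums give all square summable sequences. Definiteness in the half section is pulled
back from definiteness in `D` in the same way. -/

theorem integrableOn_test_smul [BorelSpace E] (hu : LocallyIntegrableOn u U)
    {φ : E → ℝ} (hφ : Continuous φ) (hc : HasCompactSupport φ) (hs : tsupport φ ⊆ U) :
    IntegrableOn (fun x => φ x • u x) U := by
  have h1 : IntegrableOn (fun x => φ x • u x) (tsupport φ) :=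
    (hu.integrableOn_compact_subset hs hc).continuousOn_smul hφ.continuousOn hc
  refine Integrable.integrableOn ?_
  rw [← integrableOn_iff_integrable_of_support_subset (s := tsupport φ)]
  · exact h1
  · intro x hx
    apply subset_tsupport
    intro h0
    simp [h0] at hx

theorem continuous_fderiv_apply_of_contDiff {F : Type*} [NormedAddCommGroup F] [NormedSpace ℝ F]
    {φ : E → F} (hφ : ContDiff ℝ ∞ φ) (e : E) : Continuous (fun x => fderiv ℝ φ x e) :=
  (hφ.continuous_fderiv (by simp)).clm_apply continuous_const

theorem HasWeakDeriv.integrableOn_left [BorelSpace E] (hu : HasWeakDeriv U e u g) {φ : E → ℝ}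
    (hφ : ContDiff ℝ ∞ φ) (hc : HasCompactSupport φ) (hs : tsupport φ ⊆ U) :
    IntegrableOn (fun x => fderiv ℝ φ x e • u x) U :=
  integrableOn_test_smul hu.1 (continuous_fderiv_apply_of_contDiff hφ e)
    (HasCompactSupport.fderiv_apply ℝ hc e) ((tsupport_fderiv_apply_subset ℝ e).trans hs)

theorem HasWeakDeriv.integrableOn_right [BorelSpace E] (hu : HasWeakDeriv U e u g) {φ : E → ℝ}
    (hφ : ContDiff ℝ ∞ φ) (hc : HasCompactSupport φ) (hs : tsupport φ ⊆ U) :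
    IntegrableOn (fun x => φ x • g x) U :=
  integrableOn_test_smul hu.2.1 hφ.continuous hc hs

theorem HasWeakDeriv.congr (hu : HasWeakDeriv U e u g) (huv : u =ᵐ[volume.restrict U] v)
    (hgh : g =ᵐ[volume.restrict U] h) : HasWeakDeriv U e v h := by
  refine ⟨hu.1.congr huv, hu.2.1.congr hgh, fun φ hφ hc hs => ?_⟩
  have h1 : ∫ x in U, fderiv ℝ φ x e • v x = ∫ x in U, fderiv ℝ φ x e • u x :=
    integral_congr_ae (by filter_upwards [huv] with x hx; rw [hx])
  have h2 : ∫ x in U, φ x • h x = ∫ x in U, φ x • g x :=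
    integral_congr_ae (by filter_upwards [hgh] with x hx; rw [hx])
  rw [h1, h2, hu.2.2 φ hφ hc hs]

theorem HasWeakDeriv.add [BorelSpace E] (hu : HasWeakDeriv U e u g) (hv : HasWeakDeriv U e v h) :
    HasWeakDeriv U e (u + v) (g + h) := by
  refine ⟨hu.1.add hv.1, hu.2.1.add hv.2.1, fun φ hφ hc hs => ?_⟩
  simp only [Pi.add_apply, smul_add]
  rw [integral_add (hu.integrableOn_left hφ hc hs) (hv.integrableOn_left hφ hc hs),
    integral_add (hu.integrableOn_right hφ hc hs) (hv.integrableOn_right hφ hc hs),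
    hu.2.2 φ hφ hc hs, hv.2.2 φ hφ hc hs, neg_add]

theorem HasWeakDeriv.const_smul (hu : HasWeakDeriv U e u g) (c : ℂ) :
    HasWeakDeriv U e (c • u) (c • g) := by
  refine ⟨hu.1.smul c, hu.2.1.smul c, fun φ hφ hc hs => ?_⟩
  have h1 : ∀ (a : ℝ) (z : ℂ), a • (c • z) = c • (a • z) := fun a z => smul_comm _ _ _
  simp only [Pi.smul_apply, h1]
  rw [integral_smul, integral_smul, hu.2.2 φ hφ hc hs, smul_neg]

theorem HasWeakDeriv.sub [BorelSpace E] (hu : HasWeakDeriv U e u g) (hv : HasWeakDeriv U e v h) :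
    HasWeakDeriv U e (u - v) (g - h) := by
  have := hu.add (hv.const_smul (-1))
  simpa [sub_eq_add_neg] using this

/-- The difference is orthogonal to all test functions, hence zero almost everywhere. Thus the
choice made in `weakDeriv` may be replaced by any derivative that is known explicitly. -/
theorem HasWeakDeriv.unique [BorelSpace E] [FiniteDimensional ℝ E] (hU : IsOpen U)
    (hg : HasWeakDeriv U e u g) (hh : HasWeakDeriv U e u h) : g =ᵐ[volume.restrict U] h := by
  have key := hU.ae_eq_zero_of_integral_contDiff_smul_eq_zero (f := g - h) (hg.2.1.sub hh.2.1)
    (fun φ hφ hc hs => by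
      have h0 : ∫ x, φ x • (g - h) x = ∫ x in U, φ x • (g - h) x := by
        rw [setIntegral_eq_integral_of_forall_compl_eq_zero]
        intro x hx
        rw [image_eq_zero_of_notMem_tsupport (fun h => hx (hs h)), zero_smul]
      rw [h0]
      simp only [Pi.sub_apply, smul_sub]
      rw [integral_sub (hg.integrableOn_right hφ hc hs) (hh.integrableOn_right hφ hc hs)]
      have h1 := hg.2.2 φ hφ hc hs
      have h2 := hh.2.2 φ hφ hc hs
      rw [h1, neg_inj] at h2
      rw [h2, sub_self])
  rw [EventuallyEq, ae_restrict_iff' hU.measurableSet]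
  filter_upwards [key] with x hx hxU
  simpa [sub_eq_zero] using hx hxU

theorem HasWeakDeriv.weakDeriv_spec (hg : HasWeakDeriv U e u g) :
    HasWeakDeriv U e u (weakDeriv U e u) := by
  have hex : ∃ g : E → ℂ, HasWeakDeriv U e u g := ⟨g, hg⟩
  rw [weakDeriv, dif_pos hex]
  exact hex.choose_spec

theorem HasWeakDeriv.weakDeriv_ae_eq [BorelSpace E] [FiniteDimensional ℝ E] (hU : IsOpen U)
    (hg : HasWeakDeriv U e u g) : weakDeriv U e u =ᵐ[volume.restrict U] g :=
  hg.weakDeriv_spec.unique hU hg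

/-- The integrands vanish off the support of the test function, so both integrals extend to the
whole space, where integration by parts has no boundary term. -/
theorem hasWeakDeriv_of_contDiff [BorelSpace E] [FiniteDimensional ℝ E]
    [(volume : Measure E).IsAddHaarMeasure] {f : E → ℂ} (hf : ContDiff ℝ ∞ f) (U : Set E) (e : E) :
    HasWeakDeriv U e f (fun x => fderiv ℝ f x e) := by
  have hf' := continuous_fderiv_apply_of_contDiff hf e
  refine ⟨hf.continuous.locallyIntegrable.locallyIntegrableOn _,
    hf'.locallyIntegrable.locallyIntegrableOn _, fun φ hφ hc hs => ?_⟩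
  have e1 : ∫ x in U, fderiv ℝ φ x e • f x = ∫ x, fderiv ℝ φ x e • f x := by
    rw [setIntegral_eq_integral_of_forall_compl_eq_zero]
    intro x hx
    rw [image_eq_zero_of_notMem_tsupport
      (fun h => hx (hs (tsupport_fderiv_apply_subset ℝ e h))), zero_smul]
  have e2 : ∫ x in U, φ x • fderiv ℝ f x e = ∫ x, φ x • fderiv ℝ f x e := by
    rw [setIntegral_eq_integral_of_forall_compl_eq_zero]
    intro x hx
    rw [image_eq_zero_of_notMem_tsupport (fun h => hx (hs h)), zero_smul]
  rw [e1, e2, integral_smul_fderiv_eq_neg_fderiv_smul_of_integrable, neg_neg]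
  · exact hf.continuous.locallyIntegrable.integrable_smul_left_of_hasCompactSupport
      (continuous_fderiv_apply_of_contDiff hφ e) (HasCompactSupport.fderiv_apply ℝ hc e)
  · exact hf'.locallyIntegrable.integrable_smul_left_of_hasCompactSupport hφ.continuous hc
  · exact hf.continuous.locallyIntegrable.integrable_smul_left_of_hasCompactSupport
      hφ.continuous hc
  · exact fun x _ => (hφ.differentiable (by simp)).differentiableAt
  · exact fun x _ => (hf.differentiable (by simp)).differentiableAt

/-- The product of a weakly differentiable function with a smooth real function. -/
theorem HasWeakDeriv.smooth_smul [BorelSpace E] [FiniteDimensional ℝ E] (hU : IsOpen U)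
    (hu : HasWeakDeriv U e u g) {χ : E → ℝ} (hχ : ContDiff ℝ ∞ χ) :
    HasWeakDeriv U e (fun x => χ x • u x) (fun x => χ x • g x + fderiv ℝ χ x e • u x) := by
  have hloc : ∀ {w : E → ℂ} {a : E → ℝ}, Continuous a → LocallyIntegrableOn w U →
      LocallyIntegrableOn (fun x => a x • w x) U := fun ha hw =>
    hw.continuousOn_smul hU.isLocallyClosed ha.continuousOn
  have hχ' := continuous_fderiv_apply_of_contDiff hχ e
  have l1 := hloc hχ.continuous hu.1
  have l2 := hloc hχ.continuous hu.2.1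
  have l3 := hloc hχ' hu.1
  refine ⟨l1, l2.add l3, fun φ hφ hc hs => ?_⟩
  -- The hypothesis on `u` is tested against `φ χ`, and the Leibniz rule gives the extra term.
  have hp : ContDiff ℝ ∞ (fun x => φ x * χ x) := hφ.mul hχ
  have hpc : HasCompactSupport (fun x => φ x * χ x) := hc.mul_right
  have hps : tsupport (fun x => φ x * χ x) ⊆ U := (tsupport_mul_subset_left).trans hs
  have key := hu.2.2 _ hp hpc hps
  have hd : ∀ x, fderiv ℝ (fun x => φ x * χ x) x e
      = φ x * fderiv ℝ χ x e + χ x * fderiv ℝ φ x e := fun x => by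
    rw [fderiv_fun_mul (hφ.differentiable (by simp)).differentiableAt
      (hχ.differentiable (by simp)).differentiableAt]
    simp
  have i1 : IntegrableOn (fun x => fderiv ℝ φ x e • (χ x • u x)) U :=
    integrableOn_test_smul l1 (continuous_fderiv_apply_of_contDiff hφ e)
      (HasCompactSupport.fderiv_apply ℝ hc e) ((tsupport_fderiv_apply_subset ℝ e).trans hs)
  have i2 : IntegrableOn (fun x => φ x • (χ x • g x)) U :=
    integrableOn_test_smul l2 hφ.continuous hc hs
  have i3 : IntegrableOn (fun x => φ x • (fderiv ℝ χ x e • u x)) U :=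
    integrableOn_test_smul l3 hφ.continuous hc hs
  have k1 : ∫ x in U, fderiv ℝ (fun x => φ x * χ x) x e • u x
      = (∫ x in U, φ x • (fderiv ℝ χ x e • u x)) + ∫ x in U, fderiv ℝ φ x e • (χ x • u x) := by
    rw [← integral_add i3 i1]
    congr 1; ext x
    rw [hd, add_smul, smul_smul, smul_smul, mul_comm (χ x)]
  have k2 : ∫ x in U, (φ x * χ x) • g x = ∫ x in U, φ x • (χ x • g x) := by
    simp only [smul_smul]
  rw [k1, k2] at key
  simp only [smul_add]
  rw [integral_add i2 i3, neg_add, ← key]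
  abel

/-- The measure `ν` controls the volume on compact subsets of `U`. -/
def DominatesVolumeOn (ν : Measure E) (U : Set E) : Prop :=
  ∀ K ⊆ U, IsCompact K → ∃ C : ℝ≥0∞, C ≠ ⊤ ∧ volume.restrict K ≤ C • ν

theorem dominatesVolumeOn_restrict : DominatesVolumeOn (volume.restrict U) U :=
  fun K hK _ => ⟨1, by simp, by simpa using Measure.restrict_mono_set volume hK⟩

theorem DominatesVolumeOn.memLp {ν : Measure E} (hν : DominatesVolumeOn ν U) {K : Set E}
    (hK : K ⊆ U) (hc : IsCompact K) (hu : MemLp u 2 ν) : MemLp u 2 (volume.restrict K) := by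
  obtain ⟨C, hC, hle⟩ := hν K hK hc
  exact hu.of_measure_le_smul hC hle

theorem DominatesVolumeOn.locallyIntegrableOn [BorelSpace E] [FiniteDimensional ℝ E]
    [IsFiniteMeasureOnCompacts (volume : Measure E)]
    {ν : Measure E} (hν : DominatesVolumeOn ν U) (hU : IsOpen U)
    (hu : MemLp u 2 ν) : LocallyIntegrableOn u U := by
  rw [locallyIntegrableOn_iff hU.isLocallyClosed]
  intro K hK hc
  have : IsFiniteMeasure (volume.restrict K) := ⟨by simpa using hc.measure_lt_top⟩
  exact (hν.memLp hK hc hu).integrable (by norm_num)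

/-- Cauchy–Schwarz on the compact support of `φ`. Formulating it for a dominating measure covers
both the volume on `D` and the weight `r^α`, which degenerates only at the axis. -/
theorem DominatesVolumeOn.tendsto_integral [BorelSpace E] [FiniteDimensional ℝ E]
    [IsFiniteMeasureOnCompacts (volume : Measure E)]
    {ν : Measure E} (hν : DominatesVolumeOn ν U) (hU : IsOpen U) {us : ℕ → E → ℂ}
    (hus : ∀ n, MemLp (us n) 2 ν) (hu : MemLp u 2 ν)
    (hlim : Tendsto (fun n => eLpNorm (us n - u) 2 ν) atTop (𝓝 0))
    {φ : E → ℝ} (hφ : Continuous φ) (hc : HasCompactSupport φ) (hs : tsupport φ ⊆ U) :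
    Tendsto (fun n => ∫ x in U, φ x • us n x) atTop (𝓝 (∫ x in U, φ x • u x)) := by
  have hi : ∀ {w : E → ℂ}, MemLp w 2 ν → IntegrableOn (fun x => φ x • w x) U := fun hw =>
    integrableOn_test_smul (hν.locallyIntegrableOn hU hw) hφ hc hs
  obtain ⟨C, hC, hle⟩ := hν _ hs hc
  obtain ⟨B, hB⟩ := hc.exists_bound_of_continuous hφ
  have hfin : IsFiniteMeasure (volume.restrict (tsupport φ)) :=
    ⟨by simpa using IsCompact.measure_lt_top hc⟩
  refine tendsto_integral_of_L1 _ (hi hu).aestronglyMeasurable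
    (Eventually.of_forall fun n => hi (hus n)) ?_
  -- The bound of `φ`, the cost `C^{1/2}` of passing from volume to `ν` in the `L²` norm, and the
  -- Cauchy–Schwarz factor, the square root of the volume of the support.
  set M : ℝ≥0∞ := ENNReal.ofReal B * (C ^ (1 / (2 : ℝ)) *
    (volume.restrict (tsupport φ) univ) ^ (1 / (1 : ℝ) - 1 / 2)) with hM
  have hMfin : M ≠ ⊤ := by
    refine ENNReal.mul_ne_top ENNReal.ofReal_ne_top (ENNReal.mul_ne_top ?_ ?_)
    · exact (ENNReal.rpow_lt_top_of_nonneg (by norm_num) hC).ne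
    · exact (ENNReal.rpow_lt_top_of_nonneg (by norm_num) (measure_ne_top _ _)).ne
  have hbound : ∀ n, ∫⁻ x in U, ‖φ x • us n x - φ x • u x‖ₑ ≤ M * eLpNorm (us n - u) 2 ν := by
    intro n
    have hd : MemLp (us n - u) 2 ν := (hus n).sub hu
    have s1 : ∫⁻ x in U, ‖φ x • us n x - φ x • u x‖ₑ
        ≤ ∫⁻ x in tsupport φ, ENNReal.ofReal B * ‖(us n - u) x‖ₑ := by
      calc ∫⁻ x in U, ‖φ x • us n x - φ x • u x‖ₑ
          ≤ ∫⁻ x, ‖φ x • us n x - φ x • u x‖ₑ := setLIntegral_le_lintegral _ _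
        _ = ∫⁻ x in tsupport φ, ‖φ x • us n x - φ x • u x‖ₑ := by
          rw [setLIntegral_eq_of_support_subset]
          intro x hx
          apply subset_tsupport
          intro h0
          simp [h0] at hx
        _ ≤ _ := by
          refine lintegral_mono fun x => ?_
          rw [← smul_sub, enorm_smul]
          gcongr
          · rw [← ofReal_norm]
            exact ENNReal.ofReal_le_ofReal (hB x)
          · rfl
    refine s1.trans ?_
    rw [lintegral_const_mul' _ _ ENNReal.ofReal_ne_top, hM, mul_assoc]
    gcongr
    have hd' := hν.memLp hs hc hd
    have h1 := eLpNorm_le_eLpNorm_mul_rpow_measure_univ (p := 1) (q := 2)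
      (by norm_num) hd'.aestronglyMeasurable
    rw [eLpNorm_one_eq_lintegral_enorm] at h1
    refine h1.trans ?_
    rw [mul_comm (C ^ _), mul_assoc, mul_comm]
    simp only [ENNReal.toReal_one, ENNReal.toReal_ofNat]
    gcongr
    refine (eLpNorm_mono_measure _ hle).trans ?_
    by_cases hC0 : C = 0
    · simp [hC0]
    rw [eLpNorm_smul_measure_of_ne_zero hC0]
    simp
  have hz : Tendsto (fun n => M * eLpNorm (us n - u) 2 ν) atTop (𝓝 0) := by
    simpa using ENNReal.Tendsto.const_mul hlim (Or.inr hMfin)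
  exact tendsto_of_tendsto_of_tendsto_of_le_of_le tendsto_const_nhds hz
    (fun _ => zero_le) hbound

/-- Weak derivatives pass to limits in mean square. -/
theorem DominatesVolumeOn.hasWeakDeriv_of_tendsto [BorelSpace E] [FiniteDimensional ℝ E]
    [IsFiniteMeasureOnCompacts (volume : Measure E)]
    {ν : Measure E} (hν : DominatesVolumeOn ν U) (hU : IsOpen U) {us gs : ℕ → E → ℂ}
    (hus : ∀ n, MemLp (us n) 2 ν) (hgs : ∀ n, MemLp (gs n) 2 ν)
    (hw : ∀ n, HasWeakDeriv U e (us n) (gs n)) (hu : MemLp u 2 ν) (hg : MemLp g 2 ν)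
    (hulim : Tendsto (fun n => eLpNorm (us n - u) 2 ν) atTop (𝓝 0))
    (hglim : Tendsto (fun n => eLpNorm (gs n - g) 2 ν) atTop (𝓝 0)) :
    HasWeakDeriv U e u g := by
  refine ⟨hν.locallyIntegrableOn hU hu, hν.locallyIntegrableOn hU hg, fun φ hφ hc hs => ?_⟩
  have t1 := hν.tendsto_integral hU hus hu hulim (continuous_fderiv_apply_of_contDiff hφ e)
    (HasCompactSupport.fderiv_apply ℝ hc e) ((tsupport_fderiv_apply_subset ℝ e).trans hs)
  have t2 := (hν.tendsto_integral hU hgs hg hglim hφ.continuous hc hs).neg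
  refine tendsto_nhds_unique t1 (t2.congr fun n => ?_)
  exact ((hw n).2.2 φ hφ hc hs).symm

end WeakDerivative

end Axisym

end

noncomputable section

namespace Axisym

open Filter Topology
open scoped ENNReal NNReal

/-! ### Square integrable functions -/

section SquareIntegrable

variable {α : Type*} [MeasurableSpace α] {ν : Measure α} {u v : α → ℂ}

theorem lintegral_enorm_sq_eq_eLpNorm_sq (u : α → ℂ) (ν : Measure α) :
    ∫⁻ x, ‖u x‖ₑ ^ 2 ∂ν = eLpNorm u 2 ν ^ 2 := by
  rw [eLpNorm_eq_lintegral_rpow_enorm_toReal (by norm_num) (by norm_num)]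
  simp only [ENNReal.toReal_ofNat, ENNReal.rpow_ofNat]
  rw [← ENNReal.rpow_natCast, ← ENNReal.rpow_mul]
  norm_num

theorem integrable_norm_sq (hu : MemLp u 2 ν) : Integrable (fun x => ‖u x‖ ^ 2) ν :=
  (memLp_two_iff_integrable_sq_norm hu.aestronglyMeasurable).1 hu

theorem ofReal_integral_norm_sq (hu : MemLp u 2 ν) :
    ENNReal.ofReal (∫ x, ‖u x‖ ^ 2 ∂ν) = ∫⁻ x, ‖u x‖ₑ ^ 2 ∂ν := by
  rw [ofReal_integral_eq_lintegral_ofReal (integrable_norm_sq hu)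
    (Eventually.of_forall fun x => by positivity)]
  refine lintegral_congr fun x => ?_
  rw [ENNReal.ofReal_pow (norm_nonneg _), ofReal_norm]

theorem eLpNorm_sq_eq_ofReal (hu : MemLp u 2 ν) :
    eLpNorm u 2 ν ^ 2 = ENNReal.ofReal (∫ x, ‖u x‖ ^ 2 ∂ν) := by
  rw [ofReal_integral_norm_sq hu, lintegral_enorm_sq_eq_eLpNorm_sq]

theorem integral_norm_sq_eq_toReal (hu : MemLp u 2 ν) :
    ∫ x, ‖u x‖ ^ 2 ∂ν = (eLpNorm u 2 ν ^ 2).toReal := by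
  rw [eLpNorm_sq_eq_ofReal hu, ENNReal.toReal_ofReal (integral_nonneg fun x => by positivity)]

theorem ae_eq_zero_of_integral_norm_sq (hu : MemLp u 2 ν) (h : ∫ x, ‖u x‖ ^ 2 ∂ν = 0) :
    u =ᵐ[ν] 0 := by
  rw [integral_eq_zero_iff_of_nonneg (fun x => by positivity) (integrable_norm_sq hu)] at h
  filter_upwards [h] with x hx
  simpa using hx

theorem tendsto_eLpNorm_iff {ι : Type*} {l : Filter ι} {us : ι → α → ℂ}
    (hus : ∀ n, MemLp (us n) 2 ν) :
    Tendsto (fun n => eLpNorm (us n) 2 ν) l (𝓝 0) ↔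
      Tendsto (fun n => ∫ x, ‖us n x‖ ^ 2 ∂ν) l (𝓝 0) := by
  have h1 : ∀ n, ∫ x, ‖us n x‖ ^ 2 ∂ν = (eLpNorm (us n) 2 ν).toReal ^ 2 := fun n => by
    rw [integral_norm_sq_eq_toReal (hus n), ENNReal.toReal_pow]
  simp only [h1]
  constructor
  · intro h
    have := ((ENNReal.tendsto_toReal (by simp : (0 : ℝ≥0∞) ≠ ⊤)).comp h).pow 2
    simpa using this
  · intro h
    have h2 : Tendsto (fun n => (eLpNorm (us n) 2 ν).toReal) l (𝓝 0) := by
      have := h.sqrt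
      simpa [Real.sqrt_sq ENNReal.toReal_nonneg] using this
    have h3 := ENNReal.tendsto_ofReal h2
    simpa [ENNReal.ofReal_toReal (hus _).eLpNorm_ne_top] using h3

theorem integral_norm_sq_add_le (hu : MemLp u 2 ν) (hv : MemLp v 2 ν) :
    ∫ x, ‖(u + v) x‖ ^ 2 ∂ν ≤ 2 * ∫ x, ‖u x‖ ^ 2 ∂ν + 2 * ∫ x, ‖v x‖ ^ 2 ∂ν := by
  have iu := integrable_norm_sq hu
  have iv := integrable_norm_sq hv
  rw [← integral_const_mul, ← integral_const_mul, ← integral_add (iu.const_mul 2) (iv.const_mul 2)]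
  refine integral_mono (integrable_norm_sq (hu.add hv)) ((iu.const_mul 2).add (iv.const_mul 2))
    fun x => ?_
  have h := norm_add_le (u x) (v x)
  have : ‖(u + v) x‖ ^ 2 ≤ (‖u x‖ + ‖v x‖) ^ 2 := by
    simp only [Pi.add_apply]; gcongr
  simp only
  nlinarith [sq_nonneg (‖u x‖ - ‖v x‖)]

theorem norm_sq_add_norm_sq_I (a b : ℂ) :
    ‖a + Complex.I * b‖ ^ 2 + ‖a - Complex.I * b‖ ^ 2 = 2 * (‖a‖ ^ 2 + ‖b‖ ^ 2) := by
  simp only [Complex.sq_norm, Complex.normSq_apply, Complex.add_re, Complex.add_im, Complex.sub_re,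
    Complex.sub_im, Complex.mul_re, Complex.mul_im, Complex.I_re, Complex.I_im]
  ring

theorem integral_norm_sq_parallelogram (hu : MemLp u 2 ν) (hv : MemLp v 2 ν) :
    (∫ x, ‖(u + Complex.I • v) x‖ ^ 2 ∂ν) + ∫ x, ‖(u - Complex.I • v) x‖ ^ 2 ∂ν
      = 2 * ((∫ x, ‖u x‖ ^ 2 ∂ν) + ∫ x, ‖v x‖ ^ 2 ∂ν) := by
  rw [← integral_add (integrable_norm_sq (hu.add (hv.const_smul _)))
    (integrable_norm_sq (hu.sub (hv.const_smul _))),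
    ← integral_add (integrable_norm_sq hu) (integrable_norm_sq hv), ← integral_const_mul]
  congr 1; ext x
  exact norm_sq_add_norm_sq_I _ _

end SquareIntegrable

/-! ### Weighted spaces on a plane domain to the right of the axis -/

/-- Open subsets of the half plane `r > 0`. -/
structure IsHalfPlaneOpen (Ω : Set Plane) : Prop where
  isOpen : IsOpen Ω
  pos : ∀ p ∈ Ω, 0 < p.1

/-- The measure `r ^ α dr dz` on `Ω`. -/
def wt (α : ℤ) (Ω : Set Plane) : Measure Plane :=
  (volume.restrict Ω).withDensity fun p => ENNReal.ofReal (p.1 ^ α)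

variable {Ω : Set Plane} {α : ℤ} {u v : Plane → ℂ}

theorem measurable_weight (α : ℤ) : Measurable fun p : Plane => ENNReal.ofReal (p.1 ^ α) := by
  have : Measurable fun p : Plane => p.1 ^ α := by
    have hf : Measurable fun p : Plane => p.1 := measurable_fst
    cases α with
    | ofNat n => simpa using hf.pow_const n
    | negSucc n => simp only [zpow_negSucc]; exact (hf.pow_const (n + 1)).inv
  exact this.ennreal_ofReal

theorem IsHalfPlaneOpen.ae_restrict_pos (hΩ : IsHalfPlaneOpen Ω) :
    ∀ᵐ p ∂(volume.restrict Ω), 0 < p.1 :=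
  (ae_restrict_mem hΩ.isOpen.measurableSet).mono fun p hp => hΩ.pos p hp

theorem wt_absolutelyContinuous (α : ℤ) (Ω : Set Plane) : wt α Ω ≪ volume.restrict Ω :=
  withDensity_absolutelyContinuous _ _

/-- The weight is positive on `Ω`, so all the measures `wt α Ω` have the null sets of the volume,
and statements almost everywhere move freely between them. -/
theorem IsHalfPlaneOpen.absolutelyContinuous_wt (hΩ : IsHalfPlaneOpen Ω) (α : ℤ) :
    volume.restrict Ω ≪ wt α Ω := by
  refine withDensity_absolutelyContinuous' (measurable_weight α).aemeasurable ?_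
  filter_upwards [hΩ.ae_restrict_pos] with p hp
  simpa using zpow_pos hp α

theorem IsHalfPlaneOpen.ae_wt_iff (hΩ : IsHalfPlaneOpen Ω) {P : Plane → Prop} :
    (∀ᵐ p ∂(wt α Ω), P p) ↔ ∀ᵐ p ∂(volume.restrict Ω), P p :=
  ⟨fun h => (hΩ.absolutelyContinuous_wt α).ae_le h,
    fun h => (wt_absolutelyContinuous α Ω).ae_le h⟩

theorem IsHalfPlaneOpen.integral_wt (hΩ : IsHalfPlaneOpen Ω) (α : ℤ) (f : Plane → ℝ) :
    ∫ p, f p ∂(wt α Ω) = ∫ p in Ω, f p * p.1 ^ α := by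
  rw [wt, integral_withDensity_eq_integral_toReal_smul (measurable_weight α) (by simp)]
  refine integral_congr_ae ?_
  filter_upwards [hΩ.ae_restrict_pos] with p hp
  rw [ENNReal.toReal_ofReal (zpow_pos hp α).le, smul_eq_mul, mul_comm]

theorem IsHalfPlaneOpen.integrable_wt_iff (hΩ : IsHalfPlaneOpen Ω) (α : ℤ) (f : Plane → ℝ) :
    Integrable f (wt α Ω) ↔ IntegrableOn (fun p => f p * p.1 ^ α) Ω := by
  rw [wt, integrable_withDensity_iff (measurable_weight α) (by simp)]
  refine integrable_congr ?_
  filter_upwards [hΩ.ae_restrict_pos] with p hp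
  rw [ENNReal.toReal_ofReal (zpow_pos hp α).le]

theorem lintegral_wt (α : ℤ) (Ω : Set Plane) {f : Plane → ℝ≥0∞}
    (hf : AEMeasurable f (volume.restrict Ω)) :
    ∫⁻ p, f p ∂(wt α Ω) = ∫⁻ p in Ω, ENNReal.ofReal (p.1 ^ α) * f p := by
  rw [wt, lintegral_withDensity_eq_lintegral_mul₀ (measurable_weight α).aemeasurable hf]
  rfl

theorem IsHalfPlaneOpen.memL2w_iff (hΩ : IsHalfPlaneOpen Ω) :
    MemL2w α Ω u ↔ MemLp u 2 (wt α Ω) := by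
  constructor
  · rintro ⟨h1, h2⟩
    rw [memLp_two_iff_integrable_sq_norm (h1.mono_ac (wt_absolutelyContinuous α Ω)),
      hΩ.integrable_wt_iff]
    exact h2
  · intro h
    refine ⟨h.aestronglyMeasurable.mono_ac (hΩ.absolutelyContinuous_wt α), ?_⟩
    rw [memLp_two_iff_integrable_sq_norm h.aestronglyMeasurable, hΩ.integrable_wt_iff] at h
    exact h

theorem IsHalfPlaneOpen.l2wNormSq_eq (hΩ : IsHalfPlaneOpen Ω) (α : ℤ) (u : Plane → ℂ) :
    l2wNormSq α Ω u = ∫ p, ‖u p‖ ^ 2 ∂(wt α Ω) :=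
  (hΩ.integral_wt α _).symm

theorem IsHalfPlaneOpen.l2wNormSq_nonneg (hΩ : IsHalfPlaneOpen Ω) (α : ℤ) (u : Plane → ℂ) :
    0 ≤ l2wNormSq α Ω u := by
  rw [hΩ.l2wNormSq_eq]
  exact integral_nonneg fun p => by positivity

theorem IsHalfPlaneOpen.l2wNormSq_congr (hΩ : IsHalfPlaneOpen Ω) (α : ℤ)
    (h : u =ᵐ[volume.restrict Ω] v) : l2wNormSq α Ω u = l2wNormSq α Ω v := by
  rw [hΩ.l2wNormSq_eq, hΩ.l2wNormSq_eq]
  refine integral_congr_ae ?_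
  filter_upwards [hΩ.ae_wt_iff.2 h] with x hx
  rw [hx]

/-- A nonempty compact subset of `Ω` stays away from the axis, so the continuous function `r^α` has
a positive minimum there; its inverse is the constant. -/
theorem IsHalfPlaneOpen.dominatesVolumeOn_wt (hΩ : IsHalfPlaneOpen Ω) (α : ℤ) :
    DominatesVolumeOn (wt α Ω) Ω := by
  intro K hK hc
  rcases K.eq_empty_or_nonempty with rfl | hne
  · exact ⟨0, by simp, by simp⟩
  have hcont : ContinuousOn (fun p : Plane => p.1 ^ α) K :=
    continuousOn_fst.zpow₀ α fun p hp => Or.inl (hΩ.pos p (hK hp)).ne'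
  obtain ⟨q, hq, hmin⟩ := hc.exists_isMinOn hne hcont
  have hqpos : 0 < q.1 ^ α := zpow_pos (hΩ.pos q (hK hq)) α
  refine ⟨(ENNReal.ofReal (q.1 ^ α))⁻¹, by simpa using hqpos, ?_⟩
  refine Measure.le_iff.2 fun s hs => ?_
  rw [Measure.smul_apply, smul_eq_mul, wt, withDensity_apply _ hs, Measure.restrict_restrict hs,
    Measure.restrict_apply hs, ← ENNReal.div_eq_inv_mul,
    ENNReal.le_div_iff_mul_le (Or.inl (by simpa using hqpos)) (Or.inl ENNReal.ofReal_ne_top)]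
  calc volume (s ∩ K) * ENNReal.ofReal (q.1 ^ α)
      = ∫⁻ _ in s ∩ K, ENNReal.ofReal (q.1 ^ α) := by
        rw [setLIntegral_const, mul_comm]
    _ ≤ ∫⁻ p in s ∩ K, ENNReal.ofReal (p.1 ^ α) := by
        refine setLIntegral_mono' (hs.inter hc.measurableSet) fun p hp => ?_
        exact ENNReal.ofReal_le_ofReal (hmin hp.2)
    _ ≤ ∫⁻ p in s ∩ Ω, ENNReal.ofReal (p.1 ^ α) :=
        lintegral_mono_set (inter_subset_inter_right _ hK)

/-! ### The space `H¹₁` -/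

theorem IsHalfPlaneOpen.memH11_iff (hΩ : IsHalfPlaneOpen Ω) :
    MemH11 Ω u ↔ MemLp u 2 (wt 1 Ω) ∧
      (HasWeakDeriv Ω (1, 0) u (dr Ω u) ∧ MemLp (dr Ω u) 2 (wt 1 Ω)) ∧
      (HasWeakDeriv Ω (0, 1) u (dz Ω u) ∧ MemLp (dz Ω u) 2 (wt 1 Ω)) := by
  unfold MemH11
  simp only [hΩ.memL2w_iff]
  constructor
  · rintro ⟨h1, ⟨g, hg, hg'⟩, ⟨h, hh, hh'⟩⟩
    exact ⟨h1, ⟨hg.weakDeriv_spec, hg'.ae_eq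
      (hΩ.ae_wt_iff.2 (hg.weakDeriv_ae_eq hΩ.isOpen).symm)⟩,
      ⟨hh.weakDeriv_spec, hh'.ae_eq (hΩ.ae_wt_iff.2 (hh.weakDeriv_ae_eq hΩ.isOpen).symm)⟩⟩
  · rintro ⟨h1, h2, h3⟩
    exact ⟨h1, ⟨_, h2⟩, ⟨_, h3⟩⟩

theorem IsHalfPlaneOpen.memH11_of_hasWeakDeriv (hΩ : IsHalfPlaneOpen Ω) {g h : Plane → ℂ}
    (hu : MemLp u 2 (wt 1 Ω)) (hg : HasWeakDeriv Ω (1, 0) u g) (hg' : MemLp g 2 (wt 1 Ω))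
    (hh : HasWeakDeriv Ω (0, 1) u h) (hh' : MemLp h 2 (wt 1 Ω)) : MemH11 Ω u :=
  ⟨hΩ.memL2w_iff.2 hu, ⟨g, hg, hΩ.memL2w_iff.2 hg'⟩, ⟨h, hh, hΩ.memL2w_iff.2 hh'⟩⟩

theorem IsHalfPlaneOpen.dr_ae_eq (hΩ : IsHalfPlaneOpen Ω) {g : Plane → ℂ}
    (hg : HasWeakDeriv Ω (1, 0) u g) : dr Ω u =ᵐ[volume.restrict Ω] g :=
  hg.weakDeriv_ae_eq hΩ.isOpen

theorem IsHalfPlaneOpen.dz_ae_eq (hΩ : IsHalfPlaneOpen Ω) {g : Plane → ℂ}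
    (hg : HasWeakDeriv Ω (0, 1) u g) : dz Ω u =ᵐ[volume.restrict Ω] g :=
  hg.weakDeriv_ae_eq hΩ.isOpen

theorem IsHalfPlaneOpen.memH11_congr (hΩ : IsHalfPlaneOpen Ω) (h : u =ᵐ[volume.restrict Ω] v)
    (hu : MemH11 Ω u) : MemH11 Ω v := by
  obtain ⟨h1, ⟨g, hg, hg'⟩, ⟨k, hk, hk'⟩⟩ := hu
  exact ⟨hΩ.memL2w_iff.2 ((hΩ.memL2w_iff.1 h1).ae_eq (hΩ.ae_wt_iff.2 h)),
    ⟨g, hg.congr h (ae_eq_refl _), hg'⟩, ⟨k, hk.congr h (ae_eq_refl _), hk'⟩⟩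

theorem hasWeakDeriv_congr_iff {E : Type*} [NormedAddCommGroup E] [NormedSpace ℝ E]
    [MeasureSpace E] {U : Set E} {e : E} {u v g : E → ℂ} (h : u =ᵐ[volume.restrict U] v) :
    HasWeakDeriv U e u g ↔ HasWeakDeriv U e v g :=
  ⟨fun hu => hu.congr h (ae_eq_refl _), fun hv => hv.congr h.symm (ae_eq_refl _)⟩

/-- The two predicates "being a weak derivative" are equal, so the choice returns the same function:
the equality is literal, not merely almost everywhere. -/
theorem weakDeriv_congr {E : Type*} [NormedAddCommGroup E] [NormedSpace ℝ E]
    [MeasureSpace E] {U : Set E} {u v : E → ℂ} (e : E) (h : u =ᵐ[volume.restrict U] v) :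
    weakDeriv U e u = weakDeriv U e v := by
  have : HasWeakDeriv U e u = HasWeakDeriv U e v := by
    ext g
    exact hasWeakDeriv_congr_iff h
  unfold weakDeriv
  rw [this]

theorem h11SemiSq_congr (h : u =ᵐ[volume.restrict Ω] v) : h11SemiSq Ω u = h11SemiSq Ω v := by
  unfold h11SemiSq dr dz
  rw [weakDeriv_congr _ h, weakDeriv_congr _ h]

theorem IsHalfPlaneOpen.h11NormSq_congr (hΩ : IsHalfPlaneOpen Ω)
    (h : u =ᵐ[volume.restrict Ω] v) : h11NormSq Ω u = h11NormSq Ω v := by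
  unfold h11NormSq
  rw [h11SemiSq_congr h, hΩ.l2wNormSq_congr 1 h]

theorem IsHalfPlaneOpen.memH11_smul_add (hΩ : IsHalfPlaneOpen Ω) (c : ℂ) (hu : MemH11 Ω u)
    (hv : MemH11 Ω v) : MemH11 Ω (c • u + v) := by
  rw [hΩ.memH11_iff] at hu hv
  exact hΩ.memH11_of_hasWeakDeriv ((hu.1.const_smul c).add hv.1)
    ((hu.2.1.1.const_smul c).add hv.2.1.1) ((hu.2.1.2.const_smul c).add hv.2.1.2)
    ((hu.2.2.1.const_smul c).add hv.2.2.1) ((hu.2.2.2.const_smul c).add hv.2.2.2)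

theorem IsHalfPlaneOpen.dr_smul_add (hΩ : IsHalfPlaneOpen Ω) (c : ℂ) (hu : MemH11 Ω u)
    (hv : MemH11 Ω v) : dr Ω (c • u + v) =ᵐ[volume.restrict Ω] c • dr Ω u + dr Ω v := by
  rw [hΩ.memH11_iff] at hu hv
  exact hΩ.dr_ae_eq ((hu.2.1.1.const_smul c).add hv.2.1.1)

theorem IsHalfPlaneOpen.dz_smul_add (hΩ : IsHalfPlaneOpen Ω) (c : ℂ) (hu : MemH11 Ω u)
    (hv : MemH11 Ω v) : dz Ω (c • u + v) =ᵐ[volume.restrict Ω] c • dz Ω u + dz Ω v := by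
  rw [hΩ.memH11_iff] at hu hv
  exact hΩ.dz_ae_eq ((hu.2.2.1.const_smul c).add hv.2.2.1)

theorem IsHalfPlaneOpen.h11SemiSq_nonneg (hΩ : IsHalfPlaneOpen Ω) (u : Plane → ℂ) :
    0 ≤ h11SemiSq Ω u :=
  add_nonneg (hΩ.l2wNormSq_nonneg _ _) (hΩ.l2wNormSq_nonneg _ _)

theorem IsHalfPlaneOpen.h11NormSq_nonneg (hΩ : IsHalfPlaneOpen Ω) (u : Plane → ℂ) :
    0 ≤ h11NormSq Ω u :=
  add_nonneg (hΩ.l2wNormSq_nonneg _ _) (hΩ.h11SemiSq_nonneg _)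

theorem IsHalfPlaneOpen.l2wNormSq_add_le (hΩ : IsHalfPlaneOpen Ω) (α : ℤ)
    (hu : MemLp u 2 (wt α Ω)) (hv : MemLp v 2 (wt α Ω)) :
    l2wNormSq α Ω (u + v) ≤ 2 * l2wNormSq α Ω u + 2 * l2wNormSq α Ω v := by
  simp only [hΩ.l2wNormSq_eq]
  exact integral_norm_sq_add_le hu hv

theorem l2wNormSq_const_smul (α : ℤ) (Ω : Set Plane) (c : ℂ) (u : Plane → ℂ) :
    l2wNormSq α Ω (c • u) = ‖c‖ ^ 2 * l2wNormSq α Ω u := by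
  unfold l2wNormSq
  rw [← integral_const_mul]
  congr 1; ext p
  simp [mul_pow, mul_assoc]

theorem IsHalfPlaneOpen.h11SemiSq_smul_add_le (hΩ : IsHalfPlaneOpen Ω) (c : ℂ)
    (hu : MemH11 Ω u) (hv : MemH11 Ω v) :
    h11SemiSq Ω (c • u + v) ≤ 2 * ‖c‖ ^ 2 * h11SemiSq Ω u + 2 * h11SemiSq Ω v := by
  unfold h11SemiSq
  rw [hΩ.l2wNormSq_congr 1 (hΩ.dr_smul_add c hu hv),
    hΩ.l2wNormSq_congr 1 (hΩ.dz_smul_add c hu hv)]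
  rw [hΩ.memH11_iff] at hu hv
  have h1 := hΩ.l2wNormSq_add_le 1 (hu.2.1.2.const_smul c) hv.2.1.2
  have h2 := hΩ.l2wNormSq_add_le 1 (hu.2.2.2.const_smul c) hv.2.2.2
  rw [l2wNormSq_const_smul] at h1 h2
  linarith

theorem IsHalfPlaneOpen.h11NormSq_smul_add_le (hΩ : IsHalfPlaneOpen Ω) (c : ℂ)
    (hu : MemH11 Ω u) (hv : MemH11 Ω v) :
    h11NormSq Ω (c • u + v) ≤ 2 * ‖c‖ ^ 2 * h11NormSq Ω u + 2 * h11NormSq Ω v := by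
  have h1 := hΩ.h11SemiSq_smul_add_le c hu hv
  rw [hΩ.memH11_iff] at hu hv
  have h2 := hΩ.l2wNormSq_add_le 1 (hu.1.const_smul c) hv.1
  rw [l2wNormSq_const_smul] at h2
  unfold h11NormSq
  linarith

theorem IsHalfPlaneOpen.h11SemiSq_parallelogram (hΩ : IsHalfPlaneOpen Ω) (hu : MemH11 Ω u)
    (hv : MemH11 Ω v) :
    h11SemiSq Ω (u + Complex.I • v) + h11SemiSq Ω (u - Complex.I • v)
      = 2 * (h11SemiSq Ω u + h11SemiSq Ω v) := by
  rw [hΩ.memH11_iff] at hu hv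
  unfold h11SemiSq
  rw [hΩ.l2wNormSq_congr 1 (hΩ.dr_ae_eq (hu.2.1.1.add (hv.2.1.1.const_smul Complex.I))),
    hΩ.l2wNormSq_congr 1 (hΩ.dr_ae_eq (hu.2.1.1.sub (hv.2.1.1.const_smul Complex.I))),
    hΩ.l2wNormSq_congr 1 (hΩ.dz_ae_eq (hu.2.2.1.add (hv.2.2.1.const_smul Complex.I))),
    hΩ.l2wNormSq_congr 1 (hΩ.dz_ae_eq (hu.2.2.1.sub (hv.2.2.1.const_smul Complex.I)))]
  have h1 := integral_norm_sq_parallelogram hu.2.1.2 hv.2.1.2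
  have h2 := integral_norm_sq_parallelogram hu.2.2.2 hv.2.2.2
  simp only [hΩ.l2wNormSq_eq]
  linarith

theorem IsHalfPlaneOpen.memLp_wt_one_of_continuous (hΩ : IsHalfPlaneOpen Ω)
    (hu : Continuous u) (hc : HasCompactSupport u) : MemLp u 2 (wt 1 Ω) := by
  rw [← hΩ.memL2w_iff]
  refine ⟨hu.aestronglyMeasurable, Integrable.integrableOn ?_⟩
  refine Continuous.integrable_of_hasCompactSupport (by simp only [zpow_one]; fun_prop) ?_
  refine HasCompactSupport.mul_right (HasCompactSupport.comp_left (g := fun z : ℂ => ‖z‖ ^ 2) hc ?_)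
  simp

theorem IsHalfPlaneOpen.memH11_of_contDiff (hΩ : IsHalfPlaneOpen Ω)
    (hu : ContDiff ℝ ∞ u) (hc : HasCompactSupport u) : MemH11 Ω u :=
  hΩ.memH11_of_hasWeakDeriv (hΩ.memLp_wt_one_of_continuous hu.continuous hc)
    (hasWeakDeriv_of_contDiff hu Ω (1, 0))
    (hΩ.memLp_wt_one_of_continuous (continuous_fderiv_apply_of_contDiff hu _)
      (HasCompactSupport.fderiv_apply ℝ hc _))
    (hasWeakDeriv_of_contDiff hu Ω (0, 1))
    (hΩ.memLp_wt_one_of_continuous (continuous_fderiv_apply_of_contDiff hu _)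
      (HasCompactSupport.fderiv_apply ℝ hc _))

theorem IsHalfPlaneOpen.memH11_sub (hΩ : IsHalfPlaneOpen Ω) (hu : MemH11 Ω u)
    (hv : MemH11 Ω v) : MemH11 Ω (u - v) := by
  have := hΩ.memH11_smul_add (-1) hv hu
  simpa [sub_eq_add_neg, add_comm] using this

theorem IsHalfPlaneOpen.memH11Diamond_smul_add (hΩ : IsHalfPlaneOpen Ω) (c : ℂ)
    (hu : MemH11Diamond Ω u) (hv : MemH11Diamond Ω v) : MemH11Diamond Ω (c • u + v) := by
  refine ⟨hΩ.memH11_smul_add c hu.1 hv.1, fun ε hε => ?_⟩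
  -- The quasi-triangle inequality has factors `2 ‖c‖²` and `2`, so each part contributes at most `ε
  -- / 2`; the `+ 1` covers `c = 0`.
  obtain ⟨φ, h1, h2, h3, h4⟩ := hu.2 (ε / (4 * (‖c‖ ^ 2 + 1))) (by positivity)
  obtain ⟨ψ, k1, k2, k3, k4⟩ := hv.2 (ε / 4) (by positivity)
  have hs : tsupport (c • φ + ψ) ⊆ tsupport φ ∪ tsupport ψ :=
    (tsupport_add _ _).trans (union_subset_union_left _
      (closure_mono (Function.support_const_smul_subset c φ)))
  refine ⟨c • φ + ψ, (h1.const_smul c).add k1, (h2.smul_left (f := fun _ => c)).add k2,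
    Disjoint.mono_left hs (disjoint_union_left.2 ⟨h3, k3⟩), ?_⟩
  have e : c • u + v - (c • φ + ψ) = c • (u - φ) + (v - ψ) := by
    rw [smul_sub]; abel
  rw [e]
  refine (hΩ.h11NormSq_smul_add_le c (hΩ.memH11_sub hu.1 (hΩ.memH11_of_contDiff h1 h2))
    (hΩ.memH11_sub hv.1 (hΩ.memH11_of_contDiff k1 k2))).trans_lt ?_
  rw [lt_div_iff₀ (by positivity)] at h4
  nlinarith [hΩ.h11NormSq_nonneg (u - φ)]

end Axisym

end

noncomputable section

namespace Axisym

open Filter Topology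
open scoped ENNReal NNReal

/-! ### Decoupling of the system into scalar modes -/

variable {Ω : Set Plane} {k m : ℤ} {v : Field2} {w : Plane → ℂ}

/-- The square of the norm of the scalar mode `m`. -/
def modeSq (Ω : Set Plane) (m : ℤ) (w : Plane → ℂ) : ℝ :=
  h11SemiSq Ω w + (m : ℝ) ^ 2 * l2wNormSq (-1) Ω w

/-- The space of scalar modes `m` that vanish on the outer boundary. -/
def MemMode (Ω : Set Plane) (m : ℤ) (w : Plane → ℂ) : Prop :=
  MemH11Diamond Ω w ∧ (m ≠ 0 → MemL2w (-1) Ω w)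

/-- The combination `v_r + i v_θ`. -/
def plus (v : Field2) : Plane → ℂ := v 0 + Complex.I • v 1

/-- The combination `v_r - i v_θ`. -/
def minus (v : Field2) : Plane → ℂ := v 0 - Complex.I • v 1

/-- The cross term equals `4k Im(v_r conj v_θ) / r²`, and `|v_r ± i v_θ|²` is `|v_r|² + |v_θ|² ± 2
Im(v_r conj v_θ)`: the Hermitian form becomes diagonal with perfect squares as coefficients. In
particular the density is nonnegative. -/
theorem modeDensity_mul (k : ℤ) (v : Field2) {p : Plane} (hp : 0 < p.1) :
    modeDensity k v p * p.1 =
      ((1 + k : ℝ) ^ 2 / 2 * (‖plus v p‖ ^ 2 * p.1 ^ (-1 : ℤ))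
        + (1 - k : ℝ) ^ 2 / 2 * (‖minus v p‖ ^ 2 * p.1 ^ (-1 : ℤ)))
        + (k : ℝ) ^ 2 * (‖v 2 p‖ ^ 2 * p.1 ^ (-1 : ℤ)) := by
  have h1 : (2 * Complex.I * (k : ℂ) / ((p.1 : ℝ) : ℂ) ^ 2 *
        (v 1 p * conj (v 0 p) - v 0 p * conj (v 1 p))).re
      = 4 * k / p.1 ^ 2 * ((v 1 p).re * (v 0 p).im - (v 1 p).im * (v 0 p).re) := by
    have : 2 * Complex.I * (k : ℂ) / ((p.1 : ℝ) : ℂ) ^ 2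
        = ((2 * k / p.1 ^ 2 : ℝ) : ℂ) * Complex.I := by push_cast; ring
    rw [this, mul_assoc, Complex.re_ofReal_mul]
    simp only [Complex.mul_re, Complex.sub_re, Complex.sub_im, Complex.mul_im, Complex.I_re,
      Complex.I_im, Complex.conj_re, Complex.conj_im]
    ring
  unfold modeDensity
  rw [h1]
  simp only [plus, minus, Pi.add_apply, Pi.sub_apply, Pi.smul_apply, smul_eq_mul, Complex.sq_norm,
    Complex.normSq_apply, Complex.add_re, Complex.add_im, Complex.sub_re,
    Complex.sub_im, Complex.mul_re, Complex.mul_im, Complex.I_re, Complex.I_im, zpow_neg_one]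
  field_simp
  ring

/-- Without cancellation, the sum dominates each summand. -/
theorem integrable_add_iff_of_nonneg {α : Type*} [MeasurableSpace α] {ν : Measure α}
    {f g : α → ℝ} (hf : AEStronglyMeasurable f ν) (hg : AEStronglyMeasurable g ν)
    (hf0 : 0 ≤ᵐ[ν] f) (hg0 : 0 ≤ᵐ[ν] g) :
    Integrable (fun x => f x + g x) ν ↔ Integrable f ν ∧ Integrable g ν := by
  refine ⟨fun h => ⟨h.mono' hf ?_, h.mono' hg ?_⟩, fun h => h.1.add h.2⟩
  · filter_upwards [hf0, hg0] with x h1 h2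
    simp only [Pi.zero_apply] at h1 h2
    rw [Real.norm_of_nonneg h1]; linarith
  · filter_upwards [hf0, hg0] with x h1 h2
    simp only [Pi.zero_apply] at h1 h2
    rw [Real.norm_of_nonneg h2]; linarith

theorem aestronglyMeasurable_weighted_norm_sq {α : ℤ}
    (hw : AEStronglyMeasurable w (volume.restrict Ω)) :
    AEStronglyMeasurable (fun p : Plane => ‖w p‖ ^ 2 * p.1 ^ α) (volume.restrict Ω) := by
  have h1 : Measurable fun p : Plane => p.1 ^ α := by
    have hf : Measurable fun p : Plane => p.1 := measurable_fst
    cases α with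
    | ofNat n => simpa using hf.pow_const n
    | negSucc n => simp only [zpow_negSucc]; exact (hf.pow_const (n + 1)).inv
  exact (hw.norm.pow 2).mul h1.aestronglyMeasurable

/-- A zero coefficient imposes no condition; this is how the mode of index `0` escapes the
requirement of lying in `L²₋₁`. -/
theorem integrableOn_const_mul_weighted_iff {α : ℤ} {c : ℝ}
    (hw : AEStronglyMeasurable w (volume.restrict Ω)) :
    IntegrableOn (fun p : Plane => c * (‖w p‖ ^ 2 * p.1 ^ α)) Ω ↔ (c ≠ 0 → MemL2w α Ω w) := by
  by_cases hc : c = 0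
  · simp [hc]
  · unfold IntegrableOn MemL2w
    rw [integrable_const_mul_iff (IsUnit.mk0 c hc)]
    simp [hc, hw, IntegrableOn]

/-- After diagonalisation the density is a sum of three nonnegative terms, each of which must be
integrable. The coefficients `(1+k)²/2`, `(1-k)²/2`, `k²` vanish exactly for `k = -1`, `k = 1`, `k =
0`. -/
theorem IsHalfPlaneOpen.integrableOn_modeDensity_iff (hΩ : IsHalfPlaneOpen Ω)
    (hv : ∀ i, AEStronglyMeasurable (v i) (volume.restrict Ω)) :
    IntegrableOn (fun p : Plane => modeDensity k v p * p.1) Ω ↔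
      ((k + 1 ≠ 0 → MemL2w (-1) Ω (plus v)) ∧ (k - 1 ≠ 0 → MemL2w (-1) Ω (minus v))) ∧
        (k ≠ 0 → MemL2w (-1) Ω (v 2)) := by
  have hA : AEStronglyMeasurable (plus v) (volume.restrict Ω) := (hv 0).add ((hv 1).const_smul _)
  have hB : AEStronglyMeasurable (minus v) (volume.restrict Ω) := (hv 0).sub ((hv 1).const_smul _)
  have hc : IntegrableOn (fun p : Plane => modeDensity k v p * p.1) Ω ↔
      IntegrableOn (fun p : Plane => ((1 + k : ℝ) ^ 2 / 2 * (‖plus v p‖ ^ 2 * p.1 ^ (-1 : ℤ))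
        + (1 - k : ℝ) ^ 2 / 2 * (‖minus v p‖ ^ 2 * p.1 ^ (-1 : ℤ)))
        + (k : ℝ) ^ 2 * (‖v 2 p‖ ^ 2 * p.1 ^ (-1 : ℤ))) Ω := by
    refine integrable_congr ?_
    filter_upwards [hΩ.ae_restrict_pos] with p hp using modeDensity_mul k v hp
  have hn : ∀ (c : ℝ) (w : Plane → ℂ), 0 ≤ c →
      0 ≤ᵐ[volume.restrict Ω] fun p : Plane => c * (‖w p‖ ^ 2 * p.1 ^ (-1 : ℤ)) := fun c w hc => by
    filter_upwards [hΩ.ae_restrict_pos] with p hp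
    simp only [Pi.zero_apply]
    positivity
  have hm : ∀ (c : ℝ) (w : Plane → ℂ), AEStronglyMeasurable w (volume.restrict Ω) →
      AEStronglyMeasurable (fun p : Plane => c * (‖w p‖ ^ 2 * p.1 ^ (-1 : ℤ)))
        (volume.restrict Ω) := fun c w hw =>
    (aestronglyMeasurable_weighted_norm_sq hw).const_mul c
  rw [hc]
  unfold IntegrableOn
  rw [integrable_add_iff_of_nonneg (f := fun p : Plane =>
      (1 + k : ℝ) ^ 2 / 2 * (‖plus v p‖ ^ 2 * p.1 ^ (-1 : ℤ))
        + (1 - k : ℝ) ^ 2 / 2 * (‖minus v p‖ ^ 2 * p.1 ^ (-1 : ℤ)))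
    ((hm _ _ hA).add (hm _ _ hB)) (hm _ _ (hv 2)) ?_
    (hn _ _ (by positivity)), integrable_add_iff_of_nonneg (hm _ _ hA) (hm _ _ hB)
    (hn _ _ (by positivity)) (hn _ _ (by positivity))]
  · have e1 : ((1 + k : ℝ) ^ 2 / 2 ≠ 0) ↔ k + 1 ≠ 0 := by
      rw [← not_iff_not]; simp only [ne_eq, not_not, div_eq_zero_iff, pow_eq_zero_iff two_ne_zero]
      constructor
      · rintro (h | h)
        · exact_mod_cast (by linarith : (k : ℝ) + 1 = 0)
        · norm_num at h
      · intro h; left; have : (k : ℝ) + 1 = 0 := by exact_mod_cast h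
        linarith
    have e2 : ((1 - k : ℝ) ^ 2 / 2 ≠ 0) ↔ k - 1 ≠ 0 := by
      rw [← not_iff_not]; simp only [ne_eq, not_not, div_eq_zero_iff, pow_eq_zero_iff two_ne_zero]
      constructor
      · rintro (h | h)
        · exact_mod_cast (by linarith : (k : ℝ) - 1 = 0)
        · norm_num at h
      · intro h; left; have : (k : ℝ) - 1 = 0 := by exact_mod_cast h
        linarith
    have e3 : ((k : ℝ) ^ 2 ≠ 0) ↔ k ≠ 0 := by simp
    have i1 := integrableOn_const_mul_weighted_iff (α := -1) (c := (1 + k : ℝ) ^ 2 / 2) hA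
    have i2 := integrableOn_const_mul_weighted_iff (α := -1) (c := (1 - k : ℝ) ^ 2 / 2) hB
    have i3 := integrableOn_const_mul_weighted_iff (α := -1) (c := (k : ℝ) ^ 2) (hv 2)
    rw [e1] at i1; rw [e2] at i2; rw [e3] at i3
    unfold IntegrableOn at i1 i2 i3
    rw [i1, i2, i3]
  · filter_upwards [hn ((1 + k : ℝ) ^ 2 / 2) (plus v) (by positivity),
      hn ((1 - k : ℝ) ^ 2 / 2) (minus v) (by positivity)] with p h1 h2 using add_nonneg h1 h2

theorem IsHalfPlaneOpen.memHkDiamond_iff (hΩ : IsHalfPlaneOpen Ω) :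
    MemHkDiamond Ω k v ↔ (∀ i, MemH11Diamond Ω (v i)) ∧
      ((k + 1 ≠ 0 → MemL2w (-1) Ω (plus v)) ∧ (k - 1 ≠ 0 → MemL2w (-1) Ω (minus v))) ∧
        (k ≠ 0 → MemL2w (-1) Ω (v 2)) := by
  unfold MemHkDiamond MemHk
  constructor
  · rintro ⟨⟨h1, h2⟩, h3⟩
    exact ⟨h3, (hΩ.integrableOn_modeDensity_iff fun i => (h1 i).1.1).1 h2⟩
  · rintro ⟨h1, h2⟩
    exact ⟨⟨fun i => (h1 i).1, (hΩ.integrableOn_modeDensity_iff fun i => (h1 i).1.1.1).2 h2⟩, h1⟩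

theorem IsHalfPlaneOpen.memL2w_smul_add (hΩ : IsHalfPlaneOpen Ω) {α : ℤ} {u w : Plane → ℂ} (c : ℂ)
    (hu : MemL2w α Ω u) (hw : MemL2w α Ω w) : MemL2w α Ω (c • u + w) := by
  rw [hΩ.memL2w_iff] at *
  exact (hu.const_smul c).add hw

theorem IsHalfPlaneOpen.memL2w_plus (hΩ : IsHalfPlaneOpen Ω) {α : ℤ}
    (h0 : MemL2w α Ω (v 0)) (h1 : MemL2w α Ω (v 1)) : MemL2w α Ω (plus v) := by
  have := hΩ.memL2w_smul_add Complex.I h1 h0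
  rwa [add_comm] at this

theorem IsHalfPlaneOpen.memL2w_minus (hΩ : IsHalfPlaneOpen Ω) {α : ℤ}
    (h0 : MemL2w α Ω (v 0)) (h1 : MemL2w α Ω (v 1)) : MemL2w α Ω (minus v) := by
  have := hΩ.memL2w_smul_add (-Complex.I) h1 h0
  rwa [add_comm, neg_smul, ← sub_eq_add_neg] at this

theorem half_plus_add_half_minus (v : Field2) :
    (1 / 2 : ℂ) • plus v + (1 / 2 : ℂ) • minus v = v 0 := by
  ext p
  simp only [plus, minus, Pi.add_apply, Pi.sub_apply, Pi.smul_apply, smul_eq_mul]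
  ring

theorem half_minus_sub_half_plus (v : Field2) :
    (-Complex.I / 2 : ℂ) • plus v + (Complex.I / 2 : ℂ) • minus v = v 1 := by
  ext p
  simp only [plus, minus, Pi.add_apply, Pi.sub_apply, Pi.smul_apply, smul_eq_mul]
  ring_nf
  simp

theorem IsHalfPlaneOpen.memL2w_of_plus_minus (hΩ : IsHalfPlaneOpen Ω) {α : ℤ}
    (hp : MemL2w α Ω (plus v)) (hm : MemL2w α Ω (minus v)) :
    MemL2w α Ω (v 0) ∧ MemL2w α Ω (v 1) := by
  rw [hΩ.memL2w_iff] at hp hm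
  constructor
  · rw [hΩ.memL2w_iff, ← half_plus_add_half_minus v]
    exact (hp.const_smul _).add (hm.const_smul _)
  · rw [hΩ.memL2w_iff, ← half_minus_sub_half_plus v]
    exact (hp.const_smul _).add (hm.const_smul _)

theorem IsHalfPlaneOpen.memMode_plus (hΩ : IsHalfPlaneOpen Ω) (hv : MemHkDiamond Ω k v) :
    MemMode Ω (k + 1) (plus v) := by
  rw [hΩ.memHkDiamond_iff] at hv
  refine ⟨?_, hv.2.1.1⟩
  have := hΩ.memH11Diamond_smul_add Complex.I (hv.1 1) (hv.1 0)
  rwa [add_comm] at this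

theorem IsHalfPlaneOpen.memMode_minus (hΩ : IsHalfPlaneOpen Ω) (hv : MemHkDiamond Ω k v) :
    MemMode Ω (k - 1) (minus v) := by
  rw [hΩ.memHkDiamond_iff] at hv
  refine ⟨?_, hv.2.1.2⟩
  have := hΩ.memH11Diamond_smul_add (-Complex.I) (hv.1 1) (hv.1 0)
  rwa [add_comm, neg_smul, ← sub_eq_add_neg] at this

theorem IsHalfPlaneOpen.memMode_two (hΩ : IsHalfPlaneOpen Ω) (hv : MemHkDiamond Ω k v) :
    MemMode Ω k (v 2) := by
  rw [hΩ.memHkDiamond_iff] at hv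
  exact ⟨hv.1 2, hv.2.2⟩

theorem memH11Diamond_zero (hΩ : IsHalfPlaneOpen Ω) : MemH11Diamond Ω 0 := by
  have h0 : MemH11 Ω 0 := hΩ.memH11_of_contDiff contDiff_const HasCompactSupport.zero
  refine ⟨h0, fun ε hε => ⟨0, contDiff_const, HasCompactSupport.zero, ?_, ?_⟩⟩
  · simp [tsupport]
  · have h := hΩ.memH11_iff.1 h0
    have hz : HasWeakDeriv Ω (1, 0) (0 : Plane → ℂ) 0 := by
      simpa using h.2.1.1.const_smul 0
    have hz' : HasWeakDeriv Ω (0, 1) (0 : Plane → ℂ) 0 := by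
      simpa using h.2.2.1.const_smul 0
    rw [sub_zero, h11NormSq, h11SemiSq, hΩ.l2wNormSq_congr 1 (hΩ.dr_ae_eq hz),
      hΩ.l2wNormSq_congr 1 (hΩ.dz_ae_eq hz')]
    simpa [l2wNormSq] using hε

/-- Together with `memMode_plus`, `memMode_minus` and `memMode_two`, this identifies the space of
triples with three independent scalar mode spaces; `v_r` and `v_θ` are recovered by inverting the
change of unknowns. -/
theorem IsHalfPlaneOpen.memHkDiamond_of_memMode (hΩ : IsHalfPlaneOpen Ω)
    (hp : MemMode Ω (k + 1) (plus v)) (hm : MemMode Ω (k - 1) (minus v))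
    (h2 : MemMode Ω k (v 2)) : MemHkDiamond Ω k v := by
  rw [hΩ.memHkDiamond_iff]
  refine ⟨?_, ⟨hp.2, hm.2⟩, h2.2⟩
  have h := memH11Diamond_zero hΩ
  intro i
  fin_cases i
  · have := hΩ.memH11Diamond_smul_add (1 / 2 : ℂ) hp.1
      (hΩ.memH11Diamond_smul_add (1 / 2 : ℂ) hm.1 h)
    rwa [add_zero, half_plus_add_half_minus] at this
  · have := hΩ.memH11Diamond_smul_add (-Complex.I / 2 : ℂ) hp.1
      (hΩ.memH11Diamond_smul_add (Complex.I / 2 : ℂ) hm.1 h)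
    rwa [add_zero, half_minus_sub_half_plus] at this
  · exact h2.1

theorem IsHalfPlaneOpen.h11SemiSq_plus_minus (hΩ : IsHalfPlaneOpen Ω) (h0 : MemH11 Ω (v 0))
    (h1 : MemH11 Ω (v 1)) : h11SemiSq Ω (plus v) + h11SemiSq Ω (minus v)
      = 2 * (h11SemiSq Ω (v 0) + h11SemiSq Ω (v 1)) :=
  hΩ.h11SemiSq_parallelogram h0 h1

theorem IsHalfPlaneOpen.l2wNormSq_plus_minus (hΩ : IsHalfPlaneOpen Ω) {α : ℤ}
    (h0 : MemL2w α Ω (v 0)) (h1 : MemL2w α Ω (v 1)) :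
    l2wNormSq α Ω (plus v) + l2wNormSq α Ω (minus v)
      = 2 * (l2wNormSq α Ω (v 0) + l2wNormSq α Ω (v 1)) := by
  rw [hΩ.memL2w_iff] at h0 h1
  simp only [hΩ.l2wNormSq_eq]
  exact integral_norm_sq_parallelogram h0 h1

theorem IsHalfPlaneOpen.hkSemi_sq_eq_add (hΩ : IsHalfPlaneOpen Ω) (hv : MemHk Ω k v) :
    hkSemi Ω k v ^ 2 = (∑ i, h11SemiSq Ω (v i)) + ∫ p in Ω, modeDensity k v p * p.1 := by
  have hg : ∀ i, IntegrableOn (fun p : Plane => ‖dr Ω (v i) p‖ ^ 2 * p.1 ^ (1 : ℤ)) Ω ∧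
      IntegrableOn (fun p : Plane => ‖dz Ω (v i) p‖ ^ 2 * p.1 ^ (1 : ℤ)) Ω := fun i => by
    have h := hΩ.memH11_iff.1 (hv.1 i)
    exact ⟨(hΩ.memL2w_iff.2 h.2.1.2).2, (hΩ.memL2w_iff.2 h.2.2.2).2⟩
  have hgi : ∀ i, Integrable (fun p : Plane => ‖dr Ω (v i) p‖ ^ 2 * p.1 ^ (1 : ℤ)
      + ‖dz Ω (v i) p‖ ^ 2 * p.1 ^ (1 : ℤ)) (volume.restrict Ω) := fun i => (hg i).1.add (hg i).2
  have hs : ∫ p in Ω, ((∑ i, (‖dr Ω (v i) p‖ ^ 2 + ‖dz Ω (v i) p‖ ^ 2)) + modeDensity k v p) * p.1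
      = (∑ i, h11SemiSq Ω (v i)) + ∫ p in Ω, modeDensity k v p * p.1 := by
    have : ∀ p : Plane,
        ((∑ i, (‖dr Ω (v i) p‖ ^ 2 + ‖dz Ω (v i) p‖ ^ 2)) + modeDensity k v p) * p.1
        = (∑ i, (‖dr Ω (v i) p‖ ^ 2 * p.1 ^ (1 : ℤ) + ‖dz Ω (v i) p‖ ^ 2 * p.1 ^ (1 : ℤ)))
          + modeDensity k v p * p.1 := fun p => by
      rw [add_mul, Finset.sum_mul]
      simp only [zpow_one, add_mul]
    simp only [this]
    rw [integral_add (integrable_finsetSum _ fun i _ => hgi i) hv.2,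
      integral_finsetSum _ fun i _ => hgi i]
    congr 1
    refine Finset.sum_congr rfl fun i _ => ?_
    rw [integral_add (hg i).1 (hg i).2]
    rfl
  -- Needed to undo the square root in `hkSemi`; the sign of the density is visible only in its
  -- diagonal form.
  have hnn : 0 ≤ (∑ i, h11SemiSq Ω (v i)) + ∫ p in Ω, modeDensity k v p * p.1 := by
    refine add_nonneg (Finset.sum_nonneg fun i _ => hΩ.h11SemiSq_nonneg _)
      (integral_nonneg_of_ae ?_)
    filter_upwards [hΩ.ae_restrict_pos] with p hp
    rw [modeDensity_mul k v hp]
    simp only [Pi.zero_apply]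
    positivity
  rw [hkSemi, hs, Real.sq_sqrt hnn]

theorem IsHalfPlaneOpen.integral_modeDensity (hΩ : IsHalfPlaneOpen Ω) (hv : MemHk Ω k v) :
    ∫ p in Ω, modeDensity k v p * p.1 =
      (1 + k : ℝ) ^ 2 / 2 * l2wNormSq (-1) Ω (plus v)
        + (1 - k : ℝ) ^ 2 / 2 * l2wNormSq (-1) Ω (minus v)
        + (k : ℝ) ^ 2 * l2wNormSq (-1) Ω (v 2) := by
  have hm : ∀ i, AEStronglyMeasurable (v i) (volume.restrict Ω) := fun i => (hv.1 i).1.1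
  have hA : AEStronglyMeasurable (plus v) (volume.restrict Ω) := (hm 0).add ((hm 1).const_smul _)
  have hB : AEStronglyMeasurable (minus v) (volume.restrict Ω) := (hm 0).sub ((hm 1).const_smul _)
  obtain ⟨⟨h1, h2⟩, h3⟩ := (hΩ.integrableOn_modeDensity_iff hm).1 hv.2
  have i1 := (integrableOn_const_mul_weighted_iff (α := -1) (c := (1 + k : ℝ) ^ 2 / 2) hA).2
    fun h => h1 fun h0 => h (by
      have : (k : ℝ) + 1 = 0 := by exact_mod_cast h0
      rw [add_comm, this]; norm_num)
  have i2 := (integrableOn_const_mul_weighted_iff (α := -1) (c := (1 - k : ℝ) ^ 2 / 2) hB).2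
    fun h => h2 fun h0 => h (by
      have : (k : ℝ) - 1 = 0 := by exact_mod_cast h0
      rw [show (1 : ℝ) - k = 0 by linarith]; norm_num)
  have i3 := (integrableOn_const_mul_weighted_iff (α := -1) (c := (k : ℝ) ^ 2) (hm 2)).2
    fun h => h3 fun h0 => h (by simp [h0])
  have : ∫ p in Ω, modeDensity k v p * p.1 =
      ∫ p in Ω, (((1 + k : ℝ) ^ 2 / 2 * (‖plus v p‖ ^ 2 * p.1 ^ (-1 : ℤ))
        + (1 - k : ℝ) ^ 2 / 2 * (‖minus v p‖ ^ 2 * p.1 ^ (-1 : ℤ)))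
        + (k : ℝ) ^ 2 * (‖v 2 p‖ ^ 2 * p.1 ^ (-1 : ℤ))) := by
    refine integral_congr_ae ?_
    filter_upwards [hΩ.ae_restrict_pos] with p hp using modeDensity_mul k v hp
  have i12 : Integrable (fun p : Plane => (1 + k : ℝ) ^ 2 / 2 * (‖plus v p‖ ^ 2 * p.1 ^ (-1 : ℤ))
        + (1 - k : ℝ) ^ 2 / 2 * (‖minus v p‖ ^ 2 * p.1 ^ (-1 : ℤ))) (volume.restrict Ω) := i1.add i2
  rw [this, integral_add i12 i3, integral_add i1 i2]
  simp only [integral_const_mul]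
  rfl

/-- The semi-norm splits into the norms of three scalar modes. -/
theorem IsHalfPlaneOpen.hkSemi_sq (hΩ : IsHalfPlaneOpen Ω) (hv : MemHk Ω k v) :
    hkSemi Ω k v ^ 2 = 1 / 2 * modeSq Ω (k + 1) (plus v) + 1 / 2 * modeSq Ω (k - 1) (minus v)
      + modeSq Ω k (v 2) := by
  have h := hΩ.h11SemiSq_plus_minus (hv.1 0) (hv.1 1)
  rw [hΩ.hkSemi_sq_eq_add hv, hΩ.integral_modeDensity hv, Fin.sum_univ_three]
  unfold modeSq
  push_cast
  linarith

/-! ### Explicit description of the spaces and of the norms -/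

/-- For `k = 0` both indices `k ± 1` are nonzero, so both combinations, hence both horizontal
components, lie in `L²₋₁`, while the index of `v_z` is zero. -/
theorem IsHalfPlaneOpen.memHkDiamond_zero_iff (hΩ : IsHalfPlaneOpen Ω) :
    MemHkDiamond Ω 0 v ↔
      MemV11Diamond Ω (v 0) ∧ MemV11Diamond Ω (v 1) ∧ MemH11Diamond Ω (v 2) := by
  rw [hΩ.memHkDiamond_iff]
  unfold MemV11Diamond MemV11
  constructor
  · rintro ⟨h1, ⟨h2, h3⟩, -⟩
    obtain ⟨h4, h5⟩ := hΩ.memL2w_of_plus_minus (h2 (by norm_num)) (h3 (by norm_num))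
    exact ⟨⟨⟨(h1 0).1, h4⟩, (h1 0).2⟩, ⟨⟨(h1 1).1, h5⟩, (h1 1).2⟩, h1 2⟩
  · rintro ⟨⟨⟨a1, a2⟩, a3⟩, ⟨⟨b1, b2⟩, b3⟩, c⟩
    refine ⟨fun i => ?_, ⟨fun _ => hΩ.memL2w_plus a2 b2, fun _ => hΩ.memL2w_minus a2 b2⟩,
      fun h => absurd rfl h⟩
    fin_cases i
    exacts [⟨a1, a3⟩, ⟨b1, b3⟩, c]

theorem IsHalfPlaneOpen.memHkDiamond_iff_of_two_le (hΩ : IsHalfPlaneOpen Ω) (hk : 2 ≤ |k|) :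
    MemHkDiamond Ω k v ↔
      MemV11Diamond Ω (v 0) ∧ MemV11Diamond Ω (v 1) ∧ MemV11Diamond Ω (v 2) := by
  have k0 : k ≠ 0 := by rintro rfl; norm_num at hk
  have k1 : k + 1 ≠ 0 := by
    intro h; obtain rfl : k = -1 := by linarith
    norm_num at hk
  have k2 : k - 1 ≠ 0 := by
    intro h; obtain rfl : k = 1 := by linarith
    norm_num at hk
  rw [hΩ.memHkDiamond_iff]
  unfold MemV11Diamond MemV11
  constructor
  · rintro ⟨h1, ⟨h2, h3⟩, h6⟩
    obtain ⟨h4, h5⟩ := hΩ.memL2w_of_plus_minus (h2 k1) (h3 k2)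
    exact ⟨⟨⟨(h1 0).1, h4⟩, (h1 0).2⟩, ⟨⟨(h1 1).1, h5⟩, (h1 1).2⟩,
      ⟨⟨(h1 2).1, h6 k0⟩, (h1 2).2⟩⟩
  · rintro ⟨⟨⟨a1, a2⟩, a3⟩, ⟨⟨b1, b2⟩, b3⟩, ⟨⟨c1, c2⟩, c3⟩⟩
    refine ⟨fun i => ?_, ⟨fun _ => hΩ.memL2w_plus a2 b2, fun _ => hΩ.memL2w_minus a2 b2⟩,
      fun h => c2⟩
    fin_cases i
    exacts [⟨a1, a3⟩, ⟨b1, b3⟩, ⟨c1, c3⟩]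

theorem plus_eq (v : Field2) :
    (fun p => v 0 p + Complex.I * ((1 : ℤ) : ℂ) * v 1 p) = plus v := by
  ext p; simp [plus]

theorem minus_eq (v : Field2) :
    (fun p => v 0 p + Complex.I * ((-1 : ℤ) : ℂ) * v 1 p) = minus v := by
  ext p; simp [minus, sub_eq_add_neg]

theorem eq_one_or_neg_one_of_abs (hk : |k| = 1) : k = 1 ∨ k = -1 := by
  rcases abs_cases k with h | h <;> omega

/-- Exactly one of `k ± 1` is zero. The surviving condition concerns `plus v` if `k = 1` and `minus
v` if `k = -1`, and `v_r + i k v_θ` is that combination in both cases. -/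
theorem IsHalfPlaneOpen.memHkDiamond_iff_of_one (hΩ : IsHalfPlaneOpen Ω) (hk : |k| = 1) :
    MemHkDiamond Ω k v ↔
      MemH11Diamond Ω (v 0) ∧ MemH11Diamond Ω (v 1) ∧ MemV11Diamond Ω (v 2) ∧
        MemL2w (-1) Ω (fun p => v 0 p + Complex.I * (k : ℂ) * v 1 p) := by
  have all : (∀ i, MemH11Diamond Ω (v i)) ↔
      MemH11Diamond Ω (v 0) ∧ MemH11Diamond Ω (v 1) ∧ MemH11Diamond Ω (v 2) := by
    rw [Fin.forall_fin_succ, Fin.forall_fin_two]; rfl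
  rw [hΩ.memHkDiamond_iff, all]
  unfold MemV11Diamond MemV11 MemH11Diamond
  rcases eq_one_or_neg_one_of_abs hk with rfl | rfl
  · rw [plus_eq]
    norm_num
    tauto
  · rw [minus_eq]
    norm_num
    tauto

theorem IsHalfPlaneOpen.hkSemi_zero_sq (hΩ : IsHalfPlaneOpen Ω) (hv : MemHkDiamond Ω 0 v) :
    hkSemi Ω 0 v ^ 2 = v11NormSq Ω (v 0) + v11NormSq Ω (v 1) + h11SemiSq Ω (v 2) := by
  obtain ⟨⟨⟨-, h0⟩, -⟩, ⟨⟨-, h1⟩, -⟩, -⟩ := hΩ.memHkDiamond_zero_iff.1 hv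
  have h := hΩ.l2wNormSq_plus_minus h0 h1
  rw [hΩ.hkSemi_sq_eq_add hv.1, hΩ.integral_modeDensity hv.1, Fin.sum_univ_three]
  unfold v11NormSq
  push_cast
  linarith

theorem IsHalfPlaneOpen.hkSemi_one_sq (hΩ : IsHalfPlaneOpen Ω) (hk : |k| = 1)
    (hv : MemHkDiamond Ω k v) :
    hkSemi Ω k v ^ 2 = h11SemiSq Ω (v 0) + h11SemiSq Ω (v 1) + v11NormSq Ω (v 2)
        + 2 * l2wNormSq (-1) Ω (fun p => v 0 p + Complex.I * (k : ℂ) * v 1 p) := by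
  rw [hΩ.hkSemi_sq_eq_add hv.1, hΩ.integral_modeDensity hv.1, Fin.sum_univ_three]
  unfold v11NormSq
  rcases eq_one_or_neg_one_of_abs hk with rfl | rfl
  · rw [plus_eq]
    push_cast
    ring
  · rw [minus_eq]
    push_cast
    ring

/-- Both norms are diagonal in `plus v`, `minus v`, `v 2`, so only the coefficients `(1 ± k)²/2` and
`k²/2` have to be compared; the remaining terms agree. -/
theorem IsHalfPlaneOpen.hkSemi_sq_bounds (hΩ : IsHalfPlaneOpen Ω) (hk : 2 ≤ |k|)
    (hv : MemHkDiamond Ω k v) :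
    1 / 2 * hkStarSemi Ω k v ≤ hkSemi Ω k v ∧ hkSemi Ω k v ≤ 3 / 2 * hkStarSemi Ω k v := by
  obtain ⟨⟨⟨-, h0⟩, -⟩, ⟨⟨-, h1⟩, -⟩, ⟨⟨-, h2⟩, -⟩⟩ := (hΩ.memHkDiamond_iff_of_two_le hk).1 hv
  have h := hΩ.l2wNormSq_plus_minus h0 h1
  have hk' : (2 : ℝ) ≤ |(k : ℝ)| := by exact_mod_cast hk
  have hsq : (k : ℝ) ^ 2 = |(k : ℝ)| ^ 2 := (sq_abs _).symm
  have nA := hΩ.l2wNormSq_nonneg (-1) (plus v)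
  have nB := hΩ.l2wNormSq_nonneg (-1) (minus v)
  have n2 := hΩ.l2wNormSq_nonneg (-1) (v 2)
  have g0 := hΩ.h11SemiSq_nonneg (v 0)
  have g1 := hΩ.h11SemiSq_nonneg (v 1)
  have g2 := hΩ.h11SemiSq_nonneg (v 2)
  have k2 : 0 ≤ (k : ℝ) ^ 2 := sq_nonneg _
  -- For `|s| ≥ 2` one has `|s|/2 ≤ |s| - 1 ≤ |1 + s| ≤ |s| + 1 ≤ 3|s|/2`, the source of the
  -- constants `1/2` and `3/2`.
  have bl : ∀ s : ℝ, s = k ∨ s = -k → (k : ℝ) ^ 2 / 4 ≤ (1 + s) ^ 2 ∧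
      (1 + s) ^ 2 ≤ 9 / 4 * (k : ℝ) ^ 2 := by
    intro s hs
    have e : (k : ℝ) ^ 2 = s ^ 2 := by rcases hs with rfl | rfl <;> ring
    have e' : (2 : ℝ) ≤ |s| := by rcases hs with rfl | rfl <;> simpa using hk'
    rw [e]
    rcases le_abs.1 e' with h | h <;> constructor <;> nlinarith
  obtain ⟨l1, u1⟩ := bl k (Or.inl rfl)
  obtain ⟨l2, u2⟩ := bl (-k) (Or.inr rfl)
  rw [← sub_eq_add_neg] at l2 u2
  have hstar : 0 ≤ (∑ i, h11SemiSq Ω (v i)) + (k : ℝ) ^ 2 * ∑ i, l2wNormSq (-1) Ω (v i) :=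
    add_nonneg (Finset.sum_nonneg fun i _ => hΩ.h11SemiSq_nonneg _)
      (mul_nonneg k2 (Finset.sum_nonneg fun i _ => hΩ.l2wNormSq_nonneg _ _))
  have e1 : hkStarSemi Ω k v ^ 2 = h11SemiSq Ω (v 0) + h11SemiSq Ω (v 1) + h11SemiSq Ω (v 2) +
      (k : ℝ) ^ 2 / 2 * l2wNormSq (-1) Ω (plus v) + (k : ℝ) ^ 2 / 2 * l2wNormSq (-1) Ω (minus v) +
      (k : ℝ) ^ 2 * l2wNormSq (-1) Ω (v 2) := by
    rw [hkStarSemi, Real.sq_sqrt hstar, Fin.sum_univ_three, Fin.sum_univ_three]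
    linear_combination -(k : ℝ) ^ 2 / 2 * h
  have e2 := hΩ.hkSemi_sq_eq_add hv.1
  rw [hΩ.integral_modeDensity hv.1, Fin.sum_univ_three] at e2
  have m1 := mul_le_mul_of_nonneg_right l1 nA
  have m2 := mul_le_mul_of_nonneg_right u1 nA
  have m3 := mul_le_mul_of_nonneg_right l2 nB
  have m4 := mul_le_mul_of_nonneg_right u2 nB
  have m5 := mul_nonneg k2 n2
  have p1 : 0 ≤ hkSemi Ω k v := Real.sqrt_nonneg _
  have p2 : 0 ≤ hkStarSemi Ω k v := Real.sqrt_nonneg _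
  constructor
  · refine (sq_le_sq₀ (by positivity) p1).1 ?_
    rw [mul_pow, e1, e2]
    linarith
  · refine (sq_le_sq₀ p1 (by positivity)).1 ?_
    rw [mul_pow, e1, e2]
    linarith

/-- The cross term is `-i/2 (|v_r + i v_θ|² - |v_r - i v_θ|²)`, so it is integrable against `1/r`
because both combinations lie in `L²₋₁`. It is purely imaginary, hence the identity is stated in
`ℂ`. -/
theorem IsHalfPlaneOpen.hkSemi_sq_of_two_le (hΩ : IsHalfPlaneOpen Ω) (hk : 2 ≤ |k|)
    (hv : MemHkDiamond Ω k v) :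
    IntegrableOn (fun p : Plane =>
        (v 1 p * (starRingEnd ℂ) (v 0 p) - v 0 p * (starRingEnd ℂ) (v 1 p)) *
          ((p.1⁻¹ : ℝ) : ℂ)) Ω ∧
      ((hkSemi Ω k v ^ 2 : ℝ) : ℂ) =
        (((∑ i, h11SemiSq Ω (v i))
          + (1 + (k : ℝ) ^ 2) * (l2wNormSq (-1) Ω (v 0) + l2wNormSq (-1) Ω (v 1))
          + (k : ℝ) ^ 2 * l2wNormSq (-1) Ω (v 2) : ℝ) : ℂ)
        + 2 * Complex.I * (k : ℂ) * ∫ p in Ω,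
            (v 1 p * (starRingEnd ℂ) (v 0 p) - v 0 p * (starRingEnd ℂ) (v 1 p)) *
              ((p.1⁻¹ : ℝ) : ℂ) := by
  obtain ⟨⟨⟨-, h0⟩, -⟩, ⟨⟨-, h1⟩, -⟩, ⟨⟨-, h2⟩, -⟩⟩ := (hΩ.memHkDiamond_iff_of_two_le hk).1 hv
  have hA := hΩ.memL2w_plus h0 h1
  have hB := hΩ.memL2w_minus h0 h1
  have h := hΩ.l2wNormSq_plus_minus h0 h1
  have hpt : ∀ p : Plane, (v 1 p * (starRingEnd ℂ) (v 0 p) - v 0 p * (starRingEnd ℂ) (v 1 p)) *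
      ((p.1⁻¹ : ℝ) : ℂ) = (-Complex.I / 2) * ((‖plus v p‖ ^ 2 * p.1 ^ (-1 : ℤ)
        - ‖minus v p‖ ^ 2 * p.1 ^ (-1 : ℤ) : ℝ) : ℂ) := by
    intro p
    apply Complex.ext <;>
    · simp only [plus, minus, Pi.add_apply, Pi.sub_apply, Pi.smul_apply, smul_eq_mul,
        Complex.sq_norm, Complex.normSq_apply, Complex.add_re, Complex.add_im, Complex.sub_re,
        Complex.sub_im, Complex.mul_re, Complex.mul_im, Complex.I_re, Complex.I_im, zpow_neg_one,
        Complex.conj_re, Complex.conj_im, Complex.ofReal_re, Complex.ofReal_im,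
        Complex.div_ofNat_re, Complex.div_ofNat_im, Complex.neg_re, Complex.neg_im]
      ring
  have hi : IntegrableOn (fun p : Plane => ‖plus v p‖ ^ 2 * p.1 ^ (-1 : ℤ)
        - ‖minus v p‖ ^ 2 * p.1 ^ (-1 : ℤ)) Ω := hA.2.sub hB.2
  simp only [hpt]
  refine ⟨hi.ofReal.const_mul _, ?_⟩
  have hint : ∫ p in Ω, (-Complex.I / 2) * ((‖plus v p‖ ^ 2 * p.1 ^ (-1 : ℤ)
        - ‖minus v p‖ ^ 2 * p.1 ^ (-1 : ℤ) : ℝ) : ℂ)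
      = (-Complex.I / 2) * ((l2wNormSq (-1) Ω (plus v) - l2wNormSq (-1) Ω (minus v) : ℝ) : ℂ) := by
    rw [integral_const_mul, integral_complex_ofReal, integral_sub hA.2 hB.2]
    rfl
  rw [hint, hΩ.hkSemi_sq_eq_add hv.1, hΩ.integral_modeDensity hv.1]
  have hc : 2 * Complex.I * (k : ℂ) * (-Complex.I / 2 *
      ((l2wNormSq (-1) Ω (plus v) - l2wNormSq (-1) Ω (minus v) : ℝ) : ℂ)) =
      ((k * (l2wNormSq (-1) Ω (plus v) - l2wNormSq (-1) Ω (minus v)) : ℝ) : ℂ) := by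
    push_cast
    linear_combination (-(k : ℂ) * (l2wNormSq (-1) Ω (plus v) - l2wNormSq (-1) Ω (minus v))) *
      Complex.I_sq
  rw [hc, ← Complex.ofReal_add]
  congr 1
  linear_combination (1 + (k : ℝ) ^ 2) / 2 * h

end Axisym

end

noncomputable section

namespace Axisym

open Filter Topology
open scoped ENNReal NNReal Real

/-! ### Cylindrical coordinates -/

/-- The point with cylindrical coordinates `(r, θ, z)`, where `q = (r, z)`. -/
def cyl (q : Plane) (θ : ℝ) : Space := ((q.1 * Real.cos θ, q.1 * Real.sin θ), q.2)

theorem continuous_cyl : Continuous fun x : Plane × ℝ => cyl x.1 x.2 := by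
  unfold cyl
  fun_prop

theorem continuous_cyl_right (q : Plane) : Continuous (cyl q) := by
  unfold cyl
  fun_prop

/-- The scalar Fourier coefficient of index `m`. -/
def mode (m : ℤ) (u : Space → ℂ) (q : Plane) : ℂ :=
  ((√(2 * π) : ℝ) : ℂ)⁻¹ *
    ∫ θ in (-π)..π, u (cyl q θ) * Complex.exp (-(Complex.I * (m : ℂ) * (θ : ℂ)))

/-- One turn around the axis. -/
abbrev turn : Measure ℝ := volume.restrict (Ioc (-π) π)

theorem neg_pi_le_pi : -π ≤ π := by linarith [Real.pi_pos]

theorem mode_eq_integral_turn (m : ℤ) (u : Space → ℂ) (q : Plane) :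
    mode m u q = ((√(2 * π) : ℝ) : ℂ)⁻¹ *
      ∫ θ, u (cyl q θ) * Complex.exp (-(Complex.I * (m : ℂ) * (θ : ℂ))) ∂turn := by
  rw [mode, intervalIntegral.integral_of_le neg_pi_le_pi]

variable {D : Set Space} {u v : Space → ℂ} {m : ℤ}

/-- Rotation by `∓θ` moves the point to the meridian plane and back. There is no sign condition on
`q.1`: the case `q.1 = 0` is used for points on the axis. -/
theorem IsAxisymmetricDomain.cyl_mem_iff (hD : IsAxisymmetricDomain D) {q : Plane} {θ : ℝ} :
    cyl q θ ∈ D ↔ ((q.1, (0 : ℝ)), q.2) ∈ D := by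
  constructor
  · intro h
    have := hD.rot_mem (-θ) _ h
    convert this using 1
    simp only [rot, cyl, Real.cos_neg, Real.sin_neg]
    ext
    · simp only; linear_combination q.1 * (-(Real.cos_sq_add_sin_sq θ))
    · simp only; ring
    · rfl
  · intro h
    have := hD.rot_mem θ _ h
    convert this using 1
    simp only [rot, cyl]
    ext
    · simp only; ring
    · simp only; ring
    · rfl

theorem IsAxisymmetricDomain.isHalfPlaneOpen (hD : IsAxisymmetricDomain D) :
    IsHalfPlaneOpen (halfSection D) := by
  refine ⟨?_, fun p hp => hp.1⟩
  have h1 : IsOpen {p : Plane | 0 < p.1} := isOpen_lt continuous_const continuous_fst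
  have h2 : Continuous fun p : Plane => (((p.1, 0), p.2) : Space) := by fun_prop
  exact h1.inter (hD.isOpen.preimage h2)

/-- Integration in cylindrical coordinates over all of space. -/
theorem lintegral_cyl (f : Space → ℝ≥0∞) (hf : Measurable f) :
    ∫⁻ p, f p = ∫⁻ q in {q : Plane | 0 < q.1}, ENNReal.ofReal q.1 * ∫⁻ θ, f (cyl q θ) ∂turn := by
  have hcyl : Measurable fun x : Plane × ℝ => f (cyl x.1 x.2) := hf.comp continuous_cyl.measurable
  have hF : Measurable fun q : Plane => ∫⁻ θ, f (cyl q θ) ∂turn := hcyl.lintegral_prod_right'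
  have hset : {q : Plane | 0 < q.1} = Ioi (0 : ℝ) ×ˢ univ := by ext; simp
  have lhs : ∫⁻ p, f p = ∫⁻ z, ∫⁻ r in Ioi (0 : ℝ),
      ENNReal.ofReal r * ∫⁻ θ, f (cyl (r, z) θ) ∂turn := by
    rw [Measure.volume_eq_prod, lintegral_prod_symm _ hf.aemeasurable]
    refine lintegral_congr fun z => ?_
    -- Polar coordinates in the horizontal plane at fixed height `z`; their open angular interval
    -- differs from `turn` by a null set.
    rw [← lintegral_comp_polarCoord_symm]
    have htar : polarCoord.target = Ioi (0 : ℝ) ×ˢ Ioo (-π) π := rfl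
    rw [htar, Measure.volume_eq_prod, ← Measure.prod_restrict]
    have hm : Measurable fun p : ℝ × ℝ => ENNReal.ofReal p.1 • f (polarCoord.symm p, z) := by
      refine (measurable_fst.ennreal_ofReal).smul (hf.comp ?_)
      exact (continuous_polarCoord_symm.measurable).prodMk measurable_const
    rw [lintegral_prod _ hm.aemeasurable]
    refine lintegral_congr fun r => ?_
    simp only [smul_eq_mul]
    rw [lintegral_const_mul' _ _ ENNReal.ofReal_ne_top, turn, restrict_Ioo_eq_restrict_Ioc]
    rfl
  have hm2 : Measurable fun q : Plane => ENNReal.ofReal q.1 * ∫⁻ θ, f (cyl q θ) ∂turn :=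
    measurable_fst.ennreal_ofReal.mul hF
  rw [lhs, hset, Measure.volume_eq_prod, ← Measure.prod_restrict, Measure.restrict_univ,
    lintegral_prod_symm _ hm2.aemeasurable]

/-- Integration in cylindrical coordinates over an axisymmetric domain. -/
theorem IsAxisymmetricDomain.lintegral_eq (hD : IsAxisymmetricDomain D) (f : Space → ℝ≥0∞)
    (hf : Measurable f) :
    ∫⁻ p in D, f p = ∫⁻ q, (∫⁻ θ, f (cyl q θ) ∂turn) ∂(wt 1 (halfSection D)) := by
  have hcyl : Measurable fun x : Plane × ℝ => f (cyl x.1 x.2) := hf.comp continuous_cyl.measurable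
  have hF : Measurable fun q : Plane => ∫⁻ θ, f (cyl q θ) ∂turn := hcyl.lintegral_prod_right'
  have hDm := hD.isOpen.measurableSet
  have hΩm := hD.isHalfPlaneOpen.isOpen.measurableSet
  have hpm : MeasurableSet {q : Plane | 0 < q.1} :=
    (isOpen_lt continuous_const continuous_fst).measurableSet
  rw [lintegral_wt _ _ hF.aemeasurable, ← lintegral_indicator hDm,
    lintegral_cyl _ (hf.indicator hDm), ← lintegral_indicator hpm, ← lintegral_indicator hΩm]
  refine lintegral_congr fun q => ?_
  by_cases hq : 0 < q.1
  · rw [indicator_of_mem (show q ∈ {q : Plane | 0 < q.1} from hq)]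
    by_cases hqD : ((q.1, (0 : ℝ)), q.2) ∈ D
    · rw [indicator_of_mem (show q ∈ halfSection D from ⟨hq, hqD⟩), zpow_one]
      congr 1
      refine lintegral_congr fun θ => ?_
      rw [indicator_of_mem (hD.cyl_mem_iff.2 hqD)]
    · rw [indicator_of_notMem (fun h : q ∈ halfSection D => hqD h.2)]
      have : ∀ θ, D.indicator f (cyl q θ) = 0 := fun θ =>
        indicator_of_notMem (fun h => hqD (hD.cyl_mem_iff.1 h)) _
      simp [this]
  · rw [indicator_of_notMem (show q ∉ {q : Plane | 0 < q.1} from hq),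
      indicator_of_notMem (fun h : q ∈ halfSection D => hq h.1)]

/-- The integration formula is applied to the indicator of a measurable null set containing the
exceptional points. -/
theorem IsAxisymmetricDomain.ae_cyl (hD : IsAxisymmetricDomain D) {P : Space → Prop}
    (hP : ∀ᵐ p ∂(volume.restrict D), P p) :
    ∀ᵐ q ∂(wt 1 (halfSection D)), ∀ᵐ θ ∂turn, P (cyl q θ) := by
  obtain ⟨N, hsub, hNm, hN⟩ := exists_measurable_superset_of_null (ae_iff.1 hP)
  have hf : Measurable (N.indicator (1 : Space → ℝ≥0∞)) := measurable_one.indicator hNm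
  have h0 := hD.lintegral_eq _ hf
  rw [lintegral_indicator_one hNm, hN] at h0
  have hcyl : Measurable fun x : Plane × ℝ => N.indicator (1 : Space → ℝ≥0∞) (cyl x.1 x.2) :=
    hf.comp continuous_cyl.measurable
  have hF : Measurable fun q : Plane => ∫⁻ θ, N.indicator (1 : Space → ℝ≥0∞) (cyl q θ) ∂turn :=
    hcyl.lintegral_prod_right'
  filter_upwards [(lintegral_eq_zero_iff hF).1 h0.symm] with q hq
  have hs : Measurable fun θ => N.indicator (1 : Space → ℝ≥0∞) (cyl q θ) :=
    hf.comp (continuous_cyl_right q).measurable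
  filter_upwards [(lintegral_eq_zero_iff hs).1 hq] with θ hθ
  by_contra hn
  have : cyl q θ ∈ N := hsub hn
  simp [this] at hθ

theorem IsAxisymmetricDomain.lintegral_eq' (hD : IsAxisymmetricDomain D) (f : Space → ℝ≥0∞)
    (hf : AEMeasurable f (volume.restrict D)) :
    ∫⁻ p in D, f p = ∫⁻ q, (∫⁻ θ, f (cyl q θ) ∂turn) ∂(wt 1 (halfSection D)) := by
  rw [lintegral_congr_ae hf.ae_eq_mk, hD.lintegral_eq _ hf.measurable_mk]
  refine lintegral_congr_ae ?_
  filter_upwards [hD.ae_cyl hf.ae_eq_mk] with q hq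
  exact lintegral_congr_ae (hq.mono fun θ h => h.symm)

/-! ### Fourier coefficients of square integrable functions -/

theorem mode_congr_at {q : Plane} (h : ∀ᵐ θ ∂turn, u (cyl q θ) = v (cyl q θ)) :
    mode m u q = mode m v q := by
  rw [mode_eq_integral_turn, mode_eq_integral_turn]
  congr 1
  refine integral_congr_ae ?_
  filter_upwards [h] with θ hθ
  rw [hθ]

theorem IsAxisymmetricDomain.mode_congr (hD : IsAxisymmetricDomain D)
    (h : u =ᵐ[volume.restrict D] v) (m : ℤ) :
    mode m u =ᵐ[wt 1 (halfSection D)] mode m v := by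
  filter_upwards [hD.ae_cyl h] with q hq using mode_congr_at hq

theorem continuous_exp_turn (m : ℤ) :
    Continuous fun θ : ℝ => Complex.exp (-(Complex.I * (m : ℂ) * (θ : ℂ))) := by fun_prop

theorem norm_exp_turn (m : ℤ) (θ : ℝ) :
    ‖Complex.exp (-(Complex.I * (m : ℂ) * (θ : ℂ)))‖ = 1 := by
  rw [Complex.norm_exp]
  simp

theorem stronglyMeasurable_mode (hu : StronglyMeasurable u) (m : ℤ) :
    StronglyMeasurable (mode m u) := by
  have h1 : StronglyMeasurable fun x : Plane × ℝ =>
      u (cyl x.1 x.2) * Complex.exp (-(Complex.I * (m : ℂ) * (x.2 : ℂ))) :=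
    (hu.comp_measurable continuous_cyl.measurable).mul
      ((continuous_exp_turn m).comp continuous_snd).stronglyMeasurable
  have h2 := (h1.integral_prod_right' (ν := turn)).const_mul (((√(2 * π) : ℝ) : ℂ)⁻¹)
  convert h2 using 1
  ext q
  exact mode_eq_integral_turn m u q

theorem IsAxisymmetricDomain.aestronglyMeasurable_mode (hD : IsAxisymmetricDomain D)
    (hu : AEStronglyMeasurable u (volume.restrict D)) (m : ℤ) :
    AEStronglyMeasurable (mode m u) (wt 1 (halfSection D)) :=
  ⟨mode m (hu.mk u), stronglyMeasurable_mode hu.stronglyMeasurable_mk m,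
    hD.mode_congr hu.ae_eq_mk m⟩

/-- Tonelli: the total integral of `‖u‖²` is finite, so almost every circle carries a finite part. A
measurable representative is used because slices of an almost everywhere measurable function need
not be measurable. -/
theorem IsAxisymmetricDomain.memLp_slice (hD : IsAxisymmetricDomain D)
    (hu : MemLp u 2 (volume.restrict D)) :
    ∀ᵐ q ∂(wt 1 (halfSection D)), MemLp (fun θ => u (cyl q θ)) 2 turn := by
  set w := hu.aestronglyMeasurable.mk u with hw
  have hwm : StronglyMeasurable w := hu.aestronglyMeasurable.stronglyMeasurable_mk
  have hwe := hu.aestronglyMeasurable.ae_eq_mk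
  have hwL : MemLp w 2 (volume.restrict D) := hu.ae_eq hwe
  have hm : Measurable fun p => ‖w p‖ₑ ^ 2 := hwm.measurable.enorm.pow_const 2
  have hfin : ∫⁻ q, (∫⁻ θ, ‖w (cyl q θ)‖ₑ ^ 2 ∂turn) ∂(wt 1 (halfSection D)) ≠ ⊤ := by
    rw [← hD.lintegral_eq _ hm, lintegral_enorm_sq_eq_eLpNorm_sq]
    exact ENNReal.pow_ne_top hwL.eLpNorm_ne_top
  have hcyl : Measurable fun x : Plane × ℝ => ‖w (cyl x.1 x.2)‖ₑ ^ 2 :=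
    hm.comp continuous_cyl.measurable
  filter_upwards [ae_lt_top hcyl.lintegral_prod_right' hfin, hD.ae_cyl hwe] with q hq1 hq2
  have hs : MemLp (fun θ => w (cyl q θ)) 2 turn := by
    refine ⟨(hwm.comp_measurable (continuous_cyl_right q).measurable).aestronglyMeasurable, ?_⟩
    rw [lintegral_enorm_sq_eq_eLpNorm_sq (fun θ => w (cyl q θ)) turn] at hq1
    simpa using hq1
  exact hs.ae_eq (hq2.mono fun θ h => h.symm)

/-- The coefficients `fourierCoeffOn` carry the factor `1/(2π)`; with `(2π)^{-1/2}` instead, their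
squares gain a factor `2π`, which turns the mean of `‖g‖²` into its integral. -/
theorem parseval_turn {g : ℝ → ℂ} (hg : MemLp g 2 turn) :
    ∑' m : ℤ, ‖((√(2 * π) : ℝ) : ℂ)⁻¹ *
      ∫ θ, g θ * Complex.exp (-(Complex.I * (m : ℂ) * (θ : ℂ))) ∂turn‖ₑ ^ 2
      = ∫⁻ θ, ‖g θ‖ₑ ^ 2 ∂turn := by
  have hab : -π < π := by linarith [Real.pi_pos]
  have h2 : π - -π = 2 * π := by ring
  have key := hasSum_sq_fourierCoeffOn hab hg
  have hcoef : ∀ m : ℤ, ‖((√(2 * π) : ℝ) : ℂ)⁻¹ *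
      ∫ θ, g θ * Complex.exp (-(Complex.I * (m : ℂ) * (θ : ℂ))) ∂turn‖ ^ 2
      = 2 * π * ‖fourierCoeffOn hab g m‖ ^ 2 := by
    intro m
    have hI : ∫ θ, g θ * Complex.exp (-(Complex.I * (m : ℂ) * (θ : ℂ))) ∂turn
        = ((2 * π : ℝ) : ℂ) * fourierCoeffOn hab g m := by
      rw [fourierCoeffOn_eq_integral, intervalIntegral.integral_of_le neg_pi_le_pi, h2,
        Complex.real_smul, ← mul_assoc, ← Complex.ofReal_mul,
        mul_one_div_cancel (by positivity), Complex.ofReal_one, one_mul]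
      refine integral_congr_ae (Eventually.of_forall fun θ => ?_)
      simp only [smul_eq_mul]
      rw [mul_comm, fourier_coe_apply]
      congr 2
      push_cast
      have : (π : ℂ) ≠ 0 := by exact_mod_cast Real.pi_ne_zero
      field_simp
    rw [hI, norm_mul, norm_mul, norm_inv, Complex.norm_real, Complex.norm_real,
      Real.norm_of_nonneg (Real.sqrt_nonneg _), Real.norm_of_nonneg (by positivity), mul_pow,
      mul_pow, inv_pow, Real.sq_sqrt (by positivity)]
    field_simp
  have hsum : HasSum (fun m : ℤ => ‖((√(2 * π) : ℝ) : ℂ)⁻¹ *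
      ∫ θ, g θ * Complex.exp (-(Complex.I * (m : ℂ) * (θ : ℂ))) ∂turn‖ ^ 2)
      (∫ θ, ‖g θ‖ ^ 2 ∂turn) := by
    simp only [hcoef]
    have e : 2 * π * ((π - -π)⁻¹ • ∫ x in (-π)..π, ‖g x‖ ^ 2) = ∫ θ, ‖g θ‖ ^ 2 ∂turn := by
      rw [intervalIntegral.integral_of_le neg_pi_le_pi, h2, smul_eq_mul, ← mul_assoc,
        mul_inv_cancel₀ (by positivity), one_mul]
    rw [← e]
    exact key.mul_left (2 * π)
  rw [← ofReal_integral_norm_sq hg, ← hsum.tsum_eq,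
    ENNReal.ofReal_tsum_of_nonneg (fun m => by positivity) hsum.summable]
  refine tsum_congr fun m => ?_
  rw [ENNReal.ofReal_pow (norm_nonneg _), ofReal_norm]

/-- **Parseval's identity** for the Fourier coefficients of a square integrable function. -/
theorem IsAxisymmetricDomain.parseval (hD : IsAxisymmetricDomain D)
    (hu : MemLp u 2 (volume.restrict D)) :
    ∑' m : ℤ, ∫⁻ q, ‖mode m u q‖ₑ ^ 2 ∂(wt 1 (halfSection D)) = ∫⁻ p in D, ‖u p‖ₑ ^ 2 := by
  rw [hD.lintegral_eq' _ (hu.aestronglyMeasurable.enorm.pow_const 2), ← lintegral_tsum]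
  · refine lintegral_congr_ae ?_
    filter_upwards [hD.memLp_slice hu] with q hq
    simp only [mode_eq_integral_turn]
    exact parseval_turn hq
  · intro m
    exact (hD.aestronglyMeasurable_mode hu.aestronglyMeasurable m).enorm.pow_const 2

/-- A single term of Parseval's sum. This contraction property is what carries identities from test
functions to `H¹₀`. -/
theorem IsAxisymmetricDomain.eLpNorm_mode_le (hD : IsAxisymmetricDomain D)
    (hu : MemLp u 2 (volume.restrict D)) (m : ℤ) :
    eLpNorm (mode m u) 2 (wt 1 (halfSection D)) ≤ eLpNorm u 2 (volume.restrict D) := by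
  have h := hD.parseval hu
  simp only [lintegral_enorm_sq_eq_eLpNorm_sq] at h
  have h1 := ENNReal.le_tsum (f := fun m => eLpNorm (mode m u) 2 (wt 1 (halfSection D)) ^ 2) m
  rw [h] at h1
  exact (ENNReal.pow_le_pow_left_iff two_ne_zero).1 h1

theorem IsAxisymmetricDomain.memLp_mode (hD : IsAxisymmetricDomain D)
    (hu : MemLp u 2 (volume.restrict D)) (m : ℤ) :
    MemLp (mode m u) 2 (wt 1 (halfSection D)) :=
  ⟨hD.aestronglyMeasurable_mode hu.aestronglyMeasurable m,
    (hD.eLpNorm_mode_le hu m).trans_lt hu.eLpNorm_lt_top⟩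

theorem integrable_slice {g : ℝ → ℂ} (hg : MemLp g 2 turn) (m : ℤ) :
    Integrable (fun θ : ℝ => g θ * Complex.exp (-(Complex.I * (m : ℂ) * (θ : ℂ)))) turn := by
  have h1 : Integrable g turn := hg.integrable (by norm_num)
  refine h1.mul_bdd (c := 1) (continuous_exp_turn m).aestronglyMeasurable ?_
  exact Eventually.of_forall fun θ => (norm_exp_turn m θ).le

theorem IsAxisymmetricDomain.mode_smul_add (hD : IsAxisymmetricDomain D) (c : ℂ)
    (hu : MemLp u 2 (volume.restrict D)) (hv : MemLp v 2 (volume.restrict D)) (m : ℤ) :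
    mode m (c • u + v) =ᵐ[wt 1 (halfSection D)] c • mode m u + mode m v := by
  filter_upwards [hD.memLp_slice hu, hD.memLp_slice hv] with q h1 h2
  simp only [Pi.add_apply, Pi.smul_apply, smul_eq_mul, mode_eq_integral_turn, add_mul]
  simp only [mul_assoc c]
  rw [integral_add ((integrable_slice h1 m).const_mul c) (integrable_slice h2 m),
    integral_const_mul]
  ring

theorem IsAxisymmetricDomain.mode_sub (hD : IsAxisymmetricDomain D)
    (hu : MemLp u 2 (volume.restrict D)) (hv : MemLp v 2 (volume.restrict D)) (m : ℤ) :
    mode m (u - v) =ᵐ[wt 1 (halfSection D)] mode m u - mode m v := by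
  have h := hD.mode_smul_add (-1) hv hu m
  have e1 : (-1 : ℂ) • v + u = u - v := by rw [neg_one_smul]; abel
  have e2 : (-1 : ℂ) • mode m v + mode m u = mode m u - mode m v := by rw [neg_one_smul]; abel
  rwa [e1, e2] at h

theorem IsAxisymmetricDomain.ae_eq_zero_of_mode (hD : IsAxisymmetricDomain D)
    (hu : MemLp u 2 (volume.restrict D))
    (h : ∀ m, mode m u =ᵐ[wt 1 (halfSection D)] 0) : u =ᵐ[volume.restrict D] 0 := by
  have key := hD.parseval hu
  simp only [lintegral_enorm_sq_eq_eLpNorm_sq] at key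
  have hz : ∀ m, eLpNorm (mode m u) 2 (wt 1 (halfSection D)) = 0 := fun m => by
    rw [eLpNorm_congr_ae (h m), eLpNorm_zero]
  simp only [hz] at key
  simp only [ne_eq, OfNat.ofNat_ne_zero, not_false_eq_true, zero_pow, tsum_zero] at key
  have h0 := eq_comm.1 key
  rw [pow_eq_zero_iff two_ne_zero, eLpNorm_eq_zero_iff hu.aestronglyMeasurable (by norm_num)] at h0
  exact h0

end Axisym

end

noncomputable section

namespace Axisym

open Filter Topology
open scoped ENNReal NNReal Real

/-! ### Smooth dependence of integrals on parameters -/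

section Parametric

/-- Differentiation under the integral sign: in finite dimension, the parameter derivative is
bounded on the compact product of a closed ball and the interval, and a constant dominates. -/
theorem hasFDerivAt_intervalIntegral_param {E F : Type} [NormedAddCommGroup E] [NormedSpace ℝ E]
    [FiniteDimensional ℝ E] [NormedAddCommGroup F] [NormedSpace ℝ F] {f : E × ℝ → F}
    (hf : ContDiff ℝ 1 f) (a b : ℝ) (x₀ : E) :
    HasFDerivAt (fun x => ∫ t in a..b, f (x, t))
      (∫ t in a..b, (fderiv ℝ f (x₀, t)).comp (ContinuousLinearMap.inl ℝ E ℝ)) x₀ := by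
  have hcont : Continuous fun p : E × ℝ => (fderiv ℝ f p).comp (ContinuousLinearMap.inl ℝ E ℝ) :=
    (hf.continuous_fderiv (by simp)).clm_comp continuous_const
  obtain ⟨C, hC⟩ := ((isCompact_closedBall x₀ 1).prod (isCompact_uIcc (a := a) (b := b))
    ).exists_bound_of_continuousOn hcont.continuousOn
  have hfc : ∀ x, Continuous fun t => f (x, t) := fun x =>
    hf.continuous.comp (continuous_const.prodMk continuous_id)
  refine intervalIntegral.hasFDerivAt_integral_of_dominated_of_fderiv_le
    (F' := fun x t => (fderiv ℝ f (x, t)).comp (ContinuousLinearMap.inl ℝ E ℝ))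
    (bound := fun _ => C) (s := Metric.closedBall x₀ 1)
    (Metric.closedBall_mem_nhds _ one_pos) ?_ ?_ ?_ ?_ ?_ ?_
  · exact Eventually.of_forall fun x => (hfc x).aestronglyMeasurable
  · exact (hfc x₀).intervalIntegrable _ _
  · exact (hcont.comp (continuous_const.prodMk continuous_id)).aestronglyMeasurable
  · exact Eventually.of_forall fun t ht x hx => hC (x, t) ⟨hx, uIoc_subset_uIcc ht⟩
  · exact intervalIntegrable_const
  · refine Eventually.of_forall fun t _ x _ => ?_
    have h1 : HasFDerivAt f (fderiv ℝ f (x, t)) (x, t) :=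
      (hf.differentiable (by simp)).differentiableAt.hasFDerivAt
    exact h1.comp x (hasFDerivAt_prodMk_left x t)

theorem contDiff_intervalIntegral_param_nat {E : Type} [NormedAddCommGroup E] [NormedSpace ℝ E]
    [FiniteDimensional ℝ E] (a b : ℝ) (n : ℕ) :
    ∀ {F : Type} [NormedAddCommGroup F] [NormedSpace ℝ F] {f : E × ℝ → F},
    ContDiff ℝ ∞ f → ContDiff ℝ n (fun x => ∫ t in a..b, f (x, t)) := by
  induction n with
  | zero =>
    intro F _ _ f hf
    have h := fun x => (hasFDerivAt_intervalIntegral_param (hf.of_le (by simp)) a b x).continuousAt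
    simpa [contDiff_zero] using continuous_iff_continuousAt.2 h
  | succ n ih =>
    intro F _ _ f hf
    have h := hasFDerivAt_intervalIntegral_param (hf.of_le (by simp)) a b
    push_cast
    rw [contDiff_succ_iff_fderiv]
    refine ⟨fun x => (h x).differentiableAt, by simp, ?_⟩
    have e : fderiv ℝ (fun x => ∫ t in a..b, f (x, t)) =
        fun x => ∫ t in a..b, (fderiv ℝ f (x, t)).comp (ContinuousLinearMap.inl ℝ E ℝ) :=
      funext fun x => (h x).fderiv
    rw [e]
    -- The derivative is again a parametric integral, with values in a space of linear maps; for
    -- this reason the target space is quantified inside the induction.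
    exact ih (f := fun p => (fderiv ℝ f p).comp (ContinuousLinearMap.inl ℝ E ℝ))
      ((hf.fderiv_right (by simp)).clm_comp contDiff_const)

theorem contDiff_intervalIntegral_param {E F : Type} [NormedAddCommGroup E] [NormedSpace ℝ E]
    [FiniteDimensional ℝ E] [NormedAddCommGroup F] [NormedSpace ℝ F] {f : E × ℝ → F}
    (hf : ContDiff ℝ ∞ f) (a b : ℝ) : ContDiff ℝ ∞ (fun x => ∫ t in a..b, f (x, t)) :=
  contDiff_infty.2 fun n => contDiff_intervalIntegral_param_nat a b n hf

end Parametric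

/-! ### Radial and angular derivatives -/

/-- The angular coordinate. -/
def angle (p : Space) : ℝ := Complex.arg (p.1.1 + p.1.2 * Complex.I)

/-- The radial component of the horizontal vector with components `a, b`. -/
def radial (a b : Space → ℂ) (p : Space) : ℂ :=
  Real.cos (angle p) * a p + Real.sin (angle p) * b p

/-- The angular component of the horizontal vector with components `a, b`. -/
def angular (a b : Space → ℂ) (p : Space) : ℂ :=
  -Real.sin (angle p) * a p + Real.cos (angle p) * b p

theorem measurable_angle : Measurable angle := by
  have h : Continuous fun p : Space => (p.1.1 : ℂ) + p.1.2 * Complex.I := by fun_prop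
  exact Complex.measurable_arg.comp h.measurable

theorem angle_cyl {q : Plane} (hq : 0 < q.1) {θ : ℝ} (hθ : θ ∈ Ioc (-π) π) :
    angle (cyl q θ) = θ := by
  have h := Complex.arg_mul_cos_add_sin_mul_I hq hθ
  refine Eq.trans ?_ h
  simp only [angle, cyl]
  congr 1
  push_cast
  ring

theorem norm_radial_sq_add_norm_angular_sq (a b : Space → ℂ) (p : Space) :
    ‖radial a b p‖ ^ 2 + ‖angular a b p‖ ^ 2 = ‖a p‖ ^ 2 + ‖b p‖ ^ 2 := by
  have h := Real.cos_sq_add_sin_sq (angle p)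
  simp only [radial, angular, Complex.sq_norm, Complex.normSq_apply, Complex.add_re,
    Complex.add_im, Complex.mul_re, Complex.mul_im, Complex.ofReal_re, Complex.ofReal_im,
    Complex.neg_re, Complex.neg_im]
  linear_combination ((a p).re ^ 2 + (a p).im ^ 2 + (b p).re ^ 2 + (b p).im ^ 2) * h

section

variable {ν : Measure Space} {a b a' b' : Space → ℂ}

theorem aestronglyMeasurable_radial (ha : AEStronglyMeasurable a ν)
    (hb : AEStronglyMeasurable b ν) : AEStronglyMeasurable (radial a b) ν := by
  have hc : Measurable fun p => ((Real.cos (angle p) : ℝ) : ℂ) :=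
    Complex.measurable_ofReal.comp (Real.measurable_cos.comp measurable_angle)
  have hs : Measurable fun p => ((Real.sin (angle p) : ℝ) : ℂ) :=
    Complex.measurable_ofReal.comp (Real.measurable_sin.comp measurable_angle)
  exact (hc.aestronglyMeasurable.mul ha).add (hs.aestronglyMeasurable.mul hb)

theorem aestronglyMeasurable_angular (ha : AEStronglyMeasurable a ν)
    (hb : AEStronglyMeasurable b ν) : AEStronglyMeasurable (angular a b) ν := by
  have hc : Measurable fun p => ((Real.cos (angle p) : ℝ) : ℂ) :=
    Complex.measurable_ofReal.comp (Real.measurable_cos.comp measurable_angle)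
  have hs : Measurable fun p => ((Real.sin (angle p) : ℝ) : ℂ) :=
    Complex.measurable_ofReal.comp (Real.measurable_sin.comp measurable_angle)
  exact (hs.aestronglyMeasurable.neg.mul ha).add (hc.aestronglyMeasurable.mul hb)

theorem memLp_radial (ha : MemLp a 2 ν) (hb : MemLp b 2 ν) : MemLp (radial a b) 2 ν := by
  have h := aestronglyMeasurable_radial ha.aestronglyMeasurable hb.aestronglyMeasurable
  rw [memLp_two_iff_integrable_sq_norm h]
  refine ((integrable_norm_sq ha).add (integrable_norm_sq hb)).mono' (h.norm.pow 2) ?_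
  refine Eventually.of_forall fun p => ?_
  rw [Real.norm_of_nonneg (by positivity), Pi.add_apply, ← norm_radial_sq_add_norm_angular_sq]
  exact le_add_of_nonneg_right (by positivity)

theorem memLp_angular (ha : MemLp a 2 ν) (hb : MemLp b 2 ν) : MemLp (angular a b) 2 ν := by
  have h := aestronglyMeasurable_angular ha.aestronglyMeasurable hb.aestronglyMeasurable
  rw [memLp_two_iff_integrable_sq_norm h]
  refine ((integrable_norm_sq ha).add (integrable_norm_sq hb)).mono' (h.norm.pow 2) ?_
  refine Eventually.of_forall fun p => ?_
  rw [Real.norm_of_nonneg (by positivity), Pi.add_apply, ← norm_radial_sq_add_norm_angular_sq]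
  exact le_add_of_nonneg_left (by positivity)

theorem integral_radial_add_angular (ha : MemLp a 2 ν) (hb : MemLp b 2 ν) :
    (∫ p, ‖radial a b p‖ ^ 2 ∂ν) + ∫ p, ‖angular a b p‖ ^ 2 ∂ν
      = (∫ p, ‖a p‖ ^ 2 ∂ν) + ∫ p, ‖b p‖ ^ 2 ∂ν := by
  rw [← integral_add (integrable_norm_sq (memLp_radial ha hb))
    (integrable_norm_sq (memLp_angular ha hb)),
    ← integral_add (integrable_norm_sq ha) (integrable_norm_sq hb)]
  congr 1; ext p
  exact norm_radial_sq_add_norm_angular_sq a b p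

theorem radial_sub (a b a' b' : Space → ℂ) :
    radial a b - radial a' b' = radial (a - a') (b - b') := by
  ext p; simp only [radial, Pi.sub_apply]; ring

theorem angular_sub (a b a' b' : Space → ℂ) :
    angular a b - angular a' b' = angular (a - a') (b - b') := by
  ext p; simp only [angular, Pi.sub_apply]; ring

theorem integral_radial_le (ha : MemLp a 2 ν) (hb : MemLp b 2 ν) :
    ∫ p, ‖radial a b p‖ ^ 2 ∂ν ≤ (∫ p, ‖a p‖ ^ 2 ∂ν) + ∫ p, ‖b p‖ ^ 2 ∂ν := by
  rw [← integral_radial_add_angular ha hb]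
  exact le_add_of_nonneg_right (integral_nonneg fun p => by positivity)

theorem integral_angular_le (ha : MemLp a 2 ν) (hb : MemLp b 2 ν) :
    ∫ p, ‖angular a b p‖ ^ 2 ∂ν ≤ (∫ p, ‖a p‖ ^ 2 ∂ν) + ∫ p, ‖b p‖ ^ 2 ∂ν := by
  rw [← integral_radial_add_angular ha hb]
  exact le_add_of_nonneg_left (integral_nonneg fun p => by positivity)

theorem tendsto_radial {as bs : ℕ → Space → ℂ} (has : ∀ n, MemLp (as n) 2 ν)
    (hbs : ∀ n, MemLp (bs n) 2 ν) (h1 : Tendsto (fun n => eLpNorm (as n) 2 ν) atTop (𝓝 0))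
    (h2 : Tendsto (fun n => eLpNorm (bs n) 2 ν) atTop (𝓝 0)) :
    Tendsto (fun n => eLpNorm (radial (as n) (bs n)) 2 ν) atTop (𝓝 0) := by
  rw [tendsto_eLpNorm_iff has] at h1
  rw [tendsto_eLpNorm_iff hbs] at h2
  rw [tendsto_eLpNorm_iff fun n => memLp_radial (has n) (hbs n)]
  have h3 := h1.add h2
  rw [add_zero] at h3
  exact squeeze_zero (fun n => integral_nonneg fun p => by positivity)
    (fun n => integral_radial_le (has n) (hbs n)) h3

theorem tendsto_angular {as bs : ℕ → Space → ℂ} (has : ∀ n, MemLp (as n) 2 ν)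
    (hbs : ∀ n, MemLp (bs n) 2 ν) (h1 : Tendsto (fun n => eLpNorm (as n) 2 ν) atTop (𝓝 0))
    (h2 : Tendsto (fun n => eLpNorm (bs n) 2 ν) atTop (𝓝 0)) :
    Tendsto (fun n => eLpNorm (angular (as n) (bs n)) 2 ν) atTop (𝓝 0) := by
  rw [tendsto_eLpNorm_iff has] at h1
  rw [tendsto_eLpNorm_iff hbs] at h2
  rw [tendsto_eLpNorm_iff fun n => memLp_angular (has n) (hbs n)]
  have h3 := h1.add h2
  rw [add_zero] at h3
  exact squeeze_zero (fun n => integral_nonneg fun p => by positivity)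
    (fun n => integral_angular_le (has n) (hbs n)) h3

end

/-! ### Fourier coefficients of smooth functions -/

/-- The partial derivative in a Cartesian direction. -/
def partialDeriv (j : Fin 3) (φ : Space → ℂ) (p : Space) : ℂ := fderiv ℝ φ p (cart j)

variable {D : Set Space} {φ : Space → ℂ} {m : ℤ}

/-- Passage from `(r, z)` to Cartesian coordinates, as a linear map. -/
def cylL (θ : ℝ) : Plane →L[ℝ] Space :=
  ((Real.cos θ • ContinuousLinearMap.fst ℝ ℝ ℝ).prod
    (Real.sin θ • ContinuousLinearMap.fst ℝ ℝ ℝ)).prod (ContinuousLinearMap.snd ℝ ℝ ℝ)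

theorem cylL_apply (θ : ℝ) (q : Plane) : cylL θ q = cyl q θ := by
  simp [cylL, cyl, mul_comm]

theorem contDiff_cyl : ContDiff ℝ ∞ fun x : Plane × ℝ => cyl x.1 x.2 := by
  unfold cyl
  have h1 : ContDiff ℝ ∞ fun x : Plane × ℝ => Real.cos x.2 := Real.contDiff_cos.comp contDiff_snd
  have h2 : ContDiff ℝ ∞ fun x : Plane × ℝ => Real.sin x.2 := Real.contDiff_sin.comp contDiff_snd
  have h3 : ContDiff ℝ ∞ fun x : Plane × ℝ => x.1.1 := contDiff_fst.comp contDiff_fst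
  have h4 : ContDiff ℝ ∞ fun x : Plane × ℝ => x.1.2 := contDiff_snd.comp contDiff_fst
  exact ((h3.mul h1).prodMk (h3.mul h2)).prodMk h4

theorem contDiff_mode_integrand (hφ : ContDiff ℝ ∞ φ) (m : ℤ) :
    ContDiff ℝ ∞ fun x : Plane × ℝ =>
      φ (cyl x.1 x.2) * Complex.exp (-(Complex.I * (m : ℂ) * (x.2 : ℂ))) := by
  refine (hφ.comp contDiff_cyl).mul (ContDiff.cexp (ContDiff.neg (contDiff_const.mul ?_)))
  exact Complex.ofRealCLM.contDiff.comp contDiff_snd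

theorem contDiff_mode (hφ : ContDiff ℝ ∞ φ) (m : ℤ) : ContDiff ℝ ∞ (mode m φ) :=
  contDiff_const.mul (contDiff_intervalIntegral_param (contDiff_mode_integrand hφ m) (-π) π)

/-- For fixed `θ` the map `cyl · θ` is linear, so the chain rule yields the derivative of `φ` in the
direction `cyl e θ`. -/
theorem fderiv_mode (hφ : ContDiff ℝ ∞ φ) (m : ℤ) (q e : Plane) :
    fderiv ℝ (mode m φ) q e = ((√(2 * π) : ℝ) : ℂ)⁻¹ * ∫ θ in (-π)..π,
      fderiv ℝ φ (cyl q θ) (cyl e θ) * Complex.exp (-(Complex.I * (m : ℂ) * (θ : ℂ))) := by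
  have hf := (contDiff_mode_integrand hφ m).of_le (m := 1) (by simp)
  have h := (hasFDerivAt_intervalIntegral_param hf (-π) π q).const_mul (((√(2 * π) : ℝ) : ℂ)⁻¹)
  have hm : fderiv ℝ (mode m φ) q = _ := h.fderiv
  rw [hm, smul_apply, smul_eq_mul,
    ContinuousLinearMap.intervalIntegral_apply]
  · congr 1
    refine intervalIntegral.integral_congr fun θ _ => ?_
    have h1 : HasFDerivAt (fun y : Plane => φ (cyl y θ)) ((fderiv ℝ φ (cyl q θ)).comp (cylL θ)) q := by
      have hd : HasFDerivAt φ (fderiv ℝ φ (cylL θ q)) (cylL θ q) :=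
        (hφ.differentiable (by simp)).differentiableAt.hasFDerivAt
      have := hd.comp q (cylL θ).hasFDerivAt
      simpa [Function.comp_def, cylL_apply] using this
    have h2 := h1.mul_const (Complex.exp (-(Complex.I * (m : ℂ) * (θ : ℂ))))
    have hd2 := ((hf.differentiable (by simp)).differentiableAt (x := (q, θ))).hasFDerivAt
    have h3 := hd2.comp q (hasFDerivAt_prodMk_left (𝕜 := ℝ) q θ)
    have h4 := h3.unique h2
    rw [h4]
    simp [cylL_apply, mul_comm]
  · refine Continuous.intervalIntegrable ?_ _ _
    exact ((hf.continuous_fderiv (by simp)).comp (continuous_const.prodMk continuous_id)).clm_comp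
      continuous_const

theorem cyl_radial (θ : ℝ) : cyl (1, 0) θ = Real.cos θ • cart 0 + Real.sin θ • cart 1 := by
  simp [cyl, cart]

theorem cyl_axial (θ : ℝ) : cyl (0, 1) θ = cart 2 := by
  simp [cyl, cart]

/-- For `r > 0` the function `angle` recovers `θ` on the circle, and the derivative in the direction
`(cos θ, sin θ, 0)` is `∂_r`. -/
theorem mode_radial (hφ : ContDiff ℝ ∞ φ) (m : ℤ) {q : Plane} (hq : 0 < q.1) :
    mode m (radial (partialDeriv 0 φ) (partialDeriv 1 φ)) q = fderiv ℝ (mode m φ) q (1, 0) := by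
  rw [fderiv_mode hφ, mode, intervalIntegral.integral_of_le neg_pi_le_pi,
    intervalIntegral.integral_of_le neg_pi_le_pi]
  congr 1
  refine setIntegral_congr_fun measurableSet_Ioc fun θ hθ => ?_
  simp only [radial, angle_cyl hq hθ, cyl_radial, map_add, map_smul, partialDeriv,
    Complex.real_smul]

theorem mode_axial (hφ : ContDiff ℝ ∞ φ) (m : ℤ) (q : Plane) :
    mode m (partialDeriv 2 φ) q = fderiv ℝ (mode m φ) q (0, 1) := by
  rw [fderiv_mode hφ, mode]
  simp only [cyl_axial, partialDeriv]

/-- The derivative of `φ` along the circle is `r` times its angular component. Integration by parts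
moves it onto `e^{-imθ}`. -/
theorem mode_angular (hφ : ContDiff ℝ ∞ φ) (m : ℤ) {q : Plane} (hq : 0 < q.1) :
    mode m (angular (partialDeriv 0 φ) (partialDeriv 1 φ)) q
      = Complex.I * m / q.1 * mode m φ q := by
  have hq' : (q.1 : ℂ) ≠ 0 := by exact_mod_cast hq.ne'
  set E : ℝ → ℂ := fun θ => Complex.exp (-(Complex.I * (m : ℂ) * (θ : ℂ))) with hE
  set G : ℝ → ℂ := fun θ => -Real.sin θ * partialDeriv 0 φ (cyl q θ)
    + Real.cos θ * partialDeriv 1 φ (cyl q θ) with hG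
  have hpc : ∀ j, Continuous (partialDeriv j φ) := fun j =>
    continuous_fderiv_apply_of_contDiff hφ _
  have hGc : Continuous G := by
    have h0 := (hpc 0).comp (continuous_cyl_right q)
    have h1 := (hpc 1).comp (continuous_cyl_right q)
    have hs : Continuous fun θ : ℝ => ((Real.sin θ : ℝ) : ℂ) := by fun_prop
    have hc : Continuous fun θ : ℝ => ((Real.cos θ : ℝ) : ℂ) := by fun_prop
    exact (hs.neg.mul h0).add (hc.mul h1)
  have hd : ∀ θ, HasDerivAt (fun θ => φ (cyl q θ)) (q.1 * G θ) θ := by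
    intro θ
    have h1 : HasDerivAt (cyl q) ((q.1 * -Real.sin θ, q.1 * Real.cos θ), 0) θ :=
      (((Real.hasDerivAt_cos θ).const_mul q.1).prodMk
        ((Real.hasDerivAt_sin θ).const_mul q.1)).prodMk (hasDerivAt_const θ q.2)
    have h2 : HasFDerivAt φ (fderiv ℝ φ (cyl q θ)) (cyl q θ) :=
      (hφ.differentiable (by simp)).differentiableAt.hasFDerivAt
    have h3 := h2.comp_hasDerivAt θ h1
    have e : (((q.1 * -Real.sin θ, q.1 * Real.cos θ), 0) : Space)
        = q.1 • (-Real.sin θ • cart 0 + Real.cos θ • cart 1) := by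
      simp [cart]
    rw [e, map_smul, map_add, map_smul, map_smul] at h3
    refine h3.congr_deriv ?_
    simp only [hG, partialDeriv, Complex.real_smul, Complex.ofReal_neg]
  have hEd : ∀ θ : ℝ, HasDerivAt E (-(Complex.I * m) * E θ) θ := by
    intro θ
    have h1 : HasDerivAt (fun t : ℝ => -(Complex.I * (m : ℂ) * (t : ℂ))) (-(Complex.I * m)) θ := by
      have := ((Complex.ofRealCLM.hasDerivAt (x := θ)).const_mul (Complex.I * (m : ℂ))).fun_neg
      simpa using this
    exact h1.cexp.congr_deriv (mul_comm _ _)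
  have hEc : Continuous E := continuous_exp_turn m
  have hφc : Continuous fun θ => φ (cyl q θ) := hφ.continuous.comp (continuous_cyl_right q)
  have key := intervalIntegral.integral_mul_deriv_eq_deriv_mul (a := -π) (b := π)
    (u := fun θ => φ (cyl q θ)) (v := E) (fun θ _ => hd θ) (fun θ _ => hEd θ)
    ((continuous_const.mul hGc).intervalIntegrable _ _)
    ((continuous_const.mul hEc).intervalIntegrable _ _)
  -- The circle closes up and `m` is an integer, so the boundary terms cancel.
  have hper : cyl q π = cyl q (-π) := by simp [cyl]
  have hEper : E π = E (-π) := by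
    simp only [hE]
    rw [Complex.exp_eq_exp_iff_exists_int]
    refine ⟨-m, ?_⟩
    push_cast
    ring
  simp only [hper, hEper, sub_self, zero_sub] at key
  have hA : mode m (angular (partialDeriv 0 φ) (partialDeriv 1 φ)) q
      = ((√(2 * π) : ℝ) : ℂ)⁻¹ * ∫ θ in (-π)..π, G θ * E θ := by
    rw [mode, intervalIntegral.integral_of_le neg_pi_le_pi,
      intervalIntegral.integral_of_le neg_pi_le_pi]
    congr 1
    refine setIntegral_congr_fun measurableSet_Ioc fun θ hθ => ?_
    simp only [angular, angle_cyl hq hθ, hG, hE]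
  have h1 : ∫ θ in (-π)..π, φ (cyl q θ) * (-(Complex.I * m) * E θ)
      = -(Complex.I * m) * ∫ θ in (-π)..π, φ (cyl q θ) * E θ := by
    rw [← intervalIntegral.integral_const_mul]
    congr 1; ext θ; ring
  have h2 : ∫ θ in (-π)..π, q.1 * G θ * E θ = q.1 * ∫ θ in (-π)..π, G θ * E θ := by
    rw [← intervalIntegral.integral_const_mul]
    congr 1; ext θ; ring
  rw [h1, h2] at key
  have h3 : ∫ θ in (-π)..π, G θ * E θ
      = Complex.I * m / q.1 * ∫ θ in (-π)..π, φ (cyl q θ) * E θ := by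
    field_simp
    linear_combination key
  rw [hA, h3, mode]
  ring

/-- The trace of a set of points on the meridian plane, after rotation. -/
def meridianImage (K : Set Space) : Set Plane :=
  {q | ∃ θ ∈ Icc (-π) π, cyl q θ ∈ K}

/-- Take the pairs of a point of `K` and an angle whose meridian plane contains the point: a closed
subset of a compact product. The image under `(p, θ) ↦ (x cos θ + y sin θ, z)` is the set in
question. -/
theorem isCompact_meridianImage {K : Set Space} (hK : IsCompact K) :
    IsCompact (meridianImage K) := by
  have h1 : IsCompact ((K ×ˢ Icc (-π) π) ∩
      {x : Space × ℝ | -x.1.1.1 * Real.sin x.2 + x.1.1.2 * Real.cos x.2 = 0}) :=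
    (hK.prod isCompact_Icc).inter_right (isClosed_eq (by fun_prop) continuous_const)
  have h2 : Continuous fun x : Space × ℝ =>
      ((x.1.1.1 * Real.cos x.2 + x.1.1.2 * Real.sin x.2, x.1.2) : Plane) := by fun_prop
  convert h1.image h2 using 1
  ext q
  constructor
  · rintro ⟨θ, hθ, hq⟩
    refine ⟨(cyl q θ, θ), ⟨⟨hq, hθ⟩, ?_⟩, ?_⟩
    · simp only [cyl, mem_ofPred_eq]; ring
    · simp only [cyl]
      ext
      · simp only; linear_combination q.1 * Real.cos_sq_add_sin_sq θ
      · rfl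
  · rintro ⟨⟨p, θ⟩, ⟨⟨hp, hθ⟩, h0⟩, rfl⟩
    refine ⟨θ, hθ, ?_⟩
    simp only [mem_ofPred_eq] at h0
    convert hp using 1
    simp only [cyl]
    have h := Real.cos_sq_add_sin_sq θ
    ext
    · simp only; linear_combination p.1.1 * h + Real.sin θ * h0
    · simp only; linear_combination p.1.2 * h - Real.cos θ * h0
    · rfl

theorem tsupport_mode_subset (hc : HasCompactSupport φ) (m : ℤ) :
    tsupport (mode m φ) ⊆ meridianImage (tsupport φ) := by
  refine closure_minimal ?_ (isCompact_meridianImage hc).isClosed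
  intro q hq
  by_contra hn
  apply hq
  have h0 : ∀ θ ∈ Icc (-π) π, φ (cyl q θ) = 0 := fun θ hθ =>
    image_eq_zero_of_notMem_tsupport fun h => hn ⟨θ, hθ, h⟩
  have : ∫ θ in (-π)..π, φ (cyl q θ) * Complex.exp (-(Complex.I * (m : ℂ) * (θ : ℂ)))
      = ∫ θ in (-π)..π, (0 : ℂ) := by
    refine intervalIntegral.integral_congr fun θ hθ => ?_
    rw [uIcc_of_le neg_pi_le_pi] at hθ
    simp [h0 θ hθ]
  rw [mode, this]
  simp

theorem hasCompactSupport_mode (hc : HasCompactSupport φ) (m : ℤ) :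
    HasCompactSupport (mode m φ) :=
  (isCompact_meridianImage hc).of_isClosed_subset (isClosed_tsupport _)
    (tsupport_mode_subset hc m)

/-- A point of `D` on the axis is a limit of points of the half section with `r ↓ 0` but is not in
it. Openness of `D` gives the same for nearby points of the axis. -/
theorem mem_axisBoundary (hD : IsAxisymmetricDomain D) {z : ℝ} (hz : (((0 : ℝ), (0 : ℝ)), z) ∈ D) :
    ((0 : ℝ), z) ∈ axisBoundary (halfSection D) := by
  refine ⟨rfl, mem_interior.2 ⟨{z : ℝ | (((0 : ℝ), (0 : ℝ)), z) ∈ D}, ?_, ?_, hz⟩⟩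
  · intro w hw
    rw [mem_ofPred_eq, frontier, hD.isHalfPlaneOpen.isOpen.interior_eq]
    refine ⟨?_, fun h => lt_irrefl _ h.1⟩
    have hcont : Continuous fun t : ℝ => ((t, w) : Plane) := by fun_prop
    have ht : Tendsto (fun t : ℝ => ((t, w) : Plane)) (𝓝[>] 0) (𝓝 (0, w)) :=
      (hcont.tendsto 0).mono_left nhdsWithin_le_nhds
    refine mem_closure_of_tendsto ht ?_
    have hcont2 : Continuous fun t : ℝ => (((t, 0), w) : Space) := by fun_prop
    have hev : ∀ᶠ t in 𝓝 (0 : ℝ), (((t, 0), w) : Space) ∈ D :=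
      hcont2.continuousAt.eventually_mem (hD.isOpen.mem_nhds hw)
    filter_upwards [self_mem_nhdsWithin, nhdsWithin_le_nhds hev] with t h1 h2
    exact ⟨h1, h2⟩
  · have : Continuous fun z : ℝ => ((((0 : ℝ), (0 : ℝ)), z) : Space) := by fun_prop
    exact hD.isOpen.preimage this

/-- A boundary point in the support of the mode comes from a point of `D`. If `r > 0`, it would lie
in the open half section; if `r = 0`, it lies in `axisBoundary`, which is not part of the outer
boundary. -/
theorem disjoint_tsupport_mode (hD : IsAxisymmetricDomain D) (hc : HasCompactSupport φ)
    (hs : tsupport φ ⊆ D) (m : ℤ) :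
    Disjoint (tsupport (mode m φ)) (outerBoundary (halfSection D)) := by
  rw [Set.disjoint_left]
  rintro q hq ⟨hfr, hax⟩
  obtain ⟨θ, -, hθ⟩ := tsupport_mode_subset hc m hq
  have hqD := hD.cyl_mem_iff.1 (hs hθ)
  have hcl : closure (halfSection D) ⊆ {q : Plane | 0 ≤ q.1} :=
    closure_minimal (fun q hq => le_of_lt hq.1) (isClosed_le continuous_const continuous_fst)
  have h0 : 0 ≤ q.1 := hcl (frontier_subset_closure hfr)
  rcases h0.lt_or_eq with h | h
  · rw [frontier, hD.isHalfPlaneOpen.isOpen.interior_eq] at hfr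
    exact hfr.2 ⟨h, hqD⟩
  · obtain ⟨r, z⟩ := q
    simp only at h hqD
    subst h
    exact hax (mem_axisBoundary hD hqD)

end Axisym

end

noncomputable section

namespace Axisym

open Filter Topology
open scoped ENNReal NNReal Real

/-! ### The space `H¹` on the three-dimensional domain -/

variable {D : Set Space} {u v : Space → ℂ} {m : ℤ}

instance isAddHaarMeasure_volume_space : (volume : Measure Space).IsAddHaarMeasure :=
  Measure.prod.instIsAddHaarMeasure (volume : Measure (ℝ × ℝ)) (volume : Measure ℝ)

theorem memLp_restrict_of_continuous {φ : Space → ℂ} (hφ : Continuous φ)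
    (hc : HasCompactSupport φ) (D : Set Space) : MemLp φ 2 (volume.restrict D) :=
  (hφ.memLp_of_hasCompactSupport hc).restrict D

theorem memH1_iff (hD : IsOpen D) :
    MemH1 D u ↔ MemLp u 2 (volume.restrict D) ∧ ∀ j, HasWeakDeriv D (cart j) u
      (weakDeriv D (cart j) u) ∧ MemLp (weakDeriv D (cart j) u) 2 (volume.restrict D) := by
  constructor
  · rintro ⟨h1, h2⟩
    refine ⟨h1, fun j => ?_⟩
    obtain ⟨g, hg, hg'⟩ := h2 j
    exact ⟨hg.weakDeriv_spec, hg'.ae_eq (hg.weakDeriv_ae_eq hD).symm⟩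
  · rintro ⟨h1, h2⟩
    exact ⟨h1, fun j => ⟨_, h2 j⟩⟩

theorem memH1_smul_add (hD : IsOpen D) (c : ℂ) (hu : MemH1 D u) (hv : MemH1 D v) :
    MemH1 D (c • u + v) := by
  rw [memH1_iff hD] at hu hv
  exact ⟨(hu.1.const_smul c).add hv.1, fun j => ⟨_, ((hu.2 j).1.const_smul c).add (hv.2 j).1,
    ((hu.2 j).2.const_smul c).add (hv.2 j).2⟩⟩

theorem memH1_sub (hD : IsOpen D) (hu : MemH1 D u) (hv : MemH1 D v) : MemH1 D (u - v) := by
  have := memH1_smul_add hD (-1) hv hu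
  simpa [sub_eq_add_neg, add_comm] using this

theorem hasWeakDeriv_partialDeriv {φ : Space → ℂ} (hφ : ContDiff ℝ ∞ φ) (D : Set Space)
    (j : Fin 3) : HasWeakDeriv D (cart j) φ (partialDeriv j φ) :=
  hasWeakDeriv_of_contDiff hφ D (cart j)

theorem memLp_partialDeriv {φ : Space → ℂ} (hφ : ContDiff ℝ ∞ φ) (hc : HasCompactSupport φ)
    (D : Set Space) (j : Fin 3) : MemLp (partialDeriv j φ) 2 (volume.restrict D) :=
  memLp_restrict_of_continuous (continuous_fderiv_apply_of_contDiff hφ _)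
    (HasCompactSupport.fderiv_apply ℝ hc _) D

theorem memH1_of_contDiff {φ : Space → ℂ} (hφ : ContDiff ℝ ∞ φ) (hc : HasCompactSupport φ)
    (D : Set Space) : MemH1 D φ :=
  ⟨memLp_restrict_of_continuous hφ.continuous hc D, fun j =>
    ⟨_, hasWeakDeriv_partialDeriv hφ D j, memLp_partialDeriv hφ hc D j⟩⟩

theorem weakDeriv_smul_add (hD : IsOpen D) (c : ℂ) (hu : MemH1 D u) (hv : MemH1 D v) (j : Fin 3) :
    weakDeriv D (cart j) (c • u + v) =ᵐ[volume.restrict D]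
      c • weakDeriv D (cart j) u + weakDeriv D (cart j) v := by
  rw [memH1_iff hD] at hu hv
  exact (((hu.2 j).1.const_smul c).add (hv.2 j).1).weakDeriv_ae_eq hD

theorem weakDeriv_sub (hD : IsOpen D) (hu : MemH1 D u) (hv : MemH1 D v) (j : Fin 3) :
    weakDeriv D (cart j) (u - v) =ᵐ[volume.restrict D]
      weakDeriv D (cart j) u - weakDeriv D (cart j) v := by
  rw [memH1_iff hD] at hu hv
  exact ((hu.2 j).1.sub (hv.2 j).1).weakDeriv_ae_eq hD

theorem integral_norm_sq_congr {α : Type*} [MeasurableSpace α] {ν : Measure α} {f g : α → ℂ}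
    (h : f =ᵐ[ν] g) : ∫ x, ‖f x‖ ^ 2 ∂ν = ∫ x, ‖g x‖ ^ 2 ∂ν :=
  integral_congr_ae (h.mono fun x hx => by simp only [hx])

theorem h1SemiSq_nonneg (D : Set Space) (u : Space → ℂ) : 0 ≤ h1SemiSq D u :=
  Finset.sum_nonneg fun j _ => integral_nonneg fun p => by positivity

theorem h1NormSq_nonneg (D : Set Space) (u : Space → ℂ) : 0 ≤ h1NormSq D u :=
  add_nonneg (integral_nonneg fun p => by positivity) (h1SemiSq_nonneg D u)

theorem integral_norm_sq_const_smul {α : Type*} [MeasurableSpace α] (ν : Measure α) (c : ℂ)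
    (f : α → ℂ) : ∫ x, ‖(c • f) x‖ ^ 2 ∂ν = ‖c‖ ^ 2 * ∫ x, ‖f x‖ ^ 2 ∂ν := by
  rw [← integral_const_mul]
  congr 1; ext p
  simp [mul_pow]

theorem h1SemiSq_smul_add_le (hD : IsOpen D) (c : ℂ) (hu : MemH1 D u) (hv : MemH1 D v) :
    h1SemiSq D (c • u + v) ≤ 2 * ‖c‖ ^ 2 * h1SemiSq D u + 2 * h1SemiSq D v := by
  unfold h1SemiSq
  rw [Finset.mul_sum, Finset.mul_sum, ← Finset.sum_add_distrib]
  refine Finset.sum_le_sum fun j _ => ?_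
  rw [integral_norm_sq_congr (weakDeriv_smul_add hD c hu hv j)]
  rw [memH1_iff hD] at hu hv
  have h := integral_norm_sq_add_le ((hu.2 j).2.const_smul c) (hv.2 j).2
  rw [integral_norm_sq_const_smul] at h
  linarith

theorem h1NormSq_smul_add_le (hD : IsOpen D) (c : ℂ) (hu : MemH1 D u) (hv : MemH1 D v) :
    h1NormSq D (c • u + v) ≤ 2 * ‖c‖ ^ 2 * h1NormSq D u + 2 * h1NormSq D v := by
  have h1 := h1SemiSq_smul_add_le hD c hu hv
  rw [memH1_iff hD] at hu hv
  have h := integral_norm_sq_add_le (hu.1.const_smul c) hv.1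
  rw [integral_norm_sq_const_smul] at h
  unfold h1NormSq
  linarith

theorem h1NormSq_add_le (hD : IsOpen D) (hu : MemH1 D u) (hv : MemH1 D v) :
    h1NormSq D (u + v) ≤ 2 * h1NormSq D u + 2 * h1NormSq D v := by
  simpa using h1NormSq_smul_add_le hD 1 hu hv

theorem h1SemiSq_parallelogram (hD : IsOpen D) (hu : MemH1 D u) (hv : MemH1 D v) :
    h1SemiSq D (u + Complex.I • v) + h1SemiSq D (u - Complex.I • v)
      = 2 * (h1SemiSq D u + h1SemiSq D v) := by
  rw [memH1_iff hD] at hu hv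
  unfold h1SemiSq
  rw [← Finset.sum_add_distrib, ← Finset.sum_add_distrib, Finset.mul_sum]
  refine Finset.sum_congr rfl fun j _ => ?_
  rw [integral_norm_sq_congr
      (((hu.2 j).1.add ((hv.2 j).1.const_smul Complex.I)).weakDeriv_ae_eq hD),
    integral_norm_sq_congr
      (((hu.2 j).1.sub ((hv.2 j).1.const_smul Complex.I)).weakDeriv_ae_eq hD),
    integral_norm_sq_parallelogram (hu.2 j).2 (hv.2 j).2]

theorem tendsto_h1NormSq_iff (hD : IsOpen D) {us : ℕ → Space → ℂ} (hus : ∀ n, MemH1 D (us n)) :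
    Tendsto (fun n => h1NormSq D (us n)) atTop (𝓝 0) ↔
      Tendsto (fun n => eLpNorm (us n) 2 (volume.restrict D)) atTop (𝓝 0) ∧
      ∀ j, Tendsto (fun n => eLpNorm (weakDeriv D (cart j) (us n)) 2 (volume.restrict D))
        atTop (𝓝 0) := by
  have hm := fun n => (memH1_iff hD).1 (hus n)
  rw [tendsto_eLpNorm_iff fun n => (hm n).1]
  have e : ∀ j, Tendsto (fun n => eLpNorm (weakDeriv D (cart j) (us n)) 2 (volume.restrict D))
      atTop (𝓝 0) ↔ Tendsto (fun n => ∫ p in D, ‖weakDeriv D (cart j) (us n) p‖ ^ 2)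
      atTop (𝓝 0) := fun j => tendsto_eLpNorm_iff fun n => ((hm n).2 j).2
  simp only [e]
  have hnn : ∀ (w : Space → ℂ), 0 ≤ ∫ p in D, ‖w p‖ ^ 2 := fun w =>
    integral_nonneg fun p => by positivity
  constructor
  · intro h
    refine ⟨squeeze_zero (fun n => hnn _) (fun n => ?_) h,
      fun j => squeeze_zero (fun n => hnn _) (fun n => ?_) h⟩
    · exact le_add_of_nonneg_right (h1SemiSq_nonneg D _)
    · refine le_trans ?_ (le_add_of_nonneg_left (hnn _))
      exact Finset.single_le_sum (f := fun j => ∫ p in D, ‖weakDeriv D (cart j) (us n) p‖ ^ 2)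
        (fun j _ => hnn _) (Finset.mem_univ j)
  · rintro ⟨h1, h2⟩
    have := h1.add (tendsto_finsetSum Finset.univ fun j _ => h2 j)
    simpa [h1NormSq, h1SemiSq] using this

/-- Smooth functions with compact support in `U`. -/
structure IsTest {E : Type*} [NormedAddCommGroup E] [NormedSpace ℝ E] (U : Set E) (φ : E → ℂ) :
    Prop where
  contDiff : ContDiff ℝ ∞ φ
  hasCompactSupport : HasCompactSupport φ
  tsupport_subset : tsupport φ ⊆ U

theorem IsTest.memH1 {φ : Space → ℂ} (hφ : IsTest D φ) : MemH1 D φ :=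
  memH1_of_contDiff hφ.1 hφ.2 D

theorem IsTest.smul_add {E : Type*} [NormedAddCommGroup E] [NormedSpace ℝ E] {U : Set E}
    {φ ψ : E → ℂ} (hφ : IsTest U φ) (hψ : IsTest U ψ) (c : ℂ) : IsTest U (c • φ + ψ) :=
  ⟨(hφ.1.const_smul c).add hψ.1, (hφ.2.smul_left (f := fun _ => c)).add hψ.2,
    (tsupport_add _ _).trans (union_subset
      ((closure_mono (Function.support_const_smul_subset c φ)).trans hφ.3) hψ.3)⟩

theorem IsTest.sub {E : Type*} [NormedAddCommGroup E] [NormedSpace ℝ E] {U : Set E}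
    {φ ψ : E → ℂ} (hφ : IsTest U φ) (hψ : IsTest U ψ) : IsTest U (φ - ψ) := by
  have := hψ.smul_add hφ (-1)
  simpa [sub_eq_add_neg, add_comm] using this

theorem memH10_iff_exists_seq : MemH10 D u ↔ MemH1 D u ∧
    ∃ φ : ℕ → Space → ℂ, (∀ n, IsTest D (φ n)) ∧
      Tendsto (fun n => h1NormSq D (u - φ n)) atTop (𝓝 0) := by
  constructor
  · rintro ⟨h1, h2⟩
    refine ⟨h1, ?_⟩
    choose φ h3 h4 h5 h6 using fun n : ℕ => h2 (1 / ((n : ℝ) + 1)) (by positivity)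
    exact ⟨φ, fun n => ⟨h3 n, h4 n, h5 n⟩, squeeze_zero (fun n => h1NormSq_nonneg D _)
      (fun n => (h6 n).le) tendsto_one_div_add_atTop_nhds_zero_nat⟩
  · rintro ⟨h1, φ, h2, h3⟩
    refine ⟨h1, fun ε hε => ?_⟩
    obtain ⟨n, hn⟩ := (h3.eventually (gt_mem_nhds hε)).exists
    exact ⟨φ n, (h2 n).1, (h2 n).2, (h2 n).3, hn⟩

theorem IsTest.memH10 {φ : Space → ℂ} (hφ : IsTest D φ) (hD : IsOpen D) : MemH10 D φ := by
  refine memH10_iff_exists_seq.2 ⟨hφ.memH1, fun _ => φ, fun _ => hφ, ?_⟩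
  have h0 : MemH1 D (φ - φ) := memH1_sub hD hφ.memH1 hφ.memH1
  rw [tendsto_h1NormSq_iff hD fun _ => h0]
  refine ⟨by simp, fun j => ?_⟩
  have := weakDeriv_sub hD hφ.memH1 hφ.memH1 j
  rw [sub_self (weakDeriv D (cart j) φ)] at this
  simp only [eLpNorm_congr_ae this, eLpNorm_zero, tendsto_const_nhds]

theorem memH10_smul_add (hD : IsOpen D) (c : ℂ) (hu : MemH10 D u) (hv : MemH10 D v) :
    MemH10 D (c • u + v) := by
  rw [memH10_iff_exists_seq] at hu hv
  obtain ⟨hu1, φ, hφ, hφl⟩ := hu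
  obtain ⟨hv1, ψ, hψ, hψl⟩ := hv
  refine memH10_iff_exists_seq.2 ⟨memH1_smul_add hD c hu1 hv1, fun n => c • φ n + ψ n,
    fun n => (hφ n).smul_add (hψ n) c, ?_⟩
  have h := (hφl.const_mul (2 * ‖c‖ ^ 2)).add (hψl.const_mul 2)
  rw [mul_zero, mul_zero, add_zero] at h
  refine squeeze_zero (fun n => h1NormSq_nonneg D _) (fun n => ?_) h
  have e : c • u + v - (c • φ n + ψ n) = c • (u - φ n) + (v - ψ n) := by
    rw [smul_sub]; abel
  rw [e]
  exact h1NormSq_smul_add_le hD c (memH1_sub hD hu1 (hφ n).memH1) (memH1_sub hD hv1 (hψ n).memH1)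

theorem memH10_sub (hD : IsOpen D) (hu : MemH10 D u) (hv : MemH10 D v) : MemH10 D (u - v) := by
  have := memH10_smul_add hD (-1) hv hu
  simpa [sub_eq_add_neg, add_comm] using this

/-- `H¹₀` is closed in `H¹`. -/
theorem memH10_of_tendsto (hD : IsOpen D) {us : ℕ → Space → ℂ} (hus : ∀ n, MemH10 D (us n))
    (hu : MemH1 D u) (hl : Tendsto (fun n => h1NormSq D (u - us n)) atTop (𝓝 0)) :
    MemH10 D u := by
  refine ⟨hu, fun ε hε => ?_⟩
  obtain ⟨n, hn⟩ := (hl.eventually (gt_mem_nhds (show (0 : ℝ) < ε / 4 by positivity))).exists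
  obtain ⟨φ, h1, h2, h3, h4⟩ := (hus n).2 (ε / 4) (by positivity)
  refine ⟨φ, h1, h2, h3, ?_⟩
  have e : u - φ = (u - us n) + (us n - φ) := by abel
  rw [e]
  have := h1NormSq_add_le hD (memH1_sub hD hu (hus n).1)
    (memH1_sub hD (hus n).1 (memH1_of_contDiff h1 h2 D))
  linarith

/-! ### Fourier coefficients of functions in `H¹₀` -/

theorem IsAxisymmetricDomain.tendsto_mode (hD : IsAxisymmetricDomain D) {us : ℕ → Space → ℂ}
    (hus : ∀ n, MemLp (us n) 2 (volume.restrict D)) (hu : MemLp u 2 (volume.restrict D))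
    (hl : Tendsto (fun n => eLpNorm (us n - u) 2 (volume.restrict D)) atTop (𝓝 0)) (m : ℤ) :
    Tendsto (fun n => eLpNorm (mode m (us n) - mode m u) 2 (wt 1 (halfSection D))) atTop (𝓝 0) := by
  refine tendsto_of_tendsto_of_tendsto_of_le_of_le tendsto_const_nhds hl (fun _ => zero_le)
    fun n => ?_
  rw [← eLpNorm_congr_ae (hD.mode_sub (hus n) hu m)]
  exact hD.eLpNorm_mode_le ((hus n).sub hu) m

/-- The factor `c` may be unbounded (it will be `im/r`), so the relation is passed to the limit
pointwise, along a subsequence converging almost everywhere. -/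
theorem ae_eq_of_tendsto_eLpNorm {α : Type*} [MeasurableSpace α] {ν : Measure α}
    {fs gs : ℕ → α → ℂ} {f g : α → ℂ} {c : α → ℂ} (hfs : ∀ n, AEStronglyMeasurable (fs n) ν)
    (hgs : ∀ n, AEStronglyMeasurable (gs n) ν) (hf : AEStronglyMeasurable f ν)
    (hg : AEStronglyMeasurable g ν) (hfl : Tendsto (fun n => eLpNorm (fs n - f) 2 ν) atTop (𝓝 0))
    (hgl : Tendsto (fun n => eLpNorm (gs n - g) 2 ν) atTop (𝓝 0))
    (h : ∀ n, gs n =ᵐ[ν] fun x => c x * fs n x) : g =ᵐ[ν] fun x => c x * f x := by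
  have t1 := tendstoInMeasure_of_tendsto_eLpNorm (by norm_num) hfs hf hfl
  have t2 := tendstoInMeasure_of_tendsto_eLpNorm (by norm_num) hgs hg hgl
  obtain ⟨ns, hns, h1⟩ := t1.exists_seq_tendsto_ae
  -- A subsequence for `gs` is extracted from the one found for `fs`, so that both converge.
  have t3 : TendstoInMeasure ν (fun n => gs (ns n)) atTop g := fun ε hε =>
    (t2 ε hε).comp hns.tendsto_atTop
  obtain ⟨ms, hms, h2⟩ := t3.exists_seq_tendsto_ae
  filter_upwards [h1, h2, ae_all_iff.2 h] with x h3 h4 h5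
  have h6 := (h3.comp hms.tendsto_atTop).const_mul (c x)
  refine tendsto_nhds_unique h4 (h6.congr fun n => ?_)
  simp only [Function.comp_apply]
  rw [h5]

section H10

theorem IsAxisymmetricDomain.exists_seq_test (hD : IsAxisymmetricDomain D) (hu : MemH10 D u) :
    ∃ φ : ℕ → Space → ℂ, (∀ n, IsTest D (φ n)) ∧
      Tendsto (fun n => eLpNorm (φ n - u) 2 (volume.restrict D)) atTop (𝓝 0) ∧
      ∀ j, Tendsto (fun n => eLpNorm (partialDeriv j (φ n) - weakDeriv D (cart j) u) 2
        (volume.restrict D)) atTop (𝓝 0) := by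
  obtain ⟨h1, φ, h2, h3⟩ := memH10_iff_exists_seq.1 hu
  obtain ⟨h4, h5⟩ := (tendsto_h1NormSq_iff hD.isOpen fun n =>
    memH1_sub hD.isOpen h1 (h2 n).memH1).1 h3
  refine ⟨φ, h2, ?_, fun j => ?_⟩
  · simpa only [eLpNorm_sub_comm] using h4
  · refine (h5 j).congr fun n => ?_
    rw [eLpNorm_sub_comm]
    refine eLpNorm_congr_ae ?_
    have := ((((memH1_iff hD.isOpen).1 h1).2 j).1.sub
      (hasWeakDeriv_partialDeriv (h2 n).1 D j)).weakDeriv_ae_eq hD.isOpen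
    exact this

theorem IsTest.hasWeakDeriv_mode_dr {φ : Space → ℂ} (hφ : IsTest D φ)
    (hD : IsAxisymmetricDomain D) (m : ℤ) :
    HasWeakDeriv (halfSection D) (1, 0) (mode m φ)
      (mode m (radial (partialDeriv 0 φ) (partialDeriv 1 φ))) := by
  refine (hasWeakDeriv_of_contDiff (contDiff_mode hφ.1 m) _ (1, 0)).congr (ae_eq_refl _) ?_
  filter_upwards [hD.isHalfPlaneOpen.ae_restrict_pos] with q hq using (mode_radial hφ.1 m hq).symm

theorem IsTest.hasWeakDeriv_mode_dz {φ : Space → ℂ} (hφ : IsTest D φ) (m : ℤ) :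
    HasWeakDeriv (halfSection D) (0, 1) (mode m φ) (mode m (partialDeriv 2 φ)) := by
  refine (hasWeakDeriv_of_contDiff (contDiff_mode hφ.1 m) _ (0, 1)).congr (ae_eq_refl _) ?_
  exact Eventually.of_forall fun q => (mode_axial hφ.1 m q).symm

/-- The identity holds classically for approximating test functions, modes and radial parts depend
continuously on their data in `L²`, and weak derivatives are closed under such limits. -/
theorem IsAxisymmetricDomain.hasWeakDeriv_mode_dr (hD : IsAxisymmetricDomain D)
    (hu : MemH10 D u) (m : ℤ) :
    HasWeakDeriv (halfSection D) (1, 0) (mode m u)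
      (mode m (radial (weakDeriv D (cart 0) u) (weakDeriv D (cart 1) u))) := by
  have h := (memH1_iff hD.isOpen).1 hu.1
  obtain ⟨φ, hφ, l0, l1⟩ := hD.exists_seq_test hu
  have hΩ := hD.isHalfPlaneOpen
  have hφp := fun n j => memLp_partialDeriv (hφ n).1 (hφ n).2 D j
  have hφ0 := fun n => memLp_restrict_of_continuous (hφ n).1.continuous (hφ n).2 D
  refine (hΩ.dominatesVolumeOn_wt 1).hasWeakDeriv_of_tendsto hΩ.isOpen
    (fun n => hD.memLp_mode (hφ0 n) m)
    (fun n => hD.memLp_mode (memLp_radial (hφp n 0) (hφp n 1)) m)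
    (fun n => (hφ n).hasWeakDeriv_mode_dr hD m) (hD.memLp_mode h.1 m)
    (hD.memLp_mode (memLp_radial (h.2 0).2 (h.2 1).2) m)
    (hD.tendsto_mode hφ0 h.1 l0 m)
    (hD.tendsto_mode (fun n => memLp_radial (hφp n 0) (hφp n 1))
      (memLp_radial (h.2 0).2 (h.2 1).2) ?_ m)
  simp only [radial_sub]
  exact tendsto_radial (fun n => (hφp n 0).sub (h.2 0).2) (fun n => (hφp n 1).sub (h.2 1).2)
    (l1 0) (l1 1)

theorem IsAxisymmetricDomain.hasWeakDeriv_mode_dz (hD : IsAxisymmetricDomain D)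
    (hu : MemH10 D u) (m : ℤ) :
    HasWeakDeriv (halfSection D) (0, 1) (mode m u) (mode m (weakDeriv D (cart 2) u)) := by
  have h := (memH1_iff hD.isOpen).1 hu.1
  obtain ⟨φ, hφ, l0, l1⟩ := hD.exists_seq_test hu
  have hΩ := hD.isHalfPlaneOpen
  have hφp := fun n j => memLp_partialDeriv (hφ n).1 (hφ n).2 D j
  have hφ0 := fun n => memLp_restrict_of_continuous (hφ n).1.continuous (hφ n).2 D
  exact (hΩ.dominatesVolumeOn_wt 1).hasWeakDeriv_of_tendsto hΩ.isOpen
    (fun n => hD.memLp_mode (hφ0 n) m) (fun n => hD.memLp_mode (hφp n 2) m)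
    (fun n => (hφ n).hasWeakDeriv_mode_dz m) (hD.memLp_mode h.1 m) (hD.memLp_mode (h.2 2).2 m)
    (hD.tendsto_mode hφ0 h.1 l0 m) (hD.tendsto_mode (fun n => hφp n 2) (h.2 2).2 (l1 2) m)

theorem IsAxisymmetricDomain.mode_angular_ae (hD : IsAxisymmetricDomain D)
    (hu : MemH10 D u) (m : ℤ) :
    mode m (angular (weakDeriv D (cart 0) u) (weakDeriv D (cart 1) u))
      =ᵐ[wt 1 (halfSection D)] fun q => Complex.I * m / q.1 * mode m u q := by
  have h := (memH1_iff hD.isOpen).1 hu.1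
  obtain ⟨φ, hφ, l0, l1⟩ := hD.exists_seq_test hu
  have hΩ := hD.isHalfPlaneOpen
  have hφp := fun n j => memLp_partialDeriv (hφ n).1 (hφ n).2 D j
  have hφ0 := fun n => memLp_restrict_of_continuous (hφ n).1.continuous (hφ n).2 D
  refine ae_eq_of_tendsto_eLpNorm (fun n => (hD.memLp_mode (hφ0 n) m).aestronglyMeasurable)
    (fun n => (hD.memLp_mode (memLp_angular (hφp n 0) (hφp n 1)) m).aestronglyMeasurable)
    (hD.memLp_mode h.1 m).aestronglyMeasurable
    (hD.memLp_mode (memLp_angular (h.2 0).2 (h.2 1).2) m).aestronglyMeasurable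
    (hD.tendsto_mode hφ0 h.1 l0 m)
    (hD.tendsto_mode (fun n => memLp_angular (hφp n 0) (hφp n 1))
      (memLp_angular (h.2 0).2 (h.2 1).2) ?_ m) fun n => ?_
  · simp only [angular_sub]
    exact tendsto_angular (fun n => (hφp n 0).sub (h.2 0).2) (fun n => (hφp n 1).sub (h.2 1).2)
      (l1 0) (l1 1)
  · refine hΩ.ae_wt_iff.2 ?_
    filter_upwards [hΩ.ae_restrict_pos] with q hq using mode_angular (hφ n).1 m hq

theorem IsAxisymmetricDomain.memH11_mode (hD : IsAxisymmetricDomain D) (hu : MemH10 D u)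
    (m : ℤ) : MemH11 (halfSection D) (mode m u) := by
  have h := (memH1_iff hD.isOpen).1 hu.1
  exact hD.isHalfPlaneOpen.memH11_of_hasWeakDeriv (hD.memLp_mode h.1 m)
    (hD.hasWeakDeriv_mode_dr hu m) (hD.memLp_mode (memLp_radial (h.2 0).2 (h.2 1).2) m)
    (hD.hasWeakDeriv_mode_dz hu m) (hD.memLp_mode (h.2 2).2 m)

theorem IsAxisymmetricDomain.h11SemiSq_mode (hD : IsAxisymmetricDomain D) (hu : MemH10 D u)
    (m : ℤ) : h11SemiSq (halfSection D) (mode m u) =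
      (∫ q, ‖mode m (radial (weakDeriv D (cart 0) u) (weakDeriv D (cart 1) u)) q‖ ^ 2
        ∂(wt 1 (halfSection D)))
      + ∫ q, ‖mode m (weakDeriv D (cart 2) u) q‖ ^ 2 ∂(wt 1 (halfSection D)) := by
  have hΩ := hD.isHalfPlaneOpen
  rw [h11SemiSq, hΩ.l2wNormSq_congr 1 (hΩ.dr_ae_eq (hD.hasWeakDeriv_mode_dr hu m)),
    hΩ.l2wNormSq_congr 1 (hΩ.dz_ae_eq (hD.hasWeakDeriv_mode_dz hu m)), hΩ.l2wNormSq_eq,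
    hΩ.l2wNormSq_eq]

/-- `|im/r|² r = m² r⁻¹`: the origin of the weight `r⁻¹` in the norms of the modes. -/
theorem IsAxisymmetricDomain.angular_weight (hD : IsAxisymmetricDomain D) (hu : MemH10 D u)
    (m : ℤ) : ∀ᵐ q ∂(volume.restrict (halfSection D)),
      ‖mode m (angular (weakDeriv D (cart 0) u) (weakDeriv D (cart 1) u)) q‖ ^ 2 * q.1 ^ (1 : ℤ)
        = (m : ℝ) ^ 2 * (‖mode m u q‖ ^ 2 * q.1 ^ (-1 : ℤ)) := by
  have hΩ := hD.isHalfPlaneOpen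
  filter_upwards [hΩ.ae_restrict_pos, hΩ.ae_wt_iff.1 (hD.mode_angular_ae hu m)] with q hq h
  rw [h, norm_mul, norm_div, norm_mul, Complex.norm_I, Complex.norm_intCast, Complex.norm_real,
    Real.norm_of_nonneg hq.le, mul_pow, div_pow, one_mul, sq_abs, zpow_one, zpow_neg_one]
  field_simp

theorem IsAxisymmetricDomain.l2wNormSq_mode (hD : IsAxisymmetricDomain D) (hu : MemH10 D u)
    (m : ℤ) : (m : ℝ) ^ 2 * l2wNormSq (-1) (halfSection D) (mode m u) =
      ∫ q, ‖mode m (angular (weakDeriv D (cart 0) u) (weakDeriv D (cart 1) u)) q‖ ^ 2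
        ∂(wt 1 (halfSection D)) := by
  rw [hD.isHalfPlaneOpen.integral_wt, integral_congr_ae (hD.angular_weight hu m),
    integral_const_mul]
  rfl

theorem IsAxisymmetricDomain.memL2w_mode (hD : IsAxisymmetricDomain D) (hu : MemH10 D u)
    (hm : m ≠ 0) : MemL2w (-1) (halfSection D) (mode m u) := by
  have hΩ := hD.isHalfPlaneOpen
  have h := (memH1_iff hD.isOpen).1 hu.1
  have h1 := (hΩ.memL2w_iff.2 (hD.memLp_mode (memLp_angular (h.2 0).2 (h.2 1).2) m)).2
  have h2 : IntegrableOn (fun q => (m : ℝ) ^ 2 * (‖mode m u q‖ ^ 2 * q.1 ^ (-1 : ℤ)))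
      (halfSection D) := (integrable_congr (hD.angular_weight hu m)).1 h1
  exact (integrableOn_const_mul_weighted_iff (hD.memH11_mode hu m).1.1).1 h2 (by simpa using hm)

/-- The modes of test functions approximating `u` serve as approximants. The planar norm of the mode
of the error involves only its value and its radial and axial derivatives, each contracted by `mode
m`, so the full norm in `D` bounds it. -/
theorem IsAxisymmetricDomain.vanishesOnOuter_mode (hD : IsAxisymmetricDomain D)
    (hu : MemH10 D u) (m : ℤ) : VanishesOnOuter (halfSection D) (mode m u) := by
  have hΩ := hD.isHalfPlaneOpen
  intro ε hε
  obtain ⟨φ, h1, h2, h3, h4⟩ := hu.2 ε hε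
  have hφ : IsTest D φ := ⟨h1, h2, h3⟩
  have hd : MemH10 D (u - φ) := memH10_sub hD.isOpen hu (hφ.memH10 hD.isOpen)
  have h := (memH1_iff hD.isOpen).1 hd.1
  refine ⟨mode m φ, contDiff_mode h1 m, hasCompactSupport_mode h2 m,
    disjoint_tsupport_mode hD h2 h3 m, lt_of_le_of_lt ?_ h4⟩
  have hu1 := ((memH1_iff hD.isOpen).1 hu.1).1
  have hle : ∀ {w : Space → ℂ}, MemLp w 2 (volume.restrict D) →
      ∫ q, ‖mode m w q‖ ^ 2 ∂(wt 1 (halfSection D)) ≤ ∫ p in D, ‖w p‖ ^ 2 := fun hw => by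
    rw [integral_norm_sq_eq_toReal (hD.memLp_mode hw m), integral_norm_sq_eq_toReal hw]
    refine ENNReal.toReal_mono (ENNReal.pow_ne_top hw.eLpNorm_ne_top) ?_
    gcongr
    exact hD.eLpNorm_mode_le hw m
  rw [← hΩ.h11NormSq_congr (hΩ.ae_wt_iff.1 (hD.mode_sub hu1
    (memLp_restrict_of_continuous h1.continuous h2 D) m)), h11NormSq, h1NormSq,
    hD.h11SemiSq_mode hd, hΩ.l2wNormSq_eq, h1SemiSq, Fin.sum_univ_three]
  have k1 := hle h.1
  have k2 := hle (memLp_radial (h.2 0).2 (h.2 1).2)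
  have k3 := hle (h.2 2).2
  have k4 := integral_radial_le (h.2 0).2 (h.2 1).2
  linarith

theorem IsAxisymmetricDomain.memMode_mode (hD : IsAxisymmetricDomain D) (hu : MemH10 D u)
    (m : ℤ) : MemMode (halfSection D) m (mode m u) :=
  ⟨⟨hD.memH11_mode hu m, hD.vanishesOnOuter_mode hu m⟩, fun hm => hD.memL2w_mode hu hm⟩

theorem IsAxisymmetricDomain.hasSum_mode (hD : IsAxisymmetricDomain D)
    (hu : MemLp u 2 (volume.restrict D)) :
    HasSum (fun m : ℤ => ∫ q, ‖mode m u q‖ ^ 2 ∂(wt 1 (halfSection D))) (∫ p in D, ‖u p‖ ^ 2) := by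
  have h := hD.parseval hu
  simp only [lintegral_enorm_sq_eq_eLpNorm_sq] at h
  have hfin : ∑' m : ℤ, eLpNorm (mode m u) 2 (wt 1 (halfSection D)) ^ 2 ≠ ⊤ := by
    rw [h]; exact ENNReal.pow_ne_top hu.eLpNorm_ne_top
  have h2 := ENNReal.hasSum_toReal hfin
  rw [← ENNReal.tsum_toReal_eq fun m => ENNReal.pow_ne_top
    (hD.memLp_mode hu m).eLpNorm_ne_top, h] at h2
  rw [integral_norm_sq_eq_toReal hu]
  refine h2.congr_fun ?_
  intro m
  exact integral_norm_sq_eq_toReal (hD.memLp_mode hu m)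

/-- The scalar isometry. -/
theorem IsAxisymmetricDomain.hasSum_modeSq (hD : IsAxisymmetricDomain D) (hu : MemH10 D u) :
    HasSum (fun m : ℤ => modeSq (halfSection D) m (mode m u)) (h1SemiSq D u) := by
  have h := (memH1_iff hD.isOpen).1 hu.1
  have h1 := hD.hasSum_mode (memLp_radial (h.2 0).2 (h.2 1).2)
  have h2 := hD.hasSum_mode (memLp_angular (h.2 0).2 (h.2 1).2)
  have h3 := hD.hasSum_mode (h.2 2).2
  have h4 := (h1.add h3).add h2
  -- Pointwise rotation of the horizontal gradient preserves its length, so the three Parseval sums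
  -- add up to the semi-norm.
  have e : h1SemiSq D u = (∫ p in D, ‖radial (weakDeriv D (cart 0) u) (weakDeriv D (cart 1) u) p‖ ^ 2)
      + (∫ p in D, ‖weakDeriv D (cart 2) u p‖ ^ 2)
      + ∫ p in D, ‖angular (weakDeriv D (cart 0) u) (weakDeriv D (cart 1) u) p‖ ^ 2 := by
    have := integral_radial_add_angular (h.2 0).2 (h.2 1).2
    rw [h1SemiSq, Fin.sum_univ_three]
    linarith
  rw [e]
  convert h4 using 2 with m
  rw [modeSq, hD.h11SemiSq_mode hu, hD.l2wNormSq_mode hu]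

end H10

end Axisym

end

noncomputable section

namespace Axisym

open Filter Topology
open scoped ENNReal NNReal Real

/-! ### Logarithmic cutoff functions -/

theorem exists_bound_deriv_smoothTransition :
    ∃ C : ℝ, 0 < C ∧ ∀ x, |deriv Real.smoothTransition x| ≤ C := by
  have hs : ContDiff ℝ 1 Real.smoothTransition := Real.smoothTransition.contDiff
  have hc : Continuous (deriv Real.smoothTransition) := hs.continuous_deriv le_rfl
  obtain ⟨C, hC⟩ := (isCompact_Icc (a := (0 : ℝ)) (b := 1)).exists_bound_of_continuousOn
    hc.continuousOn
  refine ⟨max C 1, by positivity, fun x => ?_⟩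
  by_cases hx : x ∈ Icc (0 : ℝ) 1
  · exact (hC x hx).trans (le_max_left _ _)
  · have h0 : deriv Real.smoothTransition x = 0 := by
      rw [mem_Icc, not_and_or, not_le, not_le] at hx
      rcases hx with hx | hx
      · have : Real.smoothTransition =ᶠ[𝓝 x] fun _ => 0 := by
          filter_upwards [gt_mem_nhds hx] with y hy
          exact Real.smoothTransition.zero_of_nonpos hy.le
        rw [this.deriv_eq, deriv_const]
      · have : Real.smoothTransition =ᶠ[𝓝 x] fun _ => 1 := by
          filter_upwards [lt_mem_nhds hx] with y hy
          exact Real.smoothTransition.one_of_one_le hy.le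
        rw [this.deriv_eq, deriv_const]
    rw [h0, abs_zero]
    positivity

/-- A smooth function on the line that vanishes for `r ≤ δ`, is `1` for `r ≥ ε`, and has small
energy with respect to the weight `r`. -/
structure IsCutoff (ε δ : ℝ) (χ : ℝ → ℝ) : Prop where
  contDiff : ContDiff ℝ ∞ χ
  nonneg : ∀ r, 0 ≤ χ r
  le_one : ∀ r, χ r ≤ 1
  pos : 0 < δ
  eq_zero : ∀ r ≤ δ, χ r = 0
  eq_one : ∀ r ≥ ε, χ r = 1
  deriv_le : ∀ r > 0, |deriv χ r| * r ≤ ε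
  deriv_bound : ∀ r, |deriv χ r| ≤ ε / δ
  energy : ∫⁻ r in Ioi 0, ENNReal.ofReal (deriv χ r ^ 2 * r) ≤ ENNReal.ofReal ε

/-- Logarithmic cutoff: `χ` is a smooth step in the variable `1 + log(r/ε)/L`, so `|χ'| ≤ C/(L r)`
and `∫ χ'² r dr ≤ (C/L)² log(ε/δ) = C²/L`. This expresses that the axis has zero capacity for the
weight `r`. -/
theorem exists_isCutoff {ε : ℝ} (hε : 0 < ε) : ∃ δ χ, IsCutoff ε δ χ := by
  obtain ⟨C, hC0, hC⟩ := exists_bound_deriv_smoothTransition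
  -- Large enough for `C/L ≤ ε`, which bounds `|χ'| r`, and for `C²/L ≤ ε`, which bounds the energy.
  set L : ℝ := max (C / ε) (C ^ 2 / ε) with hL
  have hL0 : 0 < L := lt_max_of_lt_left (by positivity)
  have hL1 : C / L ≤ ε := by
    rw [div_le_iff₀ hL0, mul_comm, ← div_le_iff₀ hε]; exact le_max_left _ _
  have hL2 : C ^ 2 / L ≤ ε := by
    rw [div_le_iff₀ hL0, mul_comm, ← div_le_iff₀ hε]; exact le_max_right _ _
  -- The radius at which the argument of the step reaches `0`, that is, `log(ε/δ) = L`.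
  set δ : ℝ := ε * Real.exp (-L) with hδ
  have hδ0 : 0 < δ := by positivity
  have hδε : δ ≤ ε := by
    have : Real.exp (-L) ≤ 1 := Real.exp_le_one_iff.2 (by linarith)
    nlinarith
  have hlogδ : Real.log δ = Real.log ε - L := by
    rw [hδ, Real.log_mul hε.ne' (Real.exp_pos _).ne', Real.log_exp]; ring
  set g : ℝ → ℝ := fun r => 1 + (Real.log r - Real.log ε) / L with hg
  set χ : ℝ → ℝ := fun r => if r ≤ 0 then 0 else Real.smoothTransition (g r) with hχ
  have hχpos : ∀ r > 0, χ r = Real.smoothTransition (g r) := fun r hr => if_neg (not_le.2 hr)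
  have h0 : ∀ r ≤ δ, χ r = 0 := fun r hr => by
    by_cases h : r ≤ 0
    · exact if_pos h
    · rw [hχpos r (not_le.1 h)]
      apply Real.smoothTransition.zero_of_nonpos
      have : Real.log r ≤ Real.log δ := Real.log_le_log (not_le.1 h) hr
      have h2 : (Real.log r - Real.log ε) / L ≤ -1 := by
        rw [div_le_iff₀ hL0]; linarith
      simp only [hg]; linarith
  have h1 : ∀ r ≥ ε, χ r = 1 := fun r hr => by
    rw [hχpos r (hε.trans_le hr)]
    apply Real.smoothTransition.one_of_one_le
    have : Real.log ε ≤ Real.log r := Real.log_le_log hε hr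
    have h2 : 0 ≤ (Real.log r - Real.log ε) / L := div_nonneg (by linarith) hL0.le
    simp only [hg]; linarith
  have hev : ∀ r > 0, χ =ᶠ[𝓝 r] fun r => Real.smoothTransition (g r) := fun r hr => by
    filter_upwards [lt_mem_nhds hr] with s hs using hχpos s hs
  have hev0 : ∀ r < δ, χ =ᶠ[𝓝 r] fun _ => 0 := fun r hr => by
    filter_upwards [gt_mem_nhds hr] with s hs using h0 s hs.le
  have hev1 : ∀ r > ε, χ =ᶠ[𝓝 r] fun _ => 1 := fun r hr => by
    filter_upwards [lt_mem_nhds hr] with s hs using h1 s hs.le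
  have hder : ∀ r > 0, |deriv χ r| ≤ C / L / r := fun r hr => by
    have hgd : HasDerivAt g (r⁻¹ / L) r := by
      have := (((Real.hasDerivAt_log hr.ne').sub_const (Real.log ε)).div_const L).const_add 1
      exact this
    have hsd : HasDerivAt Real.smoothTransition (deriv Real.smoothTransition (g r)) (g r) :=
      ((Real.smoothTransition.contDiff (n := 1)).differentiable (by simp)).differentiableAt.hasDerivAt
    have hcd := (hsd.comp r hgd).deriv
    rw [(hev r hr).deriv_eq]
    change |deriv (Real.smoothTransition ∘ g) r| ≤ _
    rw [hcd, abs_mul, abs_of_nonneg (show 0 ≤ r⁻¹ / L by positivity)]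
    calc |deriv Real.smoothTransition (g r)| * (r⁻¹ / L) ≤ C * (r⁻¹ / L) := by
          gcongr; exact hC _
      _ = C / L / r := by field_simp
  have hz0 : ∀ r < δ, deriv χ r = 0 := fun r hr => by rw [(hev0 r hr).deriv_eq, deriv_const]
  have hz1 : ∀ r > ε, deriv χ r = 0 := fun r hr => by rw [(hev1 r hr).deriv_eq, deriv_const]
  refine ⟨δ, χ, ?_, ?_, ?_, hδ0, h0, h1, ?_, ?_, ?_⟩
  · rw [contDiff_iff_contDiffAt]
    intro r
    by_cases hr : 0 < r
    · have hgc : ContDiffAt ℝ ∞ g r :=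
        contDiffAt_const.add (((Real.contDiffAt_log.2 hr.ne').sub contDiffAt_const).div_const L)
      exact (Real.smoothTransition.contDiff.contDiffAt.comp r hgc).congr_of_eventuallyEq (hev r hr)
    · exact contDiffAt_const.congr_of_eventuallyEq (hev0 r ((not_lt.1 hr).trans_lt hδ0))
  · intro r
    by_cases h : r ≤ 0
    · simp [hχ, h]
    · rw [hχpos r (not_le.1 h)]; exact Real.smoothTransition.nonneg _
  · intro r
    by_cases h : r ≤ 0
    · simp [hχ, h]
    · rw [hχpos r (not_le.1 h)]; exact Real.smoothTransition.le_one _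
  · intro r hr
    calc |deriv χ r| * r ≤ C / L / r * r := by gcongr; exact hder r hr
      _ = C / L := by field_simp
      _ ≤ ε := hL1
  · intro r
    by_cases hr : r < δ
    · rw [hz0 r hr, abs_zero]; positivity
    · have hr' := hδ0.trans_le (not_lt.1 hr)
      refine (hder r hr').trans ?_
      have := not_lt.1 hr
      gcongr
  · have hb : ∀ r ∈ Ioi (0 : ℝ), ENNReal.ofReal (deriv χ r ^ 2 * r)
        ≤ (Icc δ ε).indicator (fun r => ENNReal.ofReal ((C / L) ^ 2 * r⁻¹)) r := by
      intro r hr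
      by_cases hmem : r ∈ Icc δ ε
      · rw [indicator_of_mem hmem]
        refine ENNReal.ofReal_le_ofReal ?_
        have hr0 : 0 < r := hr
        calc deriv χ r ^ 2 * r = |deriv χ r| ^ 2 * r := by rw [sq_abs]
          _ ≤ (C / L / r) ^ 2 * r := by gcongr; exact hder r hr
          _ = (C / L) ^ 2 * r⁻¹ := by field_simp
      · rw [indicator_of_notMem hmem]
        have : deriv χ r = 0 := by
          rw [mem_Icc, not_and_or, not_le, not_le] at hmem
          rcases hmem with h | h
          exacts [hz0 r h, hz1 r h]
        simp [this]
    have hint : IntervalIntegrable (fun r : ℝ => (C / L) ^ 2 * r⁻¹) volume δ ε := by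
      refine (intervalIntegral.intervalIntegrable_inv (fun x hx => ?_) continuousOn_id).const_mul _
      rw [uIcc_of_le hδε] at hx
      exact (hδ0.trans_le hx.1).ne'
    have hcomp : ∫ r in Icc δ ε, (C / L) ^ 2 * r⁻¹ = C ^ 2 / L := by
      rw [integral_Icc_eq_integral_Ioc, ← intervalIntegral.integral_of_le hδε,
        intervalIntegral.integral_const_mul, integral_inv_of_pos hδ0 hε,
        Real.log_div hε.ne' hδ0.ne', hlogδ]
      field_simp
      ring
    calc ∫⁻ r in Ioi 0, ENNReal.ofReal (deriv χ r ^ 2 * r)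
        ≤ ∫⁻ r in Ioi 0, (Icc δ ε).indicator (fun r => ENNReal.ofReal ((C / L) ^ 2 * r⁻¹)) r :=
          setLIntegral_mono' measurableSet_Ioi hb
      _ ≤ ∫⁻ r, (Icc δ ε).indicator (fun r => ENNReal.ofReal ((C / L) ^ 2 * r⁻¹)) r :=
          setLIntegral_le_lintegral _ _
      _ = ∫⁻ r in Icc δ ε, ENNReal.ofReal ((C / L) ^ 2 * r⁻¹) :=
          lintegral_indicator measurableSet_Icc _
      _ = ENNReal.ofReal (∫ r in Icc δ ε, (C / L) ^ 2 * r⁻¹) := by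
          rw [ofReal_integral_eq_lintegral_ofReal]
          · rw [intervalIntegrable_iff_integrableOn_Icc_of_le hδε] at hint
            exact hint
          · filter_upwards [ae_restrict_mem measurableSet_Icc] with r hr
            have := hδ0.trans_le hr.1
            simp only [Pi.zero_apply]
            positivity
      _ ≤ ENNReal.ofReal ε := by
          rw [hcomp]; exact ENNReal.ofReal_le_ofReal hL2

end Axisym

end

noncomputable section

namespace Axisym

open Filter Topology
open scoped ENNReal NNReal Real

/-! ### Density of test functions in the spaces of scalar modes -/

variable {Ω : Set Plane} {m : ℤ} {w φ : Plane → ℂ}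

/-- Multiplication by a function of `r`. -/
def cut (κ : ℝ → ℝ) (w : Plane → ℂ) (p : Plane) : ℂ := κ p.1 • w p

theorem norm_cut (κ : ℝ → ℝ) (w : Plane → ℂ) (p : Plane) : ‖cut κ w p‖ = |κ p.1| * ‖w p‖ := by
  rw [cut, norm_smul, Real.norm_eq_abs]

theorem norm_cut_sq (κ : ℝ → ℝ) (w : Plane → ℂ) (p : Plane) :
    ‖cut κ w p‖ ^ 2 = κ p.1 ^ 2 * ‖w p‖ ^ 2 := by
  rw [norm_cut, mul_pow, sq_abs]

theorem memLp_cut {ν : Measure Plane} {κ : ℝ → ℝ} {B : ℝ} (hκ : Continuous κ)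
    (hB : ∀ r, |κ r| ≤ B) (hw : MemLp w 2 ν) : MemLp (cut κ w) 2 ν := by
  have hc : Continuous fun p : Plane => κ p.1 := hκ.comp continuous_fst
  refine hw.of_le_mul (c := B) (hc.aestronglyMeasurable.smul hw.aestronglyMeasurable)
    (Eventually.of_forall fun p => ?_)
  rw [norm_cut]
  exact mul_le_mul_of_nonneg_right (hB _) (norm_nonneg _)

theorem integral_cut_le {ν : Measure Plane} {κ : ℝ → ℝ} {B : ℝ} (hκ : Continuous κ)
    (hB : ∀ r, |κ r| ≤ B) (hw : MemLp w 2 ν) :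
    ∫ p, ‖cut κ w p‖ ^ 2 ∂ν ≤ B ^ 2 * ∫ p, ‖w p‖ ^ 2 ∂ν := by
  rw [← integral_const_mul]
  refine integral_mono (integrable_norm_sq (memLp_cut hκ hB hw))
    ((integrable_norm_sq hw).const_mul _) fun p => ?_
  simp only [norm_cut, mul_pow]
  have := hB p.1
  gcongr

theorem hasWeakDeriv_cut_r (hΩ : IsHalfPlaneOpen Ω) {κ : ℝ → ℝ} (hκ : ContDiff ℝ ∞ κ)
    (hw : MemH11 Ω w) :
    HasWeakDeriv Ω (1, 0) (cut κ w) (cut κ (dr Ω w) + cut (deriv κ) w) := by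
  have hχ : ContDiff ℝ ∞ fun p : Plane => κ p.1 := hκ.comp contDiff_fst
  refine ((hΩ.memH11_iff.1 hw).2.1.1.smooth_smul hΩ.isOpen hχ).congr (ae_eq_refl _)
    (Eventually.of_forall fun p => ?_)
  have h1 : HasFDerivAt (fun p : Plane => κ p.1)
      ((fderiv ℝ κ p.1).comp (ContinuousLinearMap.fst ℝ ℝ ℝ)) p :=
    ((hκ.differentiable (by simp)).differentiableAt.hasFDerivAt).comp p hasFDerivAt_fst
  beta_reduce
  rw [h1.fderiv]
  simp [cut]

theorem hasWeakDeriv_cut_z (hΩ : IsHalfPlaneOpen Ω) {κ : ℝ → ℝ} (hκ : ContDiff ℝ ∞ κ)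
    (hw : MemH11 Ω w) : HasWeakDeriv Ω (0, 1) (cut κ w) (cut κ (dz Ω w)) := by
  have hχ : ContDiff ℝ ∞ fun p : Plane => κ p.1 := hκ.comp contDiff_fst
  refine ((hΩ.memH11_iff.1 hw).2.2.1.smooth_smul hΩ.isOpen hχ).congr (ae_eq_refl _)
    (Eventually.of_forall fun p => ?_)
  have h1 : HasFDerivAt (fun p : Plane => κ p.1)
      ((fderiv ℝ κ p.1).comp (ContinuousLinearMap.fst ℝ ℝ ℝ)) p :=
    ((hκ.differentiable (by simp)).differentiableAt.hasFDerivAt).comp p hasFDerivAt_fst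
  beta_reduce
  rw [h1.fderiv]
  simp [cut]

theorem memH11_cut (hΩ : IsHalfPlaneOpen Ω) {κ : ℝ → ℝ} (hκ : ContDiff ℝ ∞ κ) {A B : ℝ}
    (hA : ∀ r, |κ r| ≤ A) (hB : ∀ r, |deriv κ r| ≤ B) (hw : MemH11 Ω w) :
    MemH11 Ω (cut κ w) := by
  have h := hΩ.memH11_iff.1 hw
  exact hΩ.memH11_of_hasWeakDeriv (memLp_cut hκ.continuous hA h.1) (hasWeakDeriv_cut_r hΩ hκ hw)
    ((memLp_cut hκ.continuous hA h.2.1.2).add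
      (memLp_cut (hκ.continuous_deriv (by simp)) hB h.1))
    (hasWeakDeriv_cut_z hΩ hκ hw) (memLp_cut hκ.continuous hA h.2.2.2)

theorem h11NormSq_cut_le (hΩ : IsHalfPlaneOpen Ω) {κ : ℝ → ℝ} (hκ : ContDiff ℝ ∞ κ) {A B : ℝ}
    (hA : ∀ r, |κ r| ≤ A) (hB : ∀ r, |deriv κ r| ≤ B) (hw : MemH11 Ω w) :
    h11NormSq Ω (cut κ w) ≤ l2wNormSq 1 Ω (cut κ w) + 2 * l2wNormSq 1 Ω (cut κ (dr Ω w))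
      + l2wNormSq 1 Ω (cut κ (dz Ω w)) + 2 * l2wNormSq 1 Ω (cut (deriv κ) w) := by
  have h := hΩ.memH11_iff.1 hw
  rw [h11NormSq, h11SemiSq, hΩ.l2wNormSq_congr 1 (hΩ.dr_ae_eq (hasWeakDeriv_cut_r hΩ hκ hw)),
    hΩ.l2wNormSq_congr 1 (hΩ.dz_ae_eq (hasWeakDeriv_cut_z hΩ hκ hw))]
  have := hΩ.l2wNormSq_add_le 1 (memLp_cut hκ.continuous hA h.2.1.2)
    (memLp_cut (hκ.continuous_deriv (by simp)) hB h.1)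
  linarith

/-! ### Estimates for multiplication by a cutoff near the axis -/

section Cutoff

variable {ε δ : ℝ} {χ : ℝ → ℝ}

theorem IsCutoff.abs_le (h : IsCutoff ε δ χ) (r : ℝ) : |χ r| ≤ 1 := by
  rw [abs_of_nonneg (h.nonneg r)]; exact h.le_one r

theorem IsCutoff.contDiff_compl (h : IsCutoff ε δ χ) : ContDiff ℝ ∞ fun r => 1 - χ r :=
  contDiff_const.sub h.contDiff

theorem IsCutoff.abs_compl_le (h : IsCutoff ε δ χ) (r : ℝ) : |1 - χ r| ≤ 1 := by
  rw [abs_of_nonneg (by linarith [h.le_one r])]; linarith [h.nonneg r]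

theorem deriv_one_sub (χ : ℝ → ℝ) :
    deriv (fun r => 1 - χ r) = fun r => -deriv χ r := by
  ext r
  rw [deriv_const_sub]

theorem IsCutoff.abs_deriv_compl_le (h : IsCutoff ε δ χ) (r : ℝ) :
    |deriv (fun r => 1 - χ r) r| ≤ ε / δ := by
  rw [deriv_one_sub, abs_neg]; exact h.deriv_bound r

theorem l2wNormSq_cut_neg (α : ℤ) (Ω : Set Plane) (κ : ℝ → ℝ) (w : Plane → ℂ) :
    l2wNormSq α Ω (cut (fun r => -κ r) w) = l2wNormSq α Ω (cut κ w) := by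
  simp only [l2wNormSq, norm_cut, abs_neg]

/-- Cutting off near the axis produces test functions. -/
theorem IsCutoff.isTest (h : IsCutoff ε δ χ) (hΩ : IsHalfPlaneOpen Ω) (hφ : ContDiff ℝ ∞ φ)
    (hc : HasCompactSupport φ) (hd : Disjoint (tsupport φ) (outerBoundary Ω)) :
    IsTest Ω (Ω.indicator (cut χ φ)) := by
  -- The support of `φ` avoids the outer boundary and `r ≥ δ > 0` avoids the axis, so this compact
  -- set lies in `Ω`. The indicator is needed because `φ` may be nonzero outside the closure of `Ω`.
  set K : Set Plane := tsupport φ ∩ (closure Ω ∩ {p | δ ≤ p.1}) with hK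
  have hKc : IsCompact K :=
    IsCompact.inter_right hc (isClosed_closure.inter (isClosed_le continuous_const continuous_fst))
  have hKΩ : K ⊆ Ω := by
    rintro p ⟨h1, h2, h3⟩
    by_contra hn
    refine Set.disjoint_left.1 hd h1 ⟨⟨h2, ?_⟩, fun h4 => ?_⟩
    · rwa [hΩ.isOpen.interior_eq]
    · have h5 : p.1 = 0 := h4.1
      have h6 : δ ≤ p.1 := h3
      linarith [h.pos]
  have hsupp : Function.support (Ω.indicator (cut χ φ)) ⊆ K := by
    intro p hp
    have hpΩ : p ∈ Ω := by
      by_contra hn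
      exact hp (indicator_of_notMem hn _)
    rw [Function.mem_support, indicator_of_mem hpΩ] at hp
    refine ⟨subset_tsupport _ fun h0 => hp (by simp [cut, h0]), subset_closure hpΩ, ?_⟩
    by_contra hn
    have : χ p.1 = 0 := h.eq_zero _ (le_of_lt (not_le.1 hn))
    exact hp (by simp [cut, this])
  have hts : tsupport (Ω.indicator (cut χ φ)) ⊆ K := closure_minimal hsupp hKc.isClosed
  have hcs : ContDiff ℝ ∞ (cut χ φ) := (h.contDiff.comp contDiff_fst).smul hφ
  refine ⟨?_, hKc.of_isClosed_subset (isClosed_tsupport _) hts, hts.trans hKΩ⟩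
  rw [contDiff_iff_contDiffAt]
  intro p
  by_cases hp : p ∈ Ω
  · refine hcs.contDiffAt.congr_of_eventuallyEq ?_
    filter_upwards [hΩ.isOpen.mem_nhds hp] with q hq using indicator_of_mem hq _
  · refine (contDiffAt_const (c := (0 : ℂ))).congr_of_eventuallyEq ?_
    filter_upwards [hKc.isClosed.isOpen_compl.mem_nhds fun h => hp (hKΩ h)] with q hq
    by_contra hn
    exact hq (hsupp hn)

/-- For `φ` bounded by `M` and vanishing where `|z| > R`, the integral is dominated by a product:
the energy of the cutoff in `r`, and `M²` times the length `2R` in `z`. -/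
theorem IsCutoff.integral_deriv_le (h : IsCutoff ε δ χ) (hΩ : IsHalfPlaneOpen Ω) {M R : ℝ}
    (hR0 : 0 ≤ R) (hM : ∀ p, ‖φ p‖ ≤ M) (hR : ∀ p : Plane, φ p ≠ 0 → |p.2| ≤ R)
    (hφ : MemLp φ 2 (wt 1 Ω)) (hε : 0 ≤ ε) :
    l2wNormSq 1 Ω (cut (deriv χ) φ) ≤ M ^ 2 * (2 * R) * ε := by
  have hdc : Continuous (deriv χ) := h.contDiff.continuous_deriv (by simp)
  have hm := memLp_cut hdc h.deriv_bound hφ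
  rw [hΩ.l2wNormSq_eq]
  refine (ENNReal.ofReal_le_ofReal_iff (by positivity)).1 ?_
  have hmeas : AEMeasurable (fun p => ‖cut (deriv χ) φ p‖ₑ ^ 2) (volume.restrict Ω) :=
    ((hΩ.memL2w_iff.2 hm).1.enorm.pow_const 2)
  rw [ofReal_integral_norm_sq hm, lintegral_wt _ _ hmeas]
  have hsub : Ω ⊆ Ioi (0 : ℝ) ×ˢ univ := fun p hp => ⟨hΩ.pos p hp, trivial⟩
  have hf : Measurable fun r : ℝ => ENNReal.ofReal (deriv χ r ^ 2 * r) := by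
    have : Continuous fun r : ℝ => deriv χ r ^ 2 * r := by fun_prop
    exact this.measurable.ennreal_ofReal
  have hg : Measurable ((Icc (-R) R).indicator fun _ : ℝ => ENNReal.ofReal (M ^ 2)) :=
    measurable_const.indicator measurableSet_Icc
  have hpt : ∀ p ∈ Ioi (0 : ℝ) ×ˢ (univ : Set ℝ),
      ENNReal.ofReal (p.1 ^ (1 : ℤ)) * ‖cut (deriv χ) φ p‖ₑ ^ 2 ≤
      ENNReal.ofReal (deriv χ p.1 ^ 2 * p.1) *
        (Icc (-R) R).indicator (fun _ : ℝ => ENNReal.ofReal (M ^ 2)) p.2 := by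
    rintro p ⟨hp, -⟩
    have hp0 : 0 < p.1 := hp
    by_cases h0 : φ p = 0
    · simp [cut, h0]
    · rw [indicator_of_mem (mem_Icc.2 (_root_.abs_le.1 (hR p h0))), ← ofReal_norm,
        ← ENNReal.ofReal_pow (norm_nonneg _),
        ← ENNReal.ofReal_mul (by positivity), ← ENNReal.ofReal_mul (by positivity), norm_cut_sq,
        zpow_one]
      refine ENNReal.ofReal_le_ofReal ?_
      have := hM p
      calc p.1 * (deriv χ p.1 ^ 2 * ‖φ p‖ ^ 2) ≤ p.1 * (deriv χ p.1 ^ 2 * M ^ 2) := by gcongr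
        _ = _ := by ring
  calc ∫⁻ p in Ω, ENNReal.ofReal (p.1 ^ (1 : ℤ)) * ‖cut (deriv χ) φ p‖ₑ ^ 2
      ≤ ∫⁻ p in Ioi (0 : ℝ) ×ˢ univ, ENNReal.ofReal (p.1 ^ (1 : ℤ)) * ‖cut (deriv χ) φ p‖ₑ ^ 2 :=
        lintegral_mono_set hsub
    _ ≤ ∫⁻ p in Ioi (0 : ℝ) ×ˢ univ, ENNReal.ofReal (deriv χ p.1 ^ 2 * p.1) *
        (Icc (-R) R).indicator (fun _ : ℝ => ENNReal.ofReal (M ^ 2)) p.2 :=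
        setLIntegral_mono' (measurableSet_Ioi.prod MeasurableSet.univ) hpt
    _ = (∫⁻ r in Ioi 0, ENNReal.ofReal (deriv χ r ^ 2 * r)) *
        ∫⁻ z, (Icc (-R) R).indicator (fun _ : ℝ => ENNReal.ofReal (M ^ 2)) z := by
        rw [Measure.volume_eq_prod, ← Measure.prod_restrict, Measure.restrict_univ,
          lintegral_prod_mul hf.aemeasurable hg.aemeasurable]
    _ ≤ ENNReal.ofReal ε * (ENNReal.ofReal (M ^ 2) * ENNReal.ofReal (2 * R)) := by
        gcongr
        · exact h.energy
        · rw [lintegral_indicator measurableSet_Icc, setLIntegral_const, Real.volume_Icc]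
          gcongr
          linarith
    _ = ENNReal.ofReal (M ^ 2 * (2 * R) * ε) := by
        rw [← ENNReal.ofReal_mul (by positivity), ← ENNReal.ofReal_mul hε]
        congr 1; ring

/-- The bound `|χ'| r ≤ ε` gives `χ'² r ≤ ε² r⁻¹`, so here no boundedness of `w` is needed. -/
theorem IsCutoff.integral_deriv_le_of_memL2w (h : IsCutoff ε δ χ) (hΩ : IsHalfPlaneOpen Ω)
    (hw : MemLp w 2 (wt 1 Ω)) (hw' : MemL2w (-1) Ω w) :
    l2wNormSq 1 Ω (cut (deriv χ) w) ≤ ε ^ 2 * l2wNormSq (-1) Ω w := by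
  have hdc : Continuous (deriv χ) := h.contDiff.continuous_deriv (by simp)
  have hm := hΩ.memL2w_iff.2 (memLp_cut hdc h.deriv_bound hw)
  unfold l2wNormSq
  rw [← integral_const_mul]
  refine integral_mono_ae hm.2 (hw'.2.const_mul _) ?_
  filter_upwards [hΩ.ae_restrict_pos] with p hp
  have h1 := h.deriv_le p.1 hp
  have h2 : (|deriv χ p.1| * p.1) ^ 2 ≤ ε ^ 2 := by gcongr
  simp only [norm_cut, mul_pow, zpow_one, zpow_neg_one]
  calc |deriv χ p.1| ^ 2 * ‖w p‖ ^ 2 * p.1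
      = (|deriv χ p.1| * p.1) ^ 2 * (‖w p‖ ^ 2 * p.1⁻¹) := by field_simp
    _ ≤ _ := by gcongr

/-- The cutoff vanishes for `r ≤ δ`, and `r⁻¹ ≤ δ⁻² r` beyond. The constant blows up with `δ → 0`,
which is harmless once the cutoff is fixed. -/
theorem IsCutoff.memL2w_cut (h : IsCutoff ε δ χ) (hΩ : IsHalfPlaneOpen Ω)
    (hw : MemLp w 2 (wt 1 Ω)) : MemL2w (-1) Ω (cut χ w) ∧
      l2wNormSq (-1) Ω (cut χ w) ≤ δ⁻¹ ^ 2 * l2wNormSq 1 Ω w := by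
  have hw2 := hΩ.memL2w_iff.2 hw
  have hc : Continuous fun p : Plane => χ p.1 := h.contDiff.continuous.comp continuous_fst
  have hms : AEStronglyMeasurable (cut χ w) (volume.restrict Ω) :=
    hc.aestronglyMeasurable.smul hw2.1
  have hle : ∀ᵐ p ∂(volume.restrict Ω), ‖cut χ w p‖ ^ 2 * p.1 ^ (-1 : ℤ)
      ≤ δ⁻¹ ^ 2 * (‖w p‖ ^ 2 * p.1 ^ (1 : ℤ)) := by
    filter_upwards [hΩ.ae_restrict_pos] with p hp
    rw [norm_cut_sq, zpow_one, zpow_neg_one]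
    rcases le_or_gt p.1 δ with h1 | h1
    · rw [h.eq_zero _ h1]
      have := h.pos
      simp only [ne_eq, OfNat.ofNat_ne_zero, not_false_eq_true, zero_pow, zero_mul]
      positivity
    · have hδ := h.pos
      have h2 : χ p.1 ^ 2 ≤ 1 := pow_le_one₀ (h.nonneg _) (h.le_one _)
      have h3 : p.1⁻¹ ≤ δ⁻¹ ^ 2 * p.1 := by
        rw [inv_pow, inv_mul_eq_div, le_div_iff₀ (by positivity), inv_mul_le_iff₀ hp]
        nlinarith
      calc χ p.1 ^ 2 * ‖w p‖ ^ 2 * p.1⁻¹ ≤ 1 * ‖w p‖ ^ 2 * (δ⁻¹ ^ 2 * p.1) := by gcongr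
        _ = _ := by ring
  have hnn : ∀ᵐ p ∂(volume.restrict Ω), 0 ≤ ‖cut χ w p‖ ^ 2 * p.1 ^ (-1 : ℤ) := by
    filter_upwards [hΩ.ae_restrict_pos] with p hp
    positivity
  have hmem : MemL2w (-1) Ω (cut χ w) := by
    refine ⟨hms, (hw2.2.const_mul (δ⁻¹ ^ 2)).mono' (aestronglyMeasurable_weighted_norm_sq hms) ?_⟩
    filter_upwards [hle, hnn] with p h1 h2
    rwa [Real.norm_of_nonneg h2]
  refine ⟨hmem, ?_⟩
  unfold l2wNormSq
  rw [← integral_const_mul]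
  exact integral_mono_ae hmem.2 (hw2.2.const_mul _) hle

end Cutoff

/-- Dominated convergence: at each point with `r > 0`, the factor `1 - χ n` is zero as soon as
`1/(n+1) < r`. -/
theorem tendsto_cut_compl (hΩ : IsHalfPlaneOpen Ω) {α : ℤ} {δ : ℕ → ℝ} {χ : ℕ → ℝ → ℝ}
    (h : ∀ n : ℕ, IsCutoff (1 / ((n : ℝ) + 1)) (δ n) (χ n)) (hw : MemLp w 2 (wt α Ω)) :
    Tendsto (fun n => l2wNormSq α Ω (cut (fun r => 1 - χ n r) w)) atTop (𝓝 0) := by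
  simp only [hΩ.l2wNormSq_eq]
  have hz : ∫ _ : Plane, (0 : ℝ) ∂(wt α Ω) = 0 := by simp
  rw [← hz]
  refine tendsto_integral_of_dominated_convergence (fun p => ‖w p‖ ^ 2) (fun n => ?_)
    (integrable_norm_sq hw) (fun n => Eventually.of_forall fun p => ?_) ?_
  · exact (memLp_cut (h n).contDiff_compl.continuous (h n).abs_compl_le
      hw).aestronglyMeasurable.norm.pow 2
  · rw [Real.norm_of_nonneg (by positivity), norm_cut]
    have := mul_le_mul_of_nonneg_right ((h n).abs_compl_le p.1) (norm_nonneg (w p))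
    rw [one_mul] at this
    gcongr
  · rw [hΩ.ae_wt_iff]
    filter_upwards [hΩ.ae_restrict_pos] with p hp
    refine tendsto_const_nhds.congr' ?_
    filter_upwards [tendsto_one_div_add_atTop_nhds_zero_nat.eventually (gt_mem_nhds hp)] with n hn
    rw [norm_cut, (h n).eq_one p.1 hn.le]
    simp

theorem tendsto_h11NormSq_cut_compl (hΩ : IsHalfPlaneOpen Ω) {δ : ℕ → ℝ} {χ : ℕ → ℝ → ℝ}
    (h : ∀ n : ℕ, IsCutoff (1 / ((n : ℝ) + 1)) (δ n) (χ n)) (hw : MemH11 Ω w)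
    (hl : Tendsto (fun n => l2wNormSq 1 Ω (cut (deriv (χ n)) w)) atTop (𝓝 0)) :
    Tendsto (fun n => h11NormSq Ω (cut (fun r => 1 - χ n r) w)) atTop (𝓝 0) := by
  have hm := hΩ.memH11_iff.1 hw
  have t := (((tendsto_cut_compl hΩ h hm.1).add ((tendsto_cut_compl hΩ h hm.2.1.2).const_mul 2)).add
    (tendsto_cut_compl hΩ h hm.2.2.2)).add (hl.const_mul 2)
  simp only [mul_zero, add_zero] at t
  refine squeeze_zero (fun n => hΩ.h11NormSq_nonneg _) (fun n => ?_) t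
  have := h11NormSq_cut_le hΩ (h n).contDiff_compl (h n).abs_compl_le (h n).abs_deriv_compl_le hw
  rwa [deriv_one_sub, l2wNormSq_cut_neg] at this

theorem exists_cutoff_seq : ∃ (δ : ℕ → ℝ) (χ : ℕ → ℝ → ℝ),
    ∀ n : ℕ, IsCutoff (1 / ((n : ℝ) + 1)) (δ n) (χ n) := by
  choose δ χ h using fun n : ℕ => exists_isCutoff (ε := 1 / ((n : ℝ) + 1)) (by positivity)
  exact ⟨δ, χ, h⟩

theorem ae_indicator_eq (hΩ : IsHalfPlaneOpen Ω) (f : Plane → ℂ) :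
    Ω.indicator f =ᵐ[volume.restrict Ω] f :=
  (ae_restrict_mem hΩ.isOpen.measurableSet).mono fun _ hp => indicator_of_mem hp _

/-- Test functions are dense in the space of scalar modes of index `0`. -/
theorem exists_isTest_zero (hΩ : IsHalfPlaneOpen Ω) (hw : MemH11Diamond Ω w) {ε : ℝ}
    (hε : 0 < ε) : ∃ ψ, IsTest Ω ψ ∧ h11NormSq Ω (w - ψ) < ε := by
  -- The energy estimate for the cutoff requires a bounded function, so `w` is first replaced by a
  -- smooth `φ` and `φ` is then cut off.
  obtain ⟨φ, h1, h2, h3, h4⟩ := hw.2 (ε / 4) (by positivity)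
  obtain ⟨δ, χ, hχ⟩ := exists_cutoff_seq
  have hφ := hΩ.memH11_of_contDiff h1 h2
  have hφ1 := (hΩ.memH11_iff.1 hφ).1
  obtain ⟨M, hM⟩ := h2.exists_bound_of_continuous h1.continuous
  obtain ⟨R, hR⟩ := (IsCompact.isBounded h2).exists_norm_le
  have hRb : ∀ p : Plane, φ p ≠ 0 → |p.2| ≤ max R 0 := fun p hp =>
    ((norm_snd_le p).trans (hR p (subset_tsupport _ hp))).trans (le_max_left _ _)
  have t1 : Tendsto (fun n => l2wNormSq 1 Ω (cut (deriv (χ n)) φ)) atTop (𝓝 0) := by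
    have t := tendsto_one_div_add_atTop_nhds_zero_nat (𝕜 := ℝ) |>.const_mul
      (M ^ 2 * (2 * max R 0))
    rw [mul_zero] at t
    exact squeeze_zero (fun n => hΩ.l2wNormSq_nonneg _ _) (fun n => (hχ n).integral_deriv_le hΩ
      (le_max_right _ _) hM hRb hφ1 (by positivity)) t
  have t2 := tendsto_h11NormSq_cut_compl hΩ hχ hφ t1
  obtain ⟨n, hn⟩ := (t2.eventually (gt_mem_nhds (show (0 : ℝ) < ε / 4 by positivity))).exists
  refine ⟨Ω.indicator (cut (χ n) φ), (hχ n).isTest hΩ h1 h2 h3, ?_⟩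
  have e : w - Ω.indicator (cut (χ n) φ) =ᵐ[volume.restrict Ω]
      (1 : ℂ) • (w - φ) + cut (fun r => 1 - χ n r) φ := by
    filter_upwards [ae_indicator_eq hΩ (cut (χ n) φ)] with p hp
    simp only [Pi.sub_apply, Pi.add_apply, hp, cut, sub_smul, one_smul]
    ring
  rw [hΩ.h11NormSq_congr e]
  have := hΩ.h11NormSq_smul_add_le 1 (hΩ.memH11_sub hw.1 hφ)
    (memH11_cut hΩ (hχ n).contDiff_compl (hχ n).abs_compl_le (hχ n).abs_deriv_compl_le hφ)
  rw [norm_one] at this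
  linarith

/-- Test functions are dense in the space of scalar modes of any index. -/
theorem exists_isTest (hΩ : IsHalfPlaneOpen Ω) (hw : MemMode Ω m w) {ε : ℝ} (hε : 0 < ε) :
    ∃ ψ, IsTest Ω ψ ∧ h11NormSq Ω (w - ψ) + (m : ℝ) ^ 2 * l2wNormSq (-1) Ω (w - ψ) < ε := by
  by_cases hm : m = 0
  · obtain ⟨ψ, h1, h2⟩ := exists_isTest_zero hΩ hw.1 hε
    exact ⟨ψ, h1, by simpa [hm] using h2⟩
  have hwV := hw.2 hm
  have hw1 := (hΩ.memH11_iff.1 hw.1.1).1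
  obtain ⟨δ, χ, hχ⟩ := exists_cutoff_seq
  -- For `m ≠ 0` the order is reversed: `w` itself is cut off, controlled by its `L²₋₁` norm, and is
  -- approximated only afterwards. An approximant `φ` is not known to be close to `w` in `L²₋₁` near
  -- the axis.
  have t1 : Tendsto (fun n => l2wNormSq 1 Ω (cut (deriv (χ n)) w)) atTop (𝓝 0) := by
    have t := ((tendsto_one_div_add_atTop_nhds_zero_nat (𝕜 := ℝ)).pow 2).mul_const
      (l2wNormSq (-1) Ω w)
    rw [zero_pow two_ne_zero, zero_mul] at t
    exact squeeze_zero (fun n => hΩ.l2wNormSq_nonneg _ _)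
      (fun n => (hχ n).integral_deriv_le_of_memL2w hΩ hw1 hwV) t
  have t2 := (tendsto_h11NormSq_cut_compl hΩ hχ hw.1.1 t1).add
    ((tendsto_cut_compl hΩ hχ (hΩ.memL2w_iff.1 hwV)).const_mul ((m : ℝ) ^ 2))
  rw [mul_zero, add_zero] at t2
  obtain ⟨n, hn⟩ := (t2.eventually (gt_mem_nhds (show (0 : ℝ) < ε / 4 by positivity))).exists
  set B : ℝ := 1 / ((n : ℝ) + 1) / δ n with hB
  -- Bound for multiplication by `χ n` from `H¹₁` to the norm of mode `m`: the Leibniz terms give `2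
  -- + 2B²`, the weight `r⁻¹` gives `m² δ⁻²`. It is fixed before `φ` is chosen, so `φ` can
  -- compensate for it.
  set C : ℝ := 2 + 2 * B ^ 2 + (m : ℝ) ^ 2 * (δ n)⁻¹ ^ 2 with hC
  have hC0 : 0 < C := by positivity
  obtain ⟨φ, h1, h2, h3, h4⟩ := hw.1.2 (ε / (4 * C)) (by positivity)
  have hφ := hΩ.memH11_of_contDiff h1 h2
  have hd := hΩ.memH11_sub hw.1.1 hφ
  have hdm := hΩ.memH11_iff.1 hd
  refine ⟨Ω.indicator (cut (χ n) φ), (hχ n).isTest hΩ h1 h2 h3, ?_⟩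
  have e : w - Ω.indicator (cut (χ n) φ) =ᵐ[volume.restrict Ω]
      (1 : ℂ) • cut (fun r => 1 - χ n r) w + cut (χ n) (w - φ) := by
    filter_upwards [ae_indicator_eq hΩ (cut (χ n) φ)] with p hp
    simp only [Pi.sub_apply, Pi.add_apply, hp, cut, sub_smul, one_smul,
      smul_sub]
    ring
  rw [hΩ.h11NormSq_congr e, hΩ.l2wNormSq_congr (-1) e]
  have hm1 := memH11_cut hΩ (hχ n).contDiff_compl (hχ n).abs_compl_le (hχ n).abs_deriv_compl_le
    hw.1.1
  have hm2 := memH11_cut hΩ (hχ n).contDiff (hχ n).abs_le (hχ n).deriv_bound hd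
  have k1 := hΩ.h11NormSq_smul_add_le 1 hm1 hm2
  obtain ⟨hv2, k3⟩ := (hχ n).memL2w_cut hΩ hdm.1
  have hv1 := memLp_cut (hχ n).contDiff_compl.continuous (hχ n).abs_compl_le
    (hΩ.memL2w_iff.1 hwV)
  have k2 := hΩ.l2wNormSq_add_le (-1) (hv1.const_smul (1 : ℂ)) (hΩ.memL2w_iff.1 hv2)
  rw [norm_one] at k1
  have k4 := h11NormSq_cut_le hΩ (hχ n).contDiff (hχ n).abs_le (hχ n).deriv_bound hd
  have hcc := (hχ n).contDiff.continuous
  have k5 := integral_cut_le hcc (hχ n).abs_le hdm.1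
  have k6 := integral_cut_le hcc (hχ n).abs_le hdm.2.1.2
  have k7 := integral_cut_le hcc (hχ n).abs_le hdm.2.2.2
  have k8 := integral_cut_le ((hχ n).contDiff.continuous_deriv (by simp)) (hχ n).deriv_bound hdm.1
  simp only [← hΩ.l2wNormSq_eq] at k5 k6 k7 k8
  have n1 := hΩ.l2wNormSq_nonneg 1 (w - φ)
  have n2 := hΩ.l2wNormSq_nonneg 1 (dr Ω (w - φ))
  have n3 := hΩ.l2wNormSq_nonneg 1 (dz Ω (w - φ))
  have hm0 : 0 ≤ (m : ℝ) ^ 2 := sq_nonneg _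
  have k9 : h11NormSq Ω (cut (χ n) (w - φ)) + (m : ℝ) ^ 2 * l2wNormSq (-1) Ω (cut (χ n) (w - φ))
      ≤ C * h11NormSq Ω (w - φ) := by
    have q1 := mul_le_mul_of_nonneg_left k3 hm0
    have q2 : 0 ≤ (2 * B ^ 2 + (m : ℝ) ^ 2 * (δ n)⁻¹ ^ 2) *
        (l2wNormSq 1 Ω (dr Ω (w - φ)) + l2wNormSq 1 Ω (dz Ω (w - φ))) := by positivity
    rw [h11NormSq] at k4
    rw [h11NormSq, h11NormSq, h11SemiSq, h11SemiSq, hC]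
    rw [h11SemiSq] at k4
    nlinarith
  rw [lt_div_iff₀ (by positivity)] at h4
  have k10 := mul_le_mul_of_nonneg_left k2 hm0
  rw [one_smul] at k1 k10 ⊢
  linarith

end Axisym

end

noncomputable section

namespace Axisym

open Filter Topology
open scoped ENNReal NNReal Real

/-! ### Lifting a function on the half section to a single Fourier mode -/

variable {D : Set Space} {ψ : Plane → ℂ} {m : ℤ}

/-- The horizontal part of a point, as a complex number. -/
def horizontal (p : Space) : ℂ := p.1.1 + p.1.2 * Complex.I

/-- The point of the meridian half plane on the circle through a point. -/
def meridian (p : Space) : Plane := (‖horizontal p‖, p.2)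

/-- The function `(2π)^(-1/2) ψ(r, z) e^(imθ)` in Cartesian coordinates. -/
def lift (m : ℤ) (ψ : Plane → ℂ) (p : Space) : ℂ :=
  ((√(2 * π) : ℝ) : ℂ)⁻¹ * (ψ (meridian p) * (horizontal p / ‖horizontal p‖) ^ m)

theorem contDiff_horizontal : ContDiff ℝ ∞ horizontal := by
  have h : ContDiff ℝ ∞ fun x : ℝ => (x : ℂ) := Complex.ofRealCLM.contDiff
  exact (h.comp (contDiff_fst.comp contDiff_fst)).add
    ((h.comp (contDiff_snd.comp contDiff_fst)).mul contDiff_const)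

theorem continuous_meridian : Continuous meridian :=
  contDiff_horizontal.continuous.norm.prodMk continuous_snd

theorem cyl_meridian (p : Space) : cyl (meridian p) (angle p) = p := by
  have h1 := Complex.norm_mul_cos_arg (horizontal p)
  have h2 := Complex.norm_mul_sin_arg (horizontal p)
  simp only [cyl, meridian, angle]
  refine Prod.ext (Prod.ext ?_ ?_) rfl
  · exact h1.trans (by simp [horizontal])
  · exact h2.trans (by simp [horizontal])

theorem horizontal_cyl (q : Plane) (θ : ℝ) :
    horizontal (cyl q θ) = q.1 * Complex.exp (θ * Complex.I) := by
  rw [Complex.exp_mul_I]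
  simp only [horizontal, cyl]
  push_cast
  ring

theorem norm_horizontal_cyl {q : Plane} (hq : 0 < q.1) (θ : ℝ) : ‖horizontal (cyl q θ)‖ = q.1 := by
  rw [horizontal_cyl, norm_mul, Complex.norm_exp_ofReal_mul_I, mul_one, Complex.norm_real,
    Real.norm_of_nonneg hq.le]

theorem meridian_cyl {q : Plane} (hq : 0 < q.1) (θ : ℝ) : meridian (cyl q θ) = q := by
  rw [meridian, norm_horizontal_cyl hq]
  rfl

theorem lift_cyl (m : ℤ) (ψ : Plane → ℂ) {q : Plane} (hq : 0 < q.1) (θ : ℝ) :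
    lift m ψ (cyl q θ) =
      ((√(2 * π) : ℝ) : ℂ)⁻¹ * (ψ q * Complex.exp (Complex.I * m * θ)) := by
  have hq' : (q.1 : ℂ) ≠ 0 := by exact_mod_cast hq.ne'
  rw [lift, meridian_cyl hq, norm_horizontal_cyl hq, horizontal_cyl, mul_div_cancel_left₀ _ hq',
    ← Complex.exp_int_mul]
  congr 3
  ring

theorem lift_sub (m : ℤ) (ψ φ : Plane → ℂ) : lift m (ψ - φ) = lift m ψ - lift m φ := by
  ext p
  simp only [lift, Pi.sub_apply]
  ring

theorem integral_exp_turn {n : ℤ} (hn : n ≠ 0) :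
    ∫ θ in (-π)..π, Complex.exp (Complex.I * n * θ) = 0 := by
  have hc : Complex.I * n ≠ 0 := mul_ne_zero Complex.I_ne_zero (by exact_mod_cast hn)
  rw [integral_exp_mul_complex hc]
  have : Complex.exp (Complex.I * n * (π : ℝ)) = Complex.exp (Complex.I * n * ((-π : ℝ) : ℂ)) := by
    rw [Complex.exp_eq_exp_iff_exists_int]
    refine ⟨n, ?_⟩
    push_cast
    ring
  rw [this, sub_self, zero_div]

/-- Orthogonality of the exponentials; the two factors `(2π)^{-1/2}` cancel the length of the
circle. -/
theorem mode_lift (j m : ℤ) (ψ : Plane → ℂ) {q : Plane} (hq : 0 < q.1) :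
    mode j (lift m ψ) q = if j = m then ψ q else 0 := by
  have e : ∀ θ : ℝ, lift m ψ (cyl q θ) * Complex.exp (-(Complex.I * (j : ℂ) * (θ : ℂ)))
      = ((√(2 * π) : ℝ) : ℂ)⁻¹ * ψ q * Complex.exp (Complex.I * ((m - j : ℤ) : ℂ) * θ) := by
    intro θ
    have h2 : Complex.I * ((m - j : ℤ) : ℂ) * θ
        = Complex.I * m * θ + -(Complex.I * (j : ℂ) * (θ : ℂ)) := by
      push_cast
      ring
    rw [lift_cyl m ψ hq, h2, Complex.exp_add]
    ring
  rw [mode]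
  simp only [e]
  rw [intervalIntegral.integral_const_mul]
  split_ifs with h
  · subst h
    have h2 : ((√(2 * π) : ℝ) : ℂ) * ((√(2 * π) : ℝ) : ℂ) = 2 * π := by
      rw [← Complex.ofReal_mul, Real.mul_self_sqrt (by positivity)]
      push_cast
      rfl
    have h3 : ((√(2 * π) : ℝ) : ℂ) ≠ 0 := by
      have : √(2 * π) ≠ 0 := by positivity
      exact_mod_cast this
    simp only [sub_self, Int.cast_zero, mul_zero, zero_mul, Complex.exp_zero,
      intervalIntegral.integral_const, sub_neg_eq_add, Complex.real_smul, mul_one]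
    push_cast
    field_simp
    linear_combination (-ψ q) * h2
  · rw [integral_exp_turn (sub_ne_zero.2 (Ne.symm h)), mul_zero, mul_zero]

theorem isCompact_meridian_preimage {K : Set Plane} (hK : IsCompact K) :
    IsCompact (meridian ⁻¹' K) := by
  refine Metric.isCompact_of_isClosed_isBounded (hK.isClosed.preimage continuous_meridian) ?_
  obtain ⟨R, hR⟩ := hK.isBounded.exists_norm_le
  refine isBounded_iff_forall_norm_le.2 ⟨R, fun p hp => ?_⟩
  have h := hR _ hp
  have h1 : ‖horizontal p‖ ≤ R := by
    refine le_trans ?_ h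
    exact (norm_norm _).symm.le.trans (norm_fst_le (meridian p))
  have hx : |p.1.1| ≤ ‖horizontal p‖ := by
    simpa [horizontal] using Complex.abs_re_le_norm (horizontal p)
  have hy : |p.1.2| ≤ ‖horizontal p‖ := by
    simpa [horizontal] using Complex.abs_im_le_norm (horizontal p)
  refine norm_prod_le_iff.2 ⟨norm_prod_le_iff.2 ⟨hx.trans h1, hy.trans h1⟩, ?_⟩
  exact (norm_snd_le (meridian p)).trans h

theorem contDiffAt_zpow_complex {f : Space → ℂ} {p : Space} (hf : ContDiffAt ℝ ∞ f p)
    (h0 : f p ≠ 0) (m : ℤ) : ContDiffAt ℝ ∞ (fun x => f x ^ m) p := by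
  cases m with
  | ofNat n => simpa using hf.pow n
  | negSucc n =>
    simp only [zpow_negSucc]
    exact (hf.pow (n + 1)).fun_inv (pow_ne_zero _ h0)

/-- Lifting preserves test functions. -/
theorem IsTest.lift (hψ : IsTest (halfSection D) ψ) (hD : IsAxisymmetricDomain D) (m : ℤ) :
    IsTest D (lift m ψ) := by
  set K := meridian ⁻¹' tsupport ψ with hK
  have hKc : IsCompact K := isCompact_meridian_preimage hψ.hasCompactSupport
  have hsupp : Function.support (Axisym.lift m ψ) ⊆ K := by
    intro p hp
    refine subset_tsupport _ fun h0 => hp ?_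
    simp [Axisym.lift, h0]
  have hts : tsupport (Axisym.lift m ψ) ⊆ K := closure_minimal hsupp hKc.isClosed
  have hKD : K ⊆ D := by
    intro p hp
    have h := hψ.tsupport_subset hp
    rw [← cyl_meridian p]
    exact hD.cyl_mem_iff.2 h.2
  refine ⟨contDiff_iff_contDiffAt.2 fun p => ?_, hKc.of_isClosed_subset (isClosed_tsupport _) hts,
    hts.trans hKD⟩
  -- On `K` the distance to the axis is positive, since `ψ` is supported in `r > 0`, so the norm and
  -- the phase are smooth there; off `K` the lift vanishes in a neighbourhood.
  by_cases hp : p ∈ K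
  · have h0 : horizontal p ≠ 0 := norm_pos_iff.1 (hψ.tsupport_subset hp).1
    have hh : ContDiffAt ℝ ∞ horizontal p := contDiff_horizontal.contDiffAt
    have hn : ContDiffAt ℝ ∞ (fun p => ‖horizontal p‖) p := hh.norm ℝ h0
    have hnc : ContDiffAt ℝ ∞ (fun p => ((‖horizontal p‖ : ℝ) : ℂ)) p :=
      Complex.ofRealCLM.contDiff.contDiffAt.comp p hn
    have hn0 : ((‖horizontal p‖ : ℝ) : ℂ) ≠ 0 := by exact_mod_cast norm_ne_zero_iff.2 h0
    have hdiv : ContDiffAt ℝ ∞ (fun p => horizontal p / ((‖horizontal p‖ : ℝ) : ℂ)) p := by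
      simp only [div_eq_mul_inv]
      exact hh.mul (hnc.fun_inv hn0)
    have hm : ContDiffAt ℝ ∞ meridian p := hn.prodMk contDiffAt_snd
    exact contDiffAt_const.mul ((hψ.contDiff.contDiffAt.comp p hm).mul
      (contDiffAt_zpow_complex hdiv (div_ne_zero h0 hn0) m))
  · refine (contDiffAt_const (c := (0 : ℂ))).congr_of_eventuallyEq ?_
    filter_upwards [hKc.isClosed.isOpen_compl.mem_nhds hp] with q hq
    by_contra hn
    exact hq (hsupp hn)

theorem modeSq_zero {Ω : Set Plane} (hΩ : IsHalfPlaneOpen Ω) (m : ℤ) : modeSq Ω m 0 = 0 := by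
  have h0 : HasWeakDeriv Ω (1, 0) (0 : Plane → ℂ) 0 := by
    have := hasWeakDeriv_of_contDiff (f := (0 : Plane → ℂ)) contDiff_const Ω (1, 0)
    simp only [fderiv_zero, Pi.zero_apply, _root_.zero_apply] at this
    exact this
  have h1 : HasWeakDeriv Ω (0, 1) (0 : Plane → ℂ) 0 := by
    have := hasWeakDeriv_of_contDiff (f := (0 : Plane → ℂ)) contDiff_const Ω (0, 1)
    simp only [fderiv_zero, Pi.zero_apply, _root_.zero_apply] at this
    exact this
  have hz : ∀ α, l2wNormSq α Ω 0 = 0 := fun α => by simp [l2wNormSq]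
  rw [modeSq, h11SemiSq, hΩ.l2wNormSq_congr 1 (hΩ.dr_ae_eq h0),
    hΩ.l2wNormSq_congr 1 (hΩ.dz_ae_eq h1), hz, hz]
  simp

theorem IsHalfPlaneOpen.modeSq_congr {Ω : Set Plane} (hΩ : IsHalfPlaneOpen Ω) {w w' : Plane → ℂ}
    (m : ℤ) (h : w =ᵐ[volume.restrict Ω] w') : modeSq Ω m w = modeSq Ω m w' := by
  rw [modeSq, modeSq, h11SemiSq_congr h, hΩ.l2wNormSq_congr _ h]

theorem IsHalfPlaneOpen.modeSq_nonneg {Ω : Set Plane} (hΩ : IsHalfPlaneOpen Ω) (m : ℤ)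
    (w : Plane → ℂ) : 0 ≤ modeSq Ω m w :=
  add_nonneg (hΩ.h11SemiSq_nonneg _) (mul_nonneg (sq_nonneg _) (hΩ.l2wNormSq_nonneg _ _))

theorem IsAxisymmetricDomain.mode_lift_ae (hD : IsAxisymmetricDomain D) (j m : ℤ)
    (ψ : Plane → ℂ) :
    mode j (lift m ψ) =ᵐ[volume.restrict (halfSection D)] if j = m then ψ else 0 := by
  filter_upwards [hD.isHalfPlaneOpen.ae_restrict_pos] with q hq
  rw [mode_lift j m ψ hq]
  split_ifs <;> rfl

/-- Functions with a single nonzero mode: the isometry. -/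
theorem IsAxisymmetricDomain.h1SemiSq_eq_modeSq (hD : IsAxisymmetricDomain D) {u : Space → ℂ}
    (hu : MemH10 D u) (h : ∀ j ≠ m, mode j u =ᵐ[volume.restrict (halfSection D)] 0) :
    h1SemiSq D u = modeSq (halfSection D) m (mode m u) := by
  refine (hD.hasSum_modeSq hu).unique (hasSum_single m fun j hj => ?_)
  rw [hD.isHalfPlaneOpen.modeSq_congr j (h j hj), modeSq_zero hD.isHalfPlaneOpen]

theorem IsTest.h1SemiSq_lift (hψ : IsTest (halfSection D) ψ) (hD : IsAxisymmetricDomain D)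
    (m : ℤ) : h1SemiSq D (Axisym.lift m ψ) = modeSq (halfSection D) m ψ := by
  rw [hD.h1SemiSq_eq_modeSq (m := m) ((hψ.lift hD m).memH10 hD.isOpen),
    hD.isHalfPlaneOpen.modeSq_congr m (by simpa using hD.mode_lift_ae m m ψ)]
  intro j hj
  simpa [hj] using hD.mode_lift_ae j m ψ

end Axisym

end

noncomputable section

namespace Axisym

open Filter Topology
open scoped ENNReal NNReal Real

/-! ### The Poincaré inequality and completeness -/

variable {D : Set Space} {u : Space → ℂ}

theorem norm_fderiv_le_sum (φ : Space → ℂ) (p : Space) :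
    ‖fderiv ℝ φ p‖ ≤ ∑ j, ‖partialDeriv j φ p‖ := by
  refine ContinuousLinearMap.opNorm_le_bound _ (Finset.sum_nonneg fun j _ => norm_nonneg _)
    fun v => ?_
  have hv : v = v.1.1 • cart 0 + v.1.2 • cart 1 + v.2 • cart 2 := by
    refine Prod.ext (Prod.ext ?_ ?_) ?_ <;> simp [cart]
  have h1 : |v.1.1| ≤ ‖v‖ := (norm_fst_le v.1).trans (norm_fst_le v)
  have h2 : |v.1.2| ≤ ‖v‖ := (norm_snd_le v.1).trans (norm_fst_le v)
  have h3 : |v.2| ≤ ‖v‖ := norm_snd_le v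
  calc ‖fderiv ℝ φ p v‖ = ‖v.1.1 • partialDeriv 0 φ p + v.1.2 • partialDeriv 1 φ p
        + v.2 • partialDeriv 2 φ p‖ := by
        conv_lhs => rw [hv]
        simp only [map_add, map_smul, partialDeriv]
    _ ≤ |v.1.1| * ‖partialDeriv 0 φ p‖ + |v.1.2| * ‖partialDeriv 1 φ p‖
        + |v.2| * ‖partialDeriv 2 φ p‖ := by
        refine (norm_add₃_le).trans ?_
        simp only [norm_smul, Real.norm_eq_abs, le_refl]
    _ ≤ ‖v‖ * ‖partialDeriv 0 φ p‖ + ‖v‖ * ‖partialDeriv 1 φ p‖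
        + ‖v‖ * ‖partialDeriv 2 φ p‖ := by gcongr
    _ = _ := by rw [Fin.sum_univ_three]; ring

/-- The Sobolev inequality for the exponent `2 < 3 = dim`, reduced to `L²` on the left because `D`
is bounded. -/
theorem exists_poincare_test (hD : Bornology.IsBounded D) :
    ∃ C : ℝ≥0, ∀ φ : Space → ℂ, IsTest D φ →
      eLpNorm φ 2 (volume.restrict D) ≤
        C * ∑ j, eLpNorm (partialDeriv j φ) 2 (volume.restrict D) := by
  refine ⟨eLpNormLESNormFDerivOfLeConst ℂ (volume : Measure Space) D 2 2, fun φ hφ => ?_⟩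
  have hs : φ.support ⊆ D := (subset_tsupport _).trans hφ.tsupport_subset
  have hdim : ((2 : ℝ≥0)) < (Module.finrank ℝ Space : ℝ≥0) := by
    simp only [Module.finrank_prod, Module.finrank_self]
    norm_num
  have key := eLpNorm_le_eLpNorm_fderiv (volume : Measure Space) (hφ.contDiff.of_le (by simp))
    hs (p := 2) (by norm_num) hdim hD
  refine (eLpNorm_mono_measure φ Measure.restrict_le_self).trans (key.trans ?_)
  gcongr
  calc eLpNorm (fderiv ℝ φ) 2 volume
      ≤ eLpNorm (∑ j, fun p => ‖partialDeriv j φ p‖) 2 volume := by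
        refine eLpNorm_mono_real fun p => ?_
        rw [Finset.sum_apply]
        exact norm_fderiv_le_sum φ p
    _ ≤ ∑ j, eLpNorm (fun p => ‖partialDeriv j φ p‖) 2 volume := by
        refine eLpNorm_sum_le (fun j _ => ?_) (by norm_num)
        exact (continuous_fderiv_apply_of_contDiff hφ.contDiff _).norm.aestronglyMeasurable
    _ = ∑ j, eLpNorm (partialDeriv j φ) 2 (volume.restrict D) := by
        refine Finset.sum_congr rfl fun j _ => ?_
        rw [eLpNorm_norm, eLpNorm_restrict_eq_of_support_subset]
        refine (subset_tsupport _).trans (Subset.trans ?_ hφ.tsupport_subset)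
        exact tsupport_fderiv_apply_subset ℝ (cart j)

theorem IsAxisymmetricDomain.exists_poincare_eLpNorm (hD : IsAxisymmetricDomain D) :
    ∃ C : ℝ≥0, ∀ u, MemH10 D u → eLpNorm u 2 (volume.restrict D) ≤
      C * ∑ j, eLpNorm (weakDeriv D (cart j) u) 2 (volume.restrict D) := by
  obtain ⟨C, hC⟩ := exists_poincare_test hD.isBounded
  refine ⟨C, fun u hu => ?_⟩
  obtain ⟨φ, h1, h2, h3⟩ := hD.exists_seq_test hu
  have hm := (memH1_iff hD.isOpen).1 hu.1
  have t : Tendsto (fun n => eLpNorm (φ n - u) 2 (volume.restrict D) +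
      C * ∑ j, (eLpNorm (weakDeriv D (cart j) u) 2 (volume.restrict D) +
        eLpNorm (partialDeriv j (φ n) - weakDeriv D (cart j) u) 2 (volume.restrict D))) atTop
      (𝓝 (0 + C * ∑ j, (eLpNorm (weakDeriv D (cart j) u) 2 (volume.restrict D) + 0))) :=
    h2.add (ENNReal.Tendsto.const_mul
      (tendsto_finsetSum _ fun j _ => tendsto_const_nhds.add (h3 j)) (Or.inr ENNReal.coe_ne_top))
  simp only [add_zero, zero_add] at t
  refine ge_of_tendsto' t fun n => ?_
  have hφ := memH1_of_contDiff (h1 n).contDiff (h1 n).hasCompactSupport D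
  have e1 : u = φ n - (φ n - u) := by abel
  calc eLpNorm u 2 (volume.restrict D)
      ≤ eLpNorm (φ n) 2 (volume.restrict D) + eLpNorm (φ n - u) 2 (volume.restrict D) := by
        conv_lhs => rw [e1]
        exact eLpNorm_sub_le hφ.1.aestronglyMeasurable (hφ.1.sub hm.1).aestronglyMeasurable
          (by norm_num)
    _ ≤ C * ∑ j, eLpNorm (partialDeriv j (φ n)) 2 (volume.restrict D)
        + eLpNorm (φ n - u) 2 (volume.restrict D) := by gcongr; exact hC _ (h1 n)
    _ ≤ _ := by
        rw [add_comm]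
        gcongr with j
        have hp := memLp_partialDeriv (h1 n).contDiff (h1 n).hasCompactSupport D j
        have e2 : partialDeriv j (φ n) = weakDeriv D (cart j) u +
          (partialDeriv j (φ n) - weakDeriv D (cart j) u) := by abel
        conv_lhs => rw [e2]
        exact eLpNorm_add_le (hm.2 j).2.aestronglyMeasurable
          (hp.sub (hm.2 j).2).aestronglyMeasurable (by norm_num)

/-- The **Poincaré inequality**. -/
theorem IsAxisymmetricDomain.exists_poincare (hD : IsAxisymmetricDomain D) :
    ∃ C : ℝ, 0 ≤ C ∧ ∀ u, MemH10 D u → ∫ p in D, ‖u p‖ ^ 2 ≤ C * h1SemiSq D u := by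
  obtain ⟨C, hC⟩ := hD.exists_poincare_eLpNorm
  -- The `3` comes from `(a + b + c)² ≤ 3 (a² + b² + c²)`, passing from the sum of the norms of the
  -- partial derivatives to the sum of squares.
  refine ⟨3 * (C : ℝ) ^ 2, by positivity, fun u hu => ?_⟩
  have hm := (memH1_iff hD.isOpen).1 hu.1
  have h := hC u hu
  have hfin : ∀ j ∈ Finset.univ, eLpNorm (weakDeriv D (cart j) u) 2 (volume.restrict D) ≠ ⊤ :=
    fun j _ => (hm.2 j).2.eLpNorm_ne_top
  have h' := ENNReal.toReal_mono (ENNReal.mul_ne_top ENNReal.coe_ne_top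
    (ENNReal.sum_ne_top.2 hfin)) h
  rw [ENNReal.toReal_mul, ENNReal.toReal_sum hfin, ENNReal.coe_toReal, Fin.sum_univ_three] at h'
  rw [h1SemiSq, Fin.sum_univ_three, integral_norm_sq_eq_toReal hm.1,
    integral_norm_sq_eq_toReal (hm.2 0).2, integral_norm_sq_eq_toReal (hm.2 1).2,
    integral_norm_sq_eq_toReal (hm.2 2).2]
  simp only [ENNReal.toReal_pow]
  set a := (eLpNorm (weakDeriv D (cart 0) u) 2 (volume.restrict D)).toReal
  set b := (eLpNorm (weakDeriv D (cart 1) u) 2 (volume.restrict D)).toReal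
  set c := (eLpNorm (weakDeriv D (cart 2) u) 2 (volume.restrict D)).toReal
  have h3 : (a + b + c) ^ 2 ≤ 3 * (a ^ 2 + b ^ 2 + c ^ 2) := by
    linarith [sq_nonneg (a - b), sq_nonneg (b - c), sq_nonneg (a - c)]
  calc _ ≤ ((C : ℝ) * (a + b + c)) ^ 2 := by gcongr
    _ = (C : ℝ) ^ 2 * (a + b + c) ^ 2 := by ring
    _ ≤ (C : ℝ) ^ 2 * (3 * (a ^ 2 + b ^ 2 + c ^ 2)) := by gcongr
    _ = _ := by ring

theorem IsAxisymmetricDomain.ae_eq_zero_of_h1SemiSq (hD : IsAxisymmetricDomain D)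
    (hu : MemH10 D u) (h : h1SemiSq D u = 0) : u =ᵐ[volume.restrict D] 0 := by
  obtain ⟨C, -, hC⟩ := hD.exists_poincare
  refine ae_eq_zero_of_integral_norm_sq hu.1.1 (le_antisymm ?_
    (integral_nonneg fun p => by positivity))
  simpa [h] using hC u hu

theorem exists_tendsto_eLpNorm_of_cauchy {α : Type*} [MeasurableSpace α] {ν : Measure α}
    {us : ℕ → α → ℂ} (hus : ∀ n, MemLp (us n) 2 ν) {b : ℕ → ℝ} (hb : Tendsto b atTop (𝓝 0))
    (h : ∀ N n, N ≤ n → ∫ x, ‖(us n - us N) x‖ ^ 2 ∂ν ≤ b N) :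
    ∃ u, MemLp u 2 ν ∧ Tendsto (fun n => eLpNorm (us n - u) 2 ν) atTop (𝓝 0) := by
  set f : ℕ → Lp ℂ 2 ν := fun n => (hus n).toLp (us n) with hf
  have hdist : ∀ n N, dist (f n) (f N) ^ 2 = ∫ x, ‖(us n - us N) x‖ ^ 2 ∂ν := fun n N => by
    rw [integral_norm_sq_eq_toReal ((hus n).sub (hus N)), Lp.dist_edist, Lp.edist_toLp_toLp,
      ENNReal.toReal_pow]
  have hc : CauchySeq f := by
    refine Metric.cauchySeq_iff'.2 fun ε hε => ?_
    obtain ⟨N, hN⟩ := (hb.eventually (gt_mem_nhds (show (0 : ℝ) < ε ^ 2 by positivity))).exists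
    refine ⟨N, fun n hn => ?_⟩
    refine lt_of_pow_lt_pow_left₀ 2 hε.le ?_
    rw [hdist]
    exact (h N n hn).trans_lt hN
  obtain ⟨g, hg⟩ := cauchySeq_tendsto_of_complete hc
  refine ⟨g, Lp.memLp g, ?_⟩
  refine (Lp.tendsto_Lp_iff_tendsto_eLpNorm'' us hus g (Lp.memLp g)).1 ?_
  rwa [Lp.toLp_coeFn]

/-- Completeness of `H¹₀` with respect to the semi-norm. -/
theorem IsAxisymmetricDomain.exists_tendsto_of_cauchy (hD : IsAxisymmetricDomain D)
    {us : ℕ → Space → ℂ} (hus : ∀ n, MemH10 D (us n)) {b : ℕ → ℝ} (hb : Tendsto b atTop (𝓝 0))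
    (h : ∀ N n, N ≤ n → h1SemiSq D (us n - us N) ≤ b N) :
    ∃ u, MemH10 D u ∧ Tendsto (fun n => eLpNorm (us n - u) 2 (volume.restrict D)) atTop (𝓝 0) := by
  obtain ⟨C, hC0, hC⟩ := hD.exists_poincare
  have hm := fun n => (memH1_iff hD.isOpen).1 (hus n).1
  have hCb : Tendsto (fun n => C * b n) atTop (𝓝 0) := by simpa using hb.const_mul C
  -- By the Poincaré inequality the functions are Cauchy in `L²` along with their derivatives. The
  -- limits of the derivatives are then the weak derivatives of the limit.
  obtain ⟨u, hu, hul⟩ := exists_tendsto_eLpNorm_of_cauchy (fun n => (hm n).1) hCb fun N n hn =>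
    (hC _ (memH10_sub hD.isOpen (hus n) (hus N))).trans (mul_le_mul_of_nonneg_left (h N n hn) hC0)
  have hj : ∀ j, ∃ g, MemLp g 2 (volume.restrict D) ∧ Tendsto (fun n =>
      eLpNorm (weakDeriv D (cart j) (us n) - g) 2 (volume.restrict D)) atTop (𝓝 0) := fun j => by
    refine exists_tendsto_eLpNorm_of_cauchy (fun n => ((hm n).2 j).2) hb fun N n hn => ?_
    refine le_trans ?_ (h N n hn)
    rw [← integral_norm_sq_congr (weakDeriv_sub hD.isOpen (hus n).1 (hus N).1 j), h1SemiSq]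
    exact Finset.single_le_sum (f := fun j => ∫ p in D, ‖weakDeriv D (cart j) (us n - us N) p‖ ^ 2)
      (fun j _ => integral_nonneg fun p => by positivity) (Finset.mem_univ j)
  choose g hg hgl using hj
  have hw : ∀ j, HasWeakDeriv D (cart j) u (g j) := fun j =>
    dominatesVolumeOn_restrict.hasWeakDeriv_of_tendsto hD.isOpen (fun n => (hm n).1)
      (fun n => ((hm n).2 j).2) (fun n => ((hm n).2 j).1) hu (hg j) hul (hgl j)
  have hu1 : MemH1 D u := ⟨hu, fun j => ⟨g j, hw j, hg j⟩⟩
  refine ⟨u, memH10_of_tendsto hD.isOpen hus hu1 ?_, hul⟩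
  rw [tendsto_h1NormSq_iff hD.isOpen fun n => memH1_sub hD.isOpen hu1 (hus n).1]
  refine ⟨?_, fun j => ?_⟩
  · simpa only [eLpNorm_sub_comm] using hul
  · refine (hgl j).congr fun n => ?_
    rw [eLpNorm_sub_comm]
    refine eLpNorm_congr_ae ?_
    filter_upwards [weakDeriv_sub hD.isOpen hu1 (hus n).1 j, (hw j).weakDeriv_ae_eq hD.isOpen]
      with p h1 h2
    rw [h1, Pi.sub_apply, Pi.sub_apply, h2]

end Axisym

end

noncomputable section

namespace Axisym

open Filter Topology
open scoped ENNReal NNReal Real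

/-! ### Surjectivity for scalar functions -/

/-! ### Linear structure of the spaces of scalar modes -/

section Modes

variable {Ω : Set Plane} {m : ℤ} {w w' : Plane → ℂ}

theorem VanishesOnOuter.congr (hΩ : IsHalfPlaneOpen Ω) (h : w =ᵐ[volume.restrict Ω] w')
    (hw : VanishesOnOuter Ω w) : VanishesOnOuter Ω w' := by
  intro ε hε
  obtain ⟨φ, h1, h2, h3, h4⟩ := hw ε hε
  refine ⟨φ, h1, h2, h3, ?_⟩
  rwa [← hΩ.h11NormSq_congr (h.sub (ae_eq_refl φ))]

theorem MemL2w.congr {α : ℤ} (hΩ : IsHalfPlaneOpen Ω) (h : w =ᵐ[volume.restrict Ω] w')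
    (hw : MemL2w α Ω w) : MemL2w α Ω w' :=
  hΩ.memL2w_iff.2 ((hΩ.memL2w_iff.1 hw).ae_eq (hΩ.ae_wt_iff.2 h))

theorem MemMode.congr (hΩ : IsHalfPlaneOpen Ω) (h : w =ᵐ[volume.restrict Ω] w')
    (hw : MemMode Ω m w) : MemMode Ω m w' :=
  ⟨⟨hΩ.memH11_congr h hw.1.1, hw.1.2.congr hΩ h⟩, fun hm => (hw.2 hm).congr hΩ h⟩

theorem MemMode.smul_add (hΩ : IsHalfPlaneOpen Ω) (c : ℂ) (hw : MemMode Ω m w)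
    (hw' : MemMode Ω m w') : MemMode Ω m (c • w + w') :=
  ⟨hΩ.memH11Diamond_smul_add c hw.1 hw'.1, fun hm => hΩ.memL2w_smul_add c (hw.2 hm) (hw'.2 hm)⟩

theorem MemMode.sub (hΩ : IsHalfPlaneOpen Ω) (hw : MemMode Ω m w) (hw' : MemMode Ω m w') :
    MemMode Ω m (w - w') := by
  have := hw'.smul_add hΩ (-1) hw
  rwa [neg_one_smul, neg_add_eq_sub] at this

theorem MemMode.modeSq_smul_add_le (hΩ : IsHalfPlaneOpen Ω) (c : ℂ) (hw : MemMode Ω m w)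
    (hw' : MemMode Ω m w') :
    modeSq Ω m (c • w + w') ≤ 2 * ‖c‖ ^ 2 * modeSq Ω m w + 2 * modeSq Ω m w' := by
  have h1 := hΩ.h11SemiSq_smul_add_le c hw.1.1 hw'.1.1
  have h2 : (m : ℝ) ^ 2 * l2wNormSq (-1) Ω (c • w + w') ≤
      (m : ℝ) ^ 2 * (2 * (‖c‖ ^ 2 * l2wNormSq (-1) Ω w) + 2 * l2wNormSq (-1) Ω w') := by
    by_cases hm : m = 0
    · simp [hm]
    · rw [← l2wNormSq_const_smul]
      exact mul_le_mul_of_nonneg_left (hΩ.l2wNormSq_add_le (-1)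
        ((hΩ.memL2w_iff.1 (hw.2 hm)).const_smul c) (hΩ.memL2w_iff.1 (hw'.2 hm))) (sq_nonneg _)
  unfold modeSq
  linarith

end Modes

variable {D : Set Space} {m : ℤ} {w : Plane → ℂ}

/-- `ψ` is the `m`-th mode of its lift, so membership is inherited from the result for `H¹₀(D)`. -/
theorem IsTest.memMode {ψ : Plane → ℂ} (hψ : IsTest (halfSection D) ψ)
    (hD : IsAxisymmetricDomain D) (m : ℤ) : MemMode (halfSection D) m ψ :=
  (hD.memMode_mode ((hψ.lift hD m).memH10 hD.isOpen) m).congr hD.isHalfPlaneOpen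
    (by simpa using hD.mode_lift_ae m m ψ)

/-- The Fourier coefficients of a limit. -/
theorem IsAxisymmetricDomain.mode_ae_eq_of_tendsto (hD : IsAxisymmetricDomain D)
    {us : ℕ → Space → ℂ} {u : Space → ℂ} (hus : ∀ n, MemLp (us n) 2 (volume.restrict D))
    (hu : MemLp u 2 (volume.restrict D))
    (hl : Tendsto (fun n => eLpNorm (us n - u) 2 (volume.restrict D)) atTop (𝓝 0))
    (hw : AEStronglyMeasurable w (wt 1 (halfSection D)))
    (h : Tendsto (fun n => eLpNorm (mode m (us n) - w) 2 (wt 1 (halfSection D))) atTop (𝓝 0)) :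
    mode m u =ᵐ[volume.restrict (halfSection D)] w := by
  have hm := fun n => hD.aestronglyMeasurable_mode (hus n).aestronglyMeasurable m
  have := ae_eq_of_tendsto_eLpNorm (c := fun _ => 1) hm hm hw
    (hD.aestronglyMeasurable_mode hu.aestronglyMeasurable m) h (hD.tendsto_mode hus hu hl m)
    fun n => Eventually.of_forall fun x => (one_mul _).symm
  simp only [one_mul] at this
  exact hD.isHalfPlaneOpen.ae_wt_iff.1 this

/-- Lifting is isometric on test functions, so the lifts of test functions approximating `w` are
Cauchy for the semi-norm. Their limit has the required modes because each mode is continuous in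
`L²`. -/
theorem IsAxisymmetricDomain.exists_mode_single (hD : IsAxisymmetricDomain D)
    (hw : MemMode (halfSection D) m w) : ∃ u, MemH10 D u ∧
      ∀ j, mode j u =ᵐ[volume.restrict (halfSection D)] if j = m then w else 0 := by
  have hΩ := hD.isHalfPlaneOpen
  choose ψ hψ hε using fun n : ℕ => exists_isTest hΩ hw (ε := 1 / ((n : ℝ) + 1)) (by positivity)
  have hψm := fun n => (hψ n).memMode hD m
  have hψl := fun n => (hψ n).lift hD m
  have hl2 := fun n => hΩ.l2wNormSq_nonneg 1 (w - ψ n)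
  have hms : ∀ n : ℕ, modeSq (halfSection D) m (w - ψ n) ≤ 1 / ((n : ℝ) + 1) := fun n => by
    have := hε n
    rw [h11NormSq] at this
    rw [modeSq]
    linarith [hl2 n]
  -- Comparing `ψ n` and `ψ N` through `w` costs `2/(n+1) + 2/(N+1)`, at most `4/(N+1)` for `n ≥ N`.
  have hb : Tendsto (fun n : ℕ => 4 * (1 / ((n : ℝ) + 1))) atTop (𝓝 0) := by
    simpa using (tendsto_one_div_add_atTop_nhds_zero_nat (𝕜 := ℝ)).const_mul 4
  obtain ⟨u, hu, hul⟩ := hD.exists_tendsto_of_cauchy (fun n => (hψl n).memH10 hD.isOpen) hb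
    fun N n hNn => by
      rw [← lift_sub, ((hψ n).sub (hψ N)).h1SemiSq_lift hD m]
      have e : ψ n - ψ N = (-1 : ℂ) • (w - ψ n) + (w - ψ N) := by
        rw [neg_one_smul]
        abel
      have k := MemMode.modeSq_smul_add_le hΩ (-1) (hw.sub hΩ (hψm n)) (hw.sub hΩ (hψm N))
      rw [norm_neg, norm_one] at k
      have k1 := hms n
      have k2 := hms N
      have k3 := Nat.one_div_le_one_div (α := ℝ) hNn
      rw [e]
      linarith
  refine ⟨u, hu, fun j => ?_⟩
  have hw1 := (hΩ.memH11_iff.1 hw.1.1).1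
  have hmeas : AEStronglyMeasurable (if j = m then w else 0) (wt 1 (halfSection D)) := by
    split_ifs
    exacts [hw1.aestronglyMeasurable, aestronglyMeasurable_zero]
  refine hD.mode_ae_eq_of_tendsto (fun n => (hψl n).memH1.1) hu.1.1 hul hmeas ?_
  have key : ∀ n, eLpNorm (mode j (lift m (ψ n)) - if j = m then w else 0) 2
      (wt 1 (halfSection D)) = eLpNorm (if j = m then ψ n - w else 0) 2 (wt 1 (halfSection D)) :=
    fun n => by
      refine eLpNorm_congr_ae (hΩ.ae_wt_iff.2 ?_)
      filter_upwards [hD.mode_lift_ae j m (ψ n)] with q hq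
      rw [Pi.sub_apply, hq]
      split_ifs <;> simp
  simp only [key]
  split_ifs with hj
  · have hs : ∀ n, MemLp (ψ n - w) 2 (wt 1 (halfSection D)) := fun n =>
      (hΩ.memH11_iff.1 (hψm n).1.1).1.sub hw1
    rw [tendsto_eLpNorm_iff hs]
    refine squeeze_zero (fun n => integral_nonneg fun p => by positivity) (fun n => ?_)
      (tendsto_one_div_add_atTop_nhds_zero_nat (𝕜 := ℝ))
    have e : ∫ p, ‖(ψ n - w) p‖ ^ 2 ∂(wt 1 (halfSection D))
        = l2wNormSq 1 (halfSection D) (w - ψ n) := by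
      rw [hΩ.l2wNormSq_eq]
      simp only [Pi.sub_apply, norm_sub_rev]
    rw [e]
    have k1 := hε n
    have k2 := hΩ.h11SemiSq_nonneg (w - ψ n)
    have k3 := mul_nonneg (sq_nonneg (m : ℝ)) (hΩ.l2wNormSq_nonneg (-1) (w - ψ n))
    rw [h11NormSq] at k1
    linarith
  · simp

theorem memH10_zero (hD : IsOpen D) : MemH10 D 0 :=
  IsTest.memH10 ⟨contDiff_const, HasCompactSupport.zero, by simp⟩ hD

theorem IsAxisymmetricDomain.mode_finsetSum (hD : IsAxisymmetricDomain D) {w : ℤ → Plane → ℂ}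
    {u : ℤ → Space → ℂ} (hu : ∀ m, MemH10 D (u m))
    (hm : ∀ m j, mode j (u m) =ᵐ[volume.restrict (halfSection D)] if j = m then w m else 0)
    (s : Finset ℤ) : MemH10 D (∑ m ∈ s, u m) ∧ ∀ j,
      mode j (∑ m ∈ s, u m) =ᵐ[volume.restrict (halfSection D)] if j ∈ s then w j else 0 := by
  classical
  induction s using Finset.induction_on with
  | empty =>
    refine ⟨memH10_zero hD.isOpen, fun j => Eventually.of_forall fun q => ?_⟩
    simp [mode]
  | insert a s ha ih =>
    rw [Finset.sum_insert ha]
    obtain ⟨ih1, ih2⟩ := ih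
    have e : u a + ∑ m ∈ s, u m = (1 : ℂ) • u a + ∑ m ∈ s, u m := by rw [one_smul]
    rw [e]
    refine ⟨memH10_smul_add hD.isOpen 1 (hu a) ih1, fun j => ?_⟩
    filter_upwards [hD.isHalfPlaneOpen.ae_wt_iff.1 (hD.mode_smul_add 1 (hu a).1.1 ih1.1.1 j), hm a j,
      ih2 j] with q h1 h2 h3
    rw [h1, Pi.add_apply, Pi.smul_apply, h2, h3, one_smul]
    by_cases hj : j = a
    · subst hj
      simp [ha]
    · simp [hj]

/-- Orthogonality of distinct modes, read off from the scalar isometry: the sum over all indices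
reduces to `s`. -/
theorem IsAxisymmetricDomain.h1SemiSq_finsetSum (hD : IsAxisymmetricDomain D)
    {w : ℤ → Plane → ℂ} {u : ℤ → Space → ℂ} (hu : ∀ m, MemH10 D (u m))
    (hm : ∀ m j, mode j (u m) =ᵐ[volume.restrict (halfSection D)] if j = m then w m else 0)
    (s : Finset ℤ) : h1SemiSq D (∑ m ∈ s, u m) = ∑ m ∈ s, modeSq (halfSection D) m (w m) := by
  obtain ⟨h1, h2⟩ := hD.mode_finsetSum hu hm s
  refine (hD.hasSum_modeSq h1).unique ?_
  have e : ∀ j, modeSq (halfSection D) j (mode j (∑ m ∈ s, u m))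
      = if j ∈ s then modeSq (halfSection D) j (w j) else 0 := fun j => by
    rw [hD.isHalfPlaneOpen.modeSq_congr j (h2 j)]
    split_ifs
    exacts [rfl, modeSq_zero hD.isHalfPlaneOpen j]
  simp only [e]
  have := hasSum_sum_of_ne_finset_zero (L := SummationFilter.unconditional ℤ) (s := s)
    (f := fun j => if j ∈ s then modeSq (halfSection D) j (w j) else 0)
    fun j hj => if_neg hj
  rwa [Finset.sum_congr rfl fun j hj => if_pos hj] at this

/-- Every square summable sequence of scalar modes is the sequence of Fourier coefficients of a
function in `H¹₀`. -/
theorem IsAxisymmetricDomain.exists_mode (hD : IsAxisymmetricDomain D) {w : ℤ → Plane → ℂ}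
    (hw : ∀ m, MemMode (halfSection D) m (w m))
    (hs : Summable fun m => modeSq (halfSection D) m (w m)) :
    ∃ u, MemH10 D u ∧ ∀ m, mode m u =ᵐ[volume.restrict (halfSection D)] w m := by
  choose u hu hm using fun m => hD.exists_mode_single (hw m)
  have hΩ := hD.isHalfPlaneOpen
  set I : ℕ → Finset ℤ := fun n => Finset.Icc (-(n : ℤ)) n with hI
  have hU := fun n => hD.mode_finsetSum hu hm (I n)
  -- By orthogonality, the semi-norm of the difference of two symmetric partial sums is bounded by
  -- this tail.
  have hb : Tendsto (fun n => (∑' m, modeSq (halfSection D) m (w m)) -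
      ∑ m ∈ I n, modeSq (halfSection D) m (w m)) atTop (𝓝 0) := by
    have : Tendsto (fun n => ∑ m ∈ I n, modeSq (halfSection D) m (w m)) atTop
      (𝓝 (∑' m, modeSq (halfSection D) m (w m))) := hs.hasSum.comp (Finset.tendsto_Icc_neg (R := ℤ))
    simpa using this.const_sub (∑' m, modeSq (halfSection D) m (w m))
  obtain ⟨v, hv, hvl⟩ := hD.exists_tendsto_of_cauchy (fun n => (hU n).1) hb fun N n hNn => by
    have hsub : I N ⊆ I n := Finset.Icc_subset_Icc (by omega) (by omega)
    have h1 := Finset.sum_sdiff (f := u) hsub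
    have h2 := Finset.sum_sdiff (f := fun m => modeSq (halfSection D) m (w m)) hsub
    have h3 := hs.sum_le_tsum (I n) fun m _ => hΩ.modeSq_nonneg m (w m)
    rw [← h1, add_sub_cancel_right, hD.h1SemiSq_finsetSum hu hm]
    linarith
  refine ⟨v, hv, fun j => ?_⟩
  refine hD.mode_ae_eq_of_tendsto (fun n => (hU n).1.1.1) hv.1.1 hvl
    (hΩ.memH11_iff.1 (hw j).1.1).1.aestronglyMeasurable ?_
  refine tendsto_const_nhds.congr' ?_
  filter_upwards [(Finset.tendsto_Icc_neg (R := ℤ)).eventually (eventually_ge_atTop {j})] with n hn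
  have hj : j ∈ I n := hn (Finset.mem_singleton_self j)
  have h := (hU n).2 j
  rw [if_pos hj] at h
  rw [eLpNorm_congr_ae (g := 0) ?_, eLpNorm_zero]
  filter_upwards [hΩ.ae_wt_iff.2 h] with q hq
  rw [Pi.sub_apply, hq, sub_self, Pi.zero_apply]

/-- For `m = 0` there is no term of order zero to exploit. Instead `w` is realised as the only mode
of a function in `H¹₀(D)` with the same semi-norm, where the Poincaré inequality applies. -/
theorem IsAxisymmetricDomain.ae_eq_zero_of_modeSq (hD : IsAxisymmetricDomain D)
    (hw : MemMode (halfSection D) m w) (h : modeSq (halfSection D) m w = 0) :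
    w =ᵐ[volume.restrict (halfSection D)] 0 := by
  have hΩ := hD.isHalfPlaneOpen
  obtain ⟨u, hu, hm⟩ := hD.exists_mode_single hw
  have h1 : mode m u =ᵐ[volume.restrict (halfSection D)] w := by simpa using hm m
  have h2 : u =ᵐ[volume.restrict D] 0 := by
    refine hD.ae_eq_zero_of_h1SemiSq hu ?_
    rw [hD.h1SemiSq_eq_modeSq hu (m := m) fun j hj => by simpa [hj] using hm j,
      hΩ.modeSq_congr m h1, h]
  filter_upwards [h1, hΩ.ae_wt_iff.1 (hD.mode_congr h2 m)] with q h3 h4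
  rw [← h3, h4]
  simp [mode]

end Axisym

end

noncomputable section

namespace Axisym

open Filter Topology
open scoped ENNReal NNReal Real

/-! ### Vector fields -/

variable {D : Set Space} {v w : Field3} {k : ℤ}

/-- The combination `v_x + i v_y`. -/
def cartPlus (v : Field3) : Space → ℂ := v 0 + Complex.I • v 1

/-- The combination `v_x - i v_y`. -/
def cartMinus (v : Field3) : Space → ℂ := v 0 - Complex.I • v 1

theorem half_cartPlus_add_half_cartMinus (v : Field3) :
    (1 / 2 : ℂ) • cartPlus v + (1 / 2 : ℂ) • cartMinus v = v 0 := by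
  ext p
  simp only [cartPlus, cartMinus, Pi.add_apply, Pi.sub_apply, Pi.smul_apply, smul_eq_mul]
  ring

theorem half_cartMinus_sub_half_cartPlus (v : Field3) :
    (-Complex.I / 2 : ℂ) • cartPlus v + (Complex.I / 2 : ℂ) • cartMinus v = v 1 := by
  ext p
  simp only [cartPlus, cartMinus, Pi.add_apply, Pi.sub_apply, Pi.smul_apply, smul_eq_mul]
  linear_combination (-v 1 p) * Complex.I_mul_I

theorem cartPlus_smul_add (c : ℂ) (v w : Field3) :
    cartPlus (c • v + w) = c • cartPlus v + cartPlus w := by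
  ext p
  simp only [cartPlus, Pi.add_apply, Pi.smul_apply, smul_eq_mul]
  ring

theorem cartMinus_smul_add (c : ℂ) (v w : Field3) :
    cartMinus (c • v + w) = c • cartMinus v + cartMinus w := by
  ext p
  simp only [cartMinus, Pi.add_apply, Pi.sub_apply, Pi.smul_apply, smul_eq_mul]
  ring

theorem memH10_const_smul (hD : IsOpen D) (c : ℂ) {u : Space → ℂ} (hu : MemH10 D u) :
    MemH10 D (c • u) := by
  simpa using memH10_smul_add hD c hu (memH10_zero hD)

theorem MemH10Vec.cartPlus (hD : IsOpen D) (hv : MemH10Vec D v) : MemH10 D (cartPlus v) := by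
  rw [Axisym.cartPlus, add_comm]
  exact memH10_smul_add hD _ (hv 1) (hv 0)

theorem MemH10Vec.cartMinus (hD : IsOpen D) (hv : MemH10Vec D v) : MemH10 D (cartMinus v) :=
  memH10_sub hD (hv 0) (memH10_const_smul hD _ (hv 1))

/-! ### Fourier coefficients of vector fields -/

theorem fourierCoef_two (v : Field3) (k : ℤ) : fourierCoef v k 2 = mode k (v 2) := rfl

theorem exp_turn_add_one (k : ℤ) (θ : ℝ) :
    Complex.exp (-(Complex.I * ((k + 1 : ℤ) : ℂ) * θ)) =
      Complex.exp (-(Complex.I * (k : ℂ) * θ)) * (Complex.cos θ - Complex.I * Complex.sin θ) := by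
  have h : -(Complex.I * ((k + 1 : ℤ) : ℂ) * θ) = -(Complex.I * (k : ℂ) * θ) + (-θ) * Complex.I := by
    push_cast
    ring
  rw [h, Complex.exp_add, Complex.exp_mul_I, Complex.cos_neg, Complex.sin_neg]
  ring

theorem exp_turn_sub_one (k : ℤ) (θ : ℝ) :
    Complex.exp (-(Complex.I * ((k - 1 : ℤ) : ℂ) * θ)) =
      Complex.exp (-(Complex.I * (k : ℂ) * θ)) * (Complex.cos θ + Complex.I * Complex.sin θ) := by
  have h : -(Complex.I * ((k - 1 : ℤ) : ℂ) * θ) = -(Complex.I * (k : ℂ) * θ) + θ * Complex.I := by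
    push_cast
    ring
  rw [h, Complex.exp_add, Complex.exp_mul_I]
  ring

theorem mode_add_mode {a b : Space → ℂ} {c d : ℂ} {m n : ℤ} {q : Plane} {f : ℝ → ℂ}
    (ha : MemLp (fun θ => a (cyl q θ)) 2 turn) (hb : MemLp (fun θ => b (cyl q θ)) 2 turn)
    (h : ∀ θ : ℝ, f θ = c * (a (cyl q θ) * Complex.exp (-(Complex.I * (m : ℂ) * θ)))
      + d * (b (cyl q θ) * Complex.exp (-(Complex.I * (n : ℂ) * θ)))) :
    ((√(2 * π) : ℝ) : ℂ)⁻¹ * ∫ θ in (-π)..π, f θ = c * mode m a q + d * mode n b q := by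
  simp only [h]
  rw [intervalIntegral.integral_of_le neg_pi_le_pi, mode_eq_integral_turn, mode_eq_integral_turn,
    integral_add ((integrable_slice ha m).const_mul c) ((integrable_slice hb n).const_mul d),
    integral_const_mul, integral_const_mul]
  ring

/-- `2 v_r = e^{-iθ} (v_x + i v_y) + e^{iθ} (v_x - i v_y)`, and the extra exponentials shift the
index by one. The identity holds at points whose circle carries square integrable data, where the
integral can be split. -/
theorem IsAxisymmetricDomain.fourierCoef_zero (hD : IsAxisymmetricDomain D) (hv : MemH10Vec D v)
    (k : ℤ) : fourierCoef v k 0 =ᵐ[volume.restrict (halfSection D)]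
      (1 / 2 : ℂ) • mode (k + 1) (cartPlus v) + (1 / 2 : ℂ) • mode (k - 1) (cartMinus v) := by
  have hp := hD.memLp_slice (hv.cartPlus hD.isOpen).1.1
  have hm := hD.memLp_slice (hv.cartMinus hD.isOpen).1.1
  filter_upwards [hD.isHalfPlaneOpen.ae_wt_iff.1 hp, hD.isHalfPlaneOpen.ae_wt_iff.1 hm] with q h1 h2
  refine mode_add_mode h1 h2 fun θ => ?_
  rw [exp_turn_add_one, exp_turn_sub_one]
  simp only [cylComp, cartPlus, cartMinus, Pi.add_apply, Pi.sub_apply, Pi.smul_apply, smul_eq_mul,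
    Matrix.cons_val_zero, cyl, Complex.ofReal_cos, Complex.ofReal_sin]
  linear_combination (v 1 ((q.1 * Real.cos θ, q.1 * Real.sin θ), q.2) * Complex.sin θ *
    Complex.exp (-(Complex.I * (k : ℂ) * θ))) * Complex.I_mul_I

theorem IsAxisymmetricDomain.fourierCoef_one (hD : IsAxisymmetricDomain D) (hv : MemH10Vec D v)
    (k : ℤ) : fourierCoef v k 1 =ᵐ[volume.restrict (halfSection D)]
      (-Complex.I / 2 : ℂ) • mode (k + 1) (cartPlus v)
        + (Complex.I / 2 : ℂ) • mode (k - 1) (cartMinus v) := by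
  have hp := hD.memLp_slice (hv.cartPlus hD.isOpen).1.1
  have hm := hD.memLp_slice (hv.cartMinus hD.isOpen).1.1
  filter_upwards [hD.isHalfPlaneOpen.ae_wt_iff.1 hp, hD.isHalfPlaneOpen.ae_wt_iff.1 hm] with q h1 h2
  refine mode_add_mode h1 h2 fun θ => ?_
  rw [exp_turn_add_one, exp_turn_sub_one]
  simp only [cylComp, cartPlus, cartMinus, Pi.add_apply, Pi.sub_apply, Pi.smul_apply, smul_eq_mul,
    Matrix.cons_val_one, Matrix.cons_val_zero, cyl, Complex.ofReal_cos, Complex.ofReal_sin]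
  linear_combination ((v 1 ((q.1 * Real.cos θ, q.1 * Real.sin θ), q.2) * Complex.cos θ -
    v 0 ((q.1 * Real.cos θ, q.1 * Real.sin θ), q.2) * Complex.sin θ) *
    Complex.exp (-(Complex.I * (k : ℂ) * θ))) * Complex.I_mul_I

theorem IsAxisymmetricDomain.plus_fourierCoef (hD : IsAxisymmetricDomain D) (hv : MemH10Vec D v)
    (k : ℤ) : plus (fourierCoef v k) =ᵐ[volume.restrict (halfSection D)]
      mode (k + 1) (cartPlus v) := by
  filter_upwards [hD.fourierCoef_zero hv k, hD.fourierCoef_one hv k] with q h0 h1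
  simp only [plus, Pi.add_apply, Pi.smul_apply, smul_eq_mul] at h0 h1 ⊢
  rw [h0, h1]
  linear_combination (1 / 2 * mode (k - 1) (cartMinus v) q - 1 / 2 * mode (k + 1) (cartPlus v) q) *
    Complex.I_mul_I

theorem IsAxisymmetricDomain.minus_fourierCoef (hD : IsAxisymmetricDomain D)
    (hv : MemH10Vec D v) (k : ℤ) :
    minus (fourierCoef v k) =ᵐ[volume.restrict (halfSection D)] mode (k - 1) (cartMinus v) := by
  filter_upwards [hD.fourierCoef_zero hv k, hD.fourierCoef_one hv k] with q h0 h1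
  simp only [minus, Pi.add_apply, Pi.sub_apply, Pi.smul_apply, smul_eq_mul] at h0 h1 ⊢
  rw [h0, h1]
  linear_combination (1 / 2 * mode (k + 1) (cartPlus v) q - 1 / 2 * mode (k - 1) (cartMinus v) q) *
    Complex.I_mul_I

/-! ### The isometric isomorphism -/

theorem IsAxisymmetricDomain.mode_congr_volume (hD : IsAxisymmetricDomain D) {a b : Space → ℂ}
    (h : a =ᵐ[volume.restrict D] b) (m : ℤ) :
    mode m a =ᵐ[volume.restrict (halfSection D)] mode m b :=
  hD.isHalfPlaneOpen.ae_wt_iff.1 (hD.mode_congr h m)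

theorem IsAxisymmetricDomain.fourierCoef_congr (hD : IsAxisymmetricDomain D)
    (hv : MemH10Vec D v) (hw : MemH10Vec D w) (h : ∀ i, v i =ᵐ[volume.restrict D] w i)
    (k : ℤ) (i : Fin 3) :
    fourierCoef v k i =ᵐ[volume.restrict (halfSection D)] fourierCoef w k i := by
  have hp : cartPlus v =ᵐ[volume.restrict D] cartPlus w := (h 0).add ((h 1).const_smul Complex.I)
  have hm : cartMinus v =ᵐ[volume.restrict D] cartMinus w :=
    (h 0).sub ((h 1).const_smul Complex.I)
  have hp' := hD.mode_congr_volume hp (k + 1)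
  have hm' := hD.mode_congr_volume hm (k - 1)
  match i with
  | 0 => exact (hD.fourierCoef_zero hv k).trans (((hp'.const_smul _).add (hm'.const_smul _)).trans
      (hD.fourierCoef_zero hw k).symm)
  | 1 => exact (hD.fourierCoef_one hv k).trans (((hp'.const_smul _).add (hm'.const_smul _)).trans
      (hD.fourierCoef_one hw k).symm)
  | 2 => exact hD.mode_congr_volume (h 2) k

theorem memH10Vec_smul_add (hD : IsOpen D) (c : ℂ) (hv : MemH10Vec D v) (hw : MemH10Vec D w) :
    MemH10Vec D (c • v + w) :=
  fun i => memH10_smul_add hD c (hv i) (hw i)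

theorem IsAxisymmetricDomain.fourierCoef_smul_add (hD : IsAxisymmetricDomain D) (c : ℂ)
    (hv : MemH10Vec D v) (hw : MemH10Vec D w) (k : ℤ) (i : Fin 3) :
    fourierCoef (c • v + w) k i =ᵐ[volume.restrict (halfSection D)]
      c • fourierCoef v k i + fourierCoef w k i := by
  have hvw := memH10Vec_smul_add hD.isOpen c hv hw
  have hΩ := hD.isHalfPlaneOpen
  have hp := hΩ.ae_wt_iff.1 (hD.mode_smul_add c (hv.cartPlus hD.isOpen).1.1
    (hw.cartPlus hD.isOpen).1.1 (k + 1))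
  have hm := hΩ.ae_wt_iff.1 (hD.mode_smul_add c (hv.cartMinus hD.isOpen).1.1
    (hw.cartMinus hD.isOpen).1.1 (k - 1))
  rw [← cartPlus_smul_add] at hp
  rw [← cartMinus_smul_add] at hm
  match i with
  | 0 =>
    filter_upwards [hD.fourierCoef_zero hv k, hD.fourierCoef_zero hw k, hD.fourierCoef_zero hvw k,
      hp, hm] with q h1 h2 h3 h4 h5
    simp only [Pi.add_apply, Pi.smul_apply, smul_eq_mul] at h1 h2 h3 h4 h5 ⊢
    rw [h1, h2, h3, h4, h5]
    ring
  | 1 =>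
    filter_upwards [hD.fourierCoef_one hv k, hD.fourierCoef_one hw k, hD.fourierCoef_one hvw k,
      hp, hm] with q h1 h2 h3 h4 h5
    simp only [Pi.add_apply, Pi.smul_apply, smul_eq_mul] at h1 h2 h3 h4 h5 ⊢
    rw [h1, h2, h3, h4, h5]
    ring
  | 2 => exact hΩ.ae_wt_iff.1 (hD.mode_smul_add c (hv 2).1.1 (hw 2).1.1 k)

theorem IsAxisymmetricDomain.memHkDiamond_fourierCoef (hD : IsAxisymmetricDomain D)
    (hv : MemH10Vec D v) (k : ℤ) : MemHkDiamond (halfSection D) k (fourierCoef v k) :=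
  hD.isHalfPlaneOpen.memHkDiamond_of_memMode
    ((hD.memMode_mode (hv.cartPlus hD.isOpen) _).congr hD.isHalfPlaneOpen
      (hD.plus_fourierCoef hv k).symm)
    ((hD.memMode_mode (hv.cartMinus hD.isOpen) _).congr hD.isHalfPlaneOpen
      (hD.minus_fourierCoef hv k).symm)
    (hD.memMode_mode (hv 2) k)

/-- The scalar isometry for `v_x + i v_y`, `v_x - i v_y` and `v_z`, with weights `1/2`, `1/2`, `1`
as in `hkSemi_sq`; the parallelogram identity restores the Cartesian components. -/
theorem IsAxisymmetricDomain.hasSum_hkSemi_sq (hD : IsAxisymmetricDomain D)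
    (hv : MemH10Vec D v) :
    HasSum (fun k => hkSemi (halfSection D) k (fourierCoef v k) ^ 2) (∑ i, h1SemiSq D (v i)) := by
  have hΩ := hD.isHalfPlaneOpen
  -- Summation over all integers is invariant under the shifts `k ↦ k ± 1`, so the modes can be
  -- regrouped by the wavenumber `k` of the vector field.
  have s1 := (Equiv.addRight (1 : ℤ)).hasSum_iff.2 (hD.hasSum_modeSq (hv.cartPlus hD.isOpen))
  have s2 := (Equiv.subRight (1 : ℤ)).hasSum_iff.2 (hD.hasSum_modeSq (hv.cartMinus hD.isOpen))
  have s := ((s1.mul_left (1 / 2)).add (s2.mul_left (1 / 2))).add (hD.hasSum_modeSq (hv 2))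
  have e : 1 / 2 * h1SemiSq D (cartPlus v) + 1 / 2 * h1SemiSq D (cartMinus v) + h1SemiSq D (v 2)
      = ∑ i, h1SemiSq D (v i) := by
    have := h1SemiSq_parallelogram hD.isOpen (hv 0).1 (hv 1).1
    rw [Fin.sum_univ_three, cartPlus, cartMinus]
    linarith
  rw [e] at s
  have hk : ∀ k, hkSemi (halfSection D) k (fourierCoef v k) ^ 2
      = 1 / 2 * modeSq (halfSection D) (k + 1) (mode (k + 1) (cartPlus v))
        + 1 / 2 * modeSq (halfSection D) (k - 1) (mode (k - 1) (cartMinus v))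
        + modeSq (halfSection D) k (mode k (v 2)) := fun k => by
    rw [hΩ.hkSemi_sq (hD.memHkDiamond_fourierCoef hv k).1,
      hΩ.modeSq_congr _ (hD.plus_fourierCoef hv k), hΩ.modeSq_congr _ (hD.minus_fourierCoef hv k),
      fourierCoef_two]
  simp only [hk]
  exact s

theorem IsAxisymmetricDomain.h1Semi_eq_l2SumNorm (hD : IsAxisymmetricDomain D)
    (hv : MemH10Vec D v) : h1Semi D v = l2SumNorm (halfSection D) (fourierCoef v) := by
  rw [h1Semi, l2SumNorm, (hD.hasSum_hkSemi_sq hv).tsum_eq]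

theorem IsAxisymmetricDomain.ae_eq_of_mode (hD : IsAxisymmetricDomain D) {a b : Space → ℂ}
    (ha : MemLp a 2 (volume.restrict D)) (hb : MemLp b 2 (volume.restrict D))
    (h : ∀ m, mode m a =ᵐ[volume.restrict (halfSection D)] mode m b) :
    a =ᵐ[volume.restrict D] b := by
  refine (hD.ae_eq_zero_of_mode (ha.sub hb) fun m => ?_).mono fun p hp => sub_eq_zero.1 hp
  filter_upwards [hD.mode_sub ha hb m, hD.isHalfPlaneOpen.ae_wt_iff.2 (h m)] with q h1 h2
  rw [h1, Pi.sub_apply, h2, sub_self, Pi.zero_apply]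

theorem ae_eq_of_cartPlus_cartMinus {ν : Measure Space} (hp : cartPlus v =ᵐ[ν] cartPlus w)
    (hm : cartMinus v =ᵐ[ν] cartMinus w) (h2 : v 2 =ᵐ[ν] w 2) (i : Fin 3) : v i =ᵐ[ν] w i := by
  match i with
  | 0 =>
    rw [← half_cartPlus_add_half_cartMinus v, ← half_cartPlus_add_half_cartMinus w]
    exact (hp.const_smul _).add (hm.const_smul _)
  | 1 =>
    rw [← half_cartMinus_sub_half_cartPlus v, ← half_cartMinus_sub_half_cartPlus w]
    exact (hp.const_smul _).add (hm.const_smul _)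
  | 2 => exact h2

theorem IsAxisymmetricDomain.ae_eq_of_fourierCoef (hD : IsAxisymmetricDomain D)
    (hv : MemH10Vec D v) (hw : MemH10Vec D w)
    (h : ∀ k i, fourierCoef v k i =ᵐ[volume.restrict (halfSection D)] fourierCoef w k i)
    (i : Fin 3) : v i =ᵐ[volume.restrict D] w i := by
  refine ae_eq_of_cartPlus_cartMinus ?_ ?_ ?_ i
  · refine hD.ae_eq_of_mode (hv.cartPlus hD.isOpen).1.1 (hw.cartPlus hD.isOpen).1.1 fun m => ?_
    have h1 := hD.plus_fourierCoef hv (m - 1)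
    have h2 := hD.plus_fourierCoef hw (m - 1)
    rw [sub_add_cancel] at h1 h2
    exact h1.symm.trans (((h _ 0).add ((h _ 1).const_smul Complex.I)).trans h2)
  · refine hD.ae_eq_of_mode (hv.cartMinus hD.isOpen).1.1 (hw.cartMinus hD.isOpen).1.1 fun m => ?_
    have h1 := hD.minus_fourierCoef hv (m + 1)
    have h2 := hD.minus_fourierCoef hw (m + 1)
    rw [add_sub_cancel_right] at h1 h2
    exact h1.symm.trans (((h _ 0).sub ((h _ 1).const_smul Complex.I)).trans h2)
  · exact hD.ae_eq_of_mode (hv 2).1.1 (hw 2).1.1 fun m => h m 2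

/-- The prescribed triples are reindexed as three sequences of scalar modes for `v_x + i v_y`, `v_x
- i v_y`, `v_z`, each solved by `exists_mode`; the Cartesian components follow by inverting the
combinations. -/
theorem IsAxisymmetricDomain.exists_fourierCoef (hD : IsAxisymmetricDomain D) {w : ℤ → Field2}
    (hw : MemL2Sum (halfSection D) w) : ∃ v : Field3, MemH10Vec D v ∧
      ∀ k i, fourierCoef v k i =ᵐ[volume.restrict (halfSection D)] w k i := by
  have hΩ := hD.isHalfPlaneOpen
  obtain ⟨hw, hs⟩ := hw
  have nn := fun m u => hΩ.modeSq_nonneg m u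
  -- Mode `m` of `v_x + i v_y` belongs to wavenumber `m - 1`. The factor `2` below undoes the `1/2`
  -- in `hkSemi_sq`.
  have sp : Summable fun m => modeSq (halfSection D) m (plus (w (m - 1))) := by
    rw [← (Equiv.addRight (1 : ℤ)).summable_iff]
    refine Summable.of_nonneg_of_le (fun k => nn _ _) (fun k => ?_) (hs.mul_left 2)
    simp only [Function.comp_apply, Equiv.coe_addRight, add_sub_cancel_right]
    linarith [hΩ.hkSemi_sq (hw k).1, nn (k - 1) (minus (w k)), nn k (w k 2)]
  have sm : Summable fun m => modeSq (halfSection D) m (minus (w (m + 1))) := by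
    rw [← (Equiv.subRight (1 : ℤ)).summable_iff]
    refine Summable.of_nonneg_of_le (fun k => nn _ _) (fun k => ?_) (hs.mul_left 2)
    simp only [Function.comp_apply, Equiv.subRight_apply, sub_add_cancel]
    linarith [hΩ.hkSemi_sq (hw k).1, nn (k + 1) (plus (w k)), nn k (w k 2)]
  have s2 : Summable fun m => modeSq (halfSection D) m (w m 2) := by
    refine Summable.of_nonneg_of_le (fun k => nn _ _) (fun k => ?_) hs
    linarith [hΩ.hkSemi_sq (hw k).1, nn (k + 1) (plus (w k)), nn (k - 1) (minus (w k))]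
  obtain ⟨p, hp, hpm⟩ := hD.exists_mode
    (fun m => by simpa using hΩ.memMode_plus (hw (m - 1))) sp
  obtain ⟨q, hq, hqm⟩ := hD.exists_mode
    (fun m => by simpa using hΩ.memMode_minus (hw (m + 1))) sm
  obtain ⟨s, hs', hsm⟩ := hD.exists_mode (fun m => hΩ.memMode_two (hw m)) s2
  set v : Field3 := ![(1 / 2 : ℂ) • p + (1 / 2 : ℂ) • q,
    (-Complex.I / 2 : ℂ) • p + (Complex.I / 2 : ℂ) • q, s] with hv
  have v0 : v 0 = (1 / 2 : ℂ) • p + (1 / 2 : ℂ) • q := rfl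
  have v1 : v 1 = (-Complex.I / 2 : ℂ) • p + (Complex.I / 2 : ℂ) • q := rfl
  have hvm : MemH10Vec D v := fun i => by
    match i with
    | 0 => exact memH10_smul_add hD.isOpen _ hp (memH10_const_smul hD.isOpen _ hq)
    | 1 => exact memH10_smul_add hD.isOpen _ hp (memH10_const_smul hD.isOpen _ hq)
    | 2 => exact hs'
  have ep : cartPlus v = p := by
    ext x
    simp only [cartPlus, v0, v1, Pi.add_apply, Pi.smul_apply, smul_eq_mul]
    linear_combination (1 / 2 * q x - 1 / 2 * p x) * Complex.I_mul_I
  have em : cartMinus v = q := by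
    ext x
    simp only [cartMinus, v0, v1, Pi.add_apply, Pi.sub_apply, Pi.smul_apply, smul_eq_mul]
    linear_combination (1 / 2 * p x - 1 / 2 * q x) * Complex.I_mul_I
  refine ⟨v, hvm, fun k i => ?_⟩
  have kp := hpm (k + 1)
  have km := hqm (k - 1)
  rw [add_sub_cancel_right, ← ep] at kp
  rw [sub_add_cancel, ← em] at km
  match i with
  | 0 =>
    refine (hD.fourierCoef_zero hvm k).trans ?_
    rw [← half_plus_add_half_minus (w k)]
    exact (kp.const_smul _).add (km.const_smul _)
  | 1 =>
    refine (hD.fourierCoef_one hvm k).trans ?_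
    rw [← half_minus_sub_half_plus (w k)]
    exact (kp.const_smul _).add (km.const_smul _)
  | 2 => exact hsm k

theorem IsAxisymmetricDomain.ae_eq_zero_of_h1Semi (hD : IsAxisymmetricDomain D)
    (hv : MemH10Vec D v) (h : h1Semi D v = 0) (i : Fin 3) : v i =ᵐ[volume.restrict D] 0 := by
  have nn : ∀ i ∈ Finset.univ, 0 ≤ h1SemiSq D (v i) := fun i _ => h1SemiSq_nonneg D (v i)
  rw [h1Semi, Real.sqrt_eq_zero (Finset.sum_nonneg nn), Finset.sum_eq_zero_iff_of_nonneg nn] at h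
  exact hD.ae_eq_zero_of_h1SemiSq (hv i) (h i (Finset.mem_univ i))

theorem IsAxisymmetricDomain.ae_eq_zero_of_hkSemi (hD : IsAxisymmetricDomain D) {v : Field2}
    (hv : MemHkDiamond (halfSection D) k v) (h : hkSemi (halfSection D) k v = 0) (i : Fin 3) :
    v i =ᵐ[volume.restrict (halfSection D)] 0 := by
  have hΩ := hD.isHalfPlaneOpen
  have e := hΩ.hkSemi_sq hv.1
  rw [h] at e
  have n1 := hΩ.modeSq_nonneg (k + 1) (plus v)
  have n2 := hΩ.modeSq_nonneg (k - 1) (minus v)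
  have n3 := hΩ.modeSq_nonneg k (v 2)
  have hp := hD.ae_eq_zero_of_modeSq (hΩ.memMode_plus hv) (by linarith)
  have hm := hD.ae_eq_zero_of_modeSq (hΩ.memMode_minus hv) (by linarith)
  have h2 := hD.ae_eq_zero_of_modeSq (hΩ.memMode_two hv) (by linarith)
  match i with
  | 0 =>
    rw [← half_plus_add_half_minus v]
    filter_upwards [hp, hm] with q h1 h2
    simp [h1, h2]
  | 1 =>
    rw [← half_minus_sub_half_plus v]
    filter_upwards [hp, hm] with q h1 h2
    simp [h1, h2]
  | 2 => exact h2

end Axisym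

end

/-! ### The theorem -/

theorem mainTheorem6 (D : Set Space) (hD : IsAxisymmetricDomain D)
    (Ω : Set Plane) (hΩ : Ω = halfSection D) :
    -- the Fourier coefficients are well defined on classes of functions equal almost everywhere
    (∀ v w : Field3, MemH10Vec D v → MemH10Vec D w →
      (∀ i, v i =ᵐ[volume.restrict D] w i) →
        ∀ k i, fourierCoef v k i =ᵐ[volume.restrict Ω] fourierCoef w k i) ∧
    -- the map is linear
    (∀ (c : ℂ) (v w : Field3), MemH10Vec D v → MemH10Vec D w →
      MemH10Vec D (c • v + w) ∧
      ∀ k i, fourierCoef (c • v + w) k i =ᵐ[volume.restrict Ω]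
        c • fourierCoef v k i + fourierCoef w k i) ∧
    -- it takes values in the `ℓ²`-sum and is isometric
    (∀ v : Field3, MemH10Vec D v →
      MemL2Sum Ω (fourierCoef v) ∧ h1Semi D v = l2SumNorm Ω (fourierCoef v)) ∧
    -- it is injective
    (∀ v w : Field3, MemH10Vec D v → MemH10Vec D w →
      (∀ k i, fourierCoef v k i =ᵐ[volume.restrict Ω] fourierCoef w k i) →
        ∀ i, v i =ᵐ[volume.restrict D] w i) ∧
    -- it is surjective
    (∀ w : ℤ → Field2, MemL2Sum Ω w →
      ∃ v : Field3, MemH10Vec D v ∧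
        ∀ k i, fourierCoef v k i =ᵐ[volume.restrict Ω] w k i) ∧
    -- the semi-norms are definite, hence norms, on the spaces in question
    (∀ v : Field3, MemH10Vec D v → h1Semi D v = 0 → ∀ i, v i =ᵐ[volume.restrict D] 0) ∧
    (∀ (k : ℤ) (v : Field2), MemHkDiamond Ω k v → hkSemi Ω k v = 0 →
      ∀ i, v i =ᵐ[volume.restrict Ω] 0) ∧
    -- explicit description of the spaces
    (∀ v : Field2, MemHkDiamond Ω 0 v ↔
      MemV11Diamond Ω (v 0) ∧ MemV11Diamond Ω (v 1) ∧ MemH11Diamond Ω (v 2)) ∧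
    (∀ (k : ℤ) (v : Field2), |k| = 1 → (MemHkDiamond Ω k v ↔
      MemH11Diamond Ω (v 0) ∧ MemH11Diamond Ω (v 1) ∧ MemV11Diamond Ω (v 2) ∧
        MemL2w (-1) Ω (fun p => v 0 p + Complex.I * (k : ℂ) * v 1 p))) ∧
    (∀ (k : ℤ) (v : Field2), 2 ≤ |k| → (MemHkDiamond Ω k v ↔
      MemV11Diamond Ω (v 0) ∧ MemV11Diamond Ω (v 1) ∧ MemV11Diamond Ω (v 2))) ∧
    -- explicit description of the semi-norms
    (∀ v : Field2, MemHkDiamond Ω 0 v →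
      hkSemi Ω 0 v ^ 2 = v11NormSq Ω (v 0) + v11NormSq Ω (v 1) + h11SemiSq Ω (v 2)) ∧
    (∀ (k : ℤ) (v : Field2), |k| = 1 → MemHkDiamond Ω k v →
      hkSemi Ω k v ^ 2 = h11SemiSq Ω (v 0) + h11SemiSq Ω (v 1) + v11NormSq Ω (v 2)
        + 2 * l2wNormSq (-1) Ω (fun p => v 0 p + Complex.I * (k : ℂ) * v 1 p)) ∧
    (∀ (k : ℤ) (v : Field2), 2 ≤ |k| → MemHkDiamond Ω k v →
      IntegrableOn (fun p : Plane =>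
        (v 1 p * (starRingEnd ℂ) (v 0 p) - v 0 p * (starRingEnd ℂ) (v 1 p)) *
          ((p.1⁻¹ : ℝ) : ℂ)) Ω ∧
      ((hkSemi Ω k v ^ 2 : ℝ) : ℂ) =
        (((∑ i, h11SemiSq Ω (v i))
          + (1 + (k : ℝ) ^ 2) * (l2wNormSq (-1) Ω (v 0) + l2wNormSq (-1) Ω (v 1))
          + (k : ℝ) ^ 2 * l2wNormSq (-1) Ω (v 2) : ℝ) : ℂ)
        + 2 * Complex.I * (k : ℂ) * ∫ p in Ω,
            (v 1 p * (starRingEnd ℂ) (v 0 p) - v 0 p * (starRingEnd ℂ) (v 1 p)) *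
              ((p.1⁻¹ : ℝ) : ℂ)) ∧
    -- the equivalent norms for `|k| ≥ 2`
    (∀ (k : ℤ) (v : Field2), 2 ≤ |k| → MemHkDiamond Ω k v →
      1 / 2 * hkStarSemi Ω k v ≤ hkSemi Ω k v ∧ hkSemi Ω k v ≤ 3 / 2 * hkStarSemi Ω k v) := by
  subst hΩ
  have hΩ := hD.isHalfPlaneOpen
  exact ⟨fun v w hv hw h => hD.fourierCoef_congr hv hw h,
    fun c v w hv hw => ⟨memH10Vec_smul_add hD.isOpen c hv hw, hD.fourierCoef_smul_add c hv hw⟩,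
    fun v hv => ⟨⟨hD.memHkDiamond_fourierCoef hv, (hD.hasSum_hkSemi_sq hv).summable⟩,
      hD.h1Semi_eq_l2SumNorm hv⟩,
    fun v w hv hw h => hD.ae_eq_of_fourierCoef hv hw h,
    fun w hw => hD.exists_fourierCoef hw,
    fun v hv h => hD.ae_eq_zero_of_h1Semi hv h,
    fun k v hv h => hD.ae_eq_zero_of_hkSemi hv h,
    fun v => hΩ.memHkDiamond_zero_iff,
    fun k v hk => hΩ.memHkDiamond_iff_of_one hk,
    fun k v hk => hΩ.memHkDiamond_iff_of_two_le hk,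
    fun v hv => hΩ.hkSemi_zero_sq hv,
    fun k v hk hv => hΩ.hkSemi_one_sq hk hv,
    fun k v hk hv => hΩ.hkSemi_sq_of_two_le hk hv,
    fun k v hk hv => hΩ.hkSemi_sq_bounds hk hv⟩
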